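/- **Setting.** An obstacle $\omega$ is the closed region bounded by a simple polygon with horizontal and vertical edges, no three of whose vertices are collinear, such that any two points of $\omega$ are joined by a shortest rectilinear path inside $\omega$. Its extreme edges are the edges that lie on the boundary of its bounding box; an extreme corner is a vertex at which two extreme edges meet. $\omega$ is a partial staircase if it has exactly one extreme corner $c$; let $e_1,e_2$ be the two extreme edges not incident with $c$. A set $S$ of closed line segments inside $\omega$ is a skeleton if for all points $p,q$ outside the interior of $\omega$: if every shortest rectilinear path from $p$ to $q$ with at most one corner meets the interior of $\omega$, then each such path meets an element of $S$. A minimum skeleton is a skeleton with the smallest possible number of segments. A visibility edge is a segment inside $\omega$ that cannot be extended at either end inside $\omega$. Two extreme edges are mutually visible if some segment inside $\omega$ has an endpoint on each. A cross is a pair of segments inside $\omega$, one with an endpoint on each horizontal extreme edge, the other with an endpoint on each vertical extreme edge. The horizontal (vertical) advancement of a visibility edge is measured at its leading endpoint, in the direction of $c$: it is larger when this endpoint is horizontally (vertically) closer to $c$. A maximal extreme visibility edge for $e_i$ is one that, among all visibility edges with an endpoint on $e_i$, maximises at its other endpoint first the advancement perpendicular to $e_i$ and, subject to this, the advancement parallel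 to $e_i$. For a set $S$ of segments with bounding box $B(S)$, a frontier of $S$ is the closure of a connected component of $\partial B(S)\cap\operatorname{int}\omega$. A maximal frontier visibility edge for a frontier $f$ is one that, among all visibility edges meeting $f$, maximises first the horizontal and then the vertical advancement if $f$ is vertical, first the vertical and then the horizontal if $f$ is horizontal, and does so in either of these orders if $f$ is L-shaped. **PartialStaircaseSkeleton**$(\omega)$. If $\omega$ has a cross, return a cross. Otherwise, if $e_1,e_2$ are mutually visible, let $S=\{s_{12}\}$ where $s_{12}$ is a longest segment inside $\omega$ with endpoints on $e_1$ and $e_2$; if not, let $S=\{s_1,s_2\}$ where $s_i$ is a maximal extreme visibility edge for $e_i$, and return $S$ if it has no frontier. Then continue with StaircaseSkeleton with termination frontier $c$: let $f$ be a frontier of $S$; add to $S$ a maximal frontier visibility edge $s$ for $f$; if $c\in s$, return $S$; otherwise repeat with a frontier $f$ of the new $S$. **Theorem.** For every partial staircase obstacle $\omega$, whatever choices are made, PartialStaircaseSkeleton$(\omega)$ never gets stuck, stops after finitely many steps, and returns a minimum skeleton for $\omega$. -/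

import Mathlib

namespace RectSkeleton

/-! ### The rectilinear plane -/

/-- Points of the plane; only the affine structure, the topology and the two coordinates are used
(lengths are given explicitly below, so the sup metric of the product plays no role). -/
abbrev Plane : Type := ℝ × ℝ

/-- The rectilinear distance. -/
noncomputable def l1Dist (p q : Plane) : ℝ := |p.1 - q.1| + |p.2 - q.2|

/-- The Euclidean length of the segment from `p` to `q`. -/
noncomputable def euclLength (p q : Plane) : ℝ := Real.sqrt ((p.1 - q.1) ^ 2 + (p.2 - q.2) ^ 2)

/-- All points of `A` have the same second coordinate. -/
def IsHorizontal (A : Set Plane) : Prop := ∃ y : ℝ, ∀ p ∈ A, p.2 = y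

/-- All points of `A` have the same first coordinate. -/
def IsVertical (A : Set Plane) : Prop := ∃ x : ℝ, ∀ p ∈ A, p.1 = x

/-- `RectPathIn A p q L`: there is a rectilinear path (finitely many horizontal and vertical
segments) of total length `L` from `p` to `q` inside `A`. -/
inductive RectPathIn (A : Set Plane) : Plane → Plane → ℝ → Prop
  | refl (p : Plane) (hp : p ∈ A) : RectPathIn A p p 0
  | step (p r q : Plane) (L : ℝ) (haxis : p.1 = r.1 ∨ p.2 = r.2) (hseg : segment ℝ p r ⊆ A)
      (hrest : RectPathIn A r q L) : RectPathIn A p q (l1Dist p r + L)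

/-- Any two points of `A` are joined by a shortest rectilinear path inside `A`. A rectilinear path
is shortest exactly if its length is the rectilinear distance of its ends. -/
def RectConvex (A : Set Plane) : Prop := ∀ p ∈ A, ∀ q ∈ A, RectPathIn A p q (l1Dist p q)

/-- The bounding box of a bounded non-empty set: the smallest closed axis-parallel rectangle
containing it (`Set.Icc` for the coordinatewise order). -/
noncomputable def boundingBox (A : Set Plane) : Set Plane :=
  Set.Icc (sInf (Prod.fst '' A), sInf (Prod.snd '' A)) (sSup (Prod.fst '' A), sSup (Prod.snd '' A))

/-! ### Obstacles -/

/-- A rectilinearly-convex obstacle: the closed bounded region of a simple rectilinear polygon,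
no three of whose vertices are collinear, that is moreover rectilinearly convex. The vertices are
listed cyclically. -/
structure Obstacle where
  /-- the closed region -/
  region : Set Plane
  /-- the number of vertices -/
  n : ℕ
  four_le : 4 ≤ n
  /-- the vertices in cyclic order -/
  vertex : ZMod n → Plane
  vertex_injective : Function.Injective vertex
  rectilinear : ∀ i, (vertex i).1 = (vertex (i + 1)).1 ∨ (vertex i).2 = (vertex (i + 1)).2
  consecutive_edges : ∀ i, segment ℝ (vertex i) (vertex (i + 1)) ∩
      segment ℝ (vertex (i + 1)) (vertex (i + 1 + 1)) = {vertex (i + 1)}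
  disjoint_edges : ∀ i j, j ≠ i → j ≠ i + 1 → i ≠ j + 1 →
      Disjoint (segment ℝ (vertex i) (vertex (i + 1))) (segment ℝ (vertex j) (vertex (j + 1)))
  general_position : ∀ i j k, i ≠ j → i ≠ k → j ≠ k →
      ¬ Collinear ℝ ({vertex i, vertex j, vertex k} : Set Plane)
  bounded : Bornology.IsBounded region
  regular : closure (interior region) = region
  boundary_eq : frontier region = ⋃ i, segment ℝ (vertex i) (vertex (i + 1))
  convex : RectConvex region

namespace Obstacle

/-- The `i`-th edge of the boundary. -/
def edge (ω : Obstacle) (i : ZMod ω.n) : Set Plane :=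
  segment ℝ (ω.vertex i) (ω.vertex (i + 1))

/-- The extreme edges: the edges that lie on the boundary of the bounding box. -/
def IsExtremeEdge (ω : Obstacle) (e : Set Plane) : Prop :=
  (∃ i, e = ω.edge i) ∧ e ⊆ frontier (boundingBox ω.region)

/-- The extreme corners: the vertices at the intersection of two extreme edges. -/
def IsExtremeCorner (ω : Obstacle) (c : Plane) : Prop :=
  (∃ i, c = ω.vertex i) ∧
    ∃ e e', ω.IsExtremeEdge e ∧ ω.IsExtremeEdge e' ∧ e ≠ e' ∧ c ∈ e ∧ c ∈ e'

/-- `ω` is a partial staircase: it has exactly one extreme corner, namely `c`. -/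
def IsPartialStaircase (ω : Obstacle) (c : Plane) : Prop :=
  ω.IsExtremeCorner c ∧ ∀ c', ω.IsExtremeCorner c' → c' = c

/-! ### Skeletons -/

/-- `P` is a shortest rectilinear path from `p` to `q` with at most one corner point. If `p` and `q`
lie on a common horizontal or vertical line, both descriptions give the segment from `p` to `q`. -/
def _root_.RectSkeleton.IsOneCornerPath (p q : Plane) (P : Set Plane) : Prop :=
  P = segment ℝ p (p.1, q.2) ∪ segment ℝ (p.1, q.2) q ∨
    P = segment ℝ p (q.1, p.2) ∪ segment ℝ (q.1, p.2) q

/-- `S` is a skeleton for `ω`: a set of closed line segments inside `ω` such that for all points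
`p`, `q` outside the interior of `ω`, if every shortest rectilinear path from `p` to `q` with at
most one corner point meets the interior of `ω`, then each such path meets an element of `S`. -/
def IsSkeleton (ω : Obstacle) (S : Set (Set Plane)) : Prop :=
  (∀ s ∈ S, (∃ a b : Plane, a ≠ b ∧ s = segment ℝ a b) ∧ s ⊆ ω.region) ∧
    ∀ p q : Plane, p ∉ interior ω.region → q ∉ interior ω.region →
      (∀ P, IsOneCornerPath p q P → (P ∩ interior ω.region).Nonempty) →
        ∀ P, IsOneCornerPath p q P → ∃ s ∈ S, (P ∩ s).Nonempty

/-- A skeleton with the smallest possible number of line segments. -/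
def IsMinimumSkeleton (ω : Obstacle) (S : Set (Set Plane)) : Prop :=
  ω.IsSkeleton S ∧ ∀ S', ω.IsSkeleton S' → S.encard ≤ S'.encard

/-! ### Visibility edges -/

/-- The segment from `a` to `b` is a maximum length visibility edge: it is inside `ω` and cannot be
extended at either end inside `ω`. -/
def IsVisibilityEdge (ω : Obstacle) (a b : Plane) : Prop :=
  a ≠ b ∧ segment ℝ a b ⊆ ω.region ∧
    ∀ a' b', segment ℝ a b ⊆ segment ℝ a' b' → segment ℝ a' b' ⊆ ω.region →
      segment ℝ a' b' = segment ℝ a b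

/-- `e₁` and `e₂` are mutually visible. -/
def MutuallyVisible (ω : Obstacle) (e₁ e₂ : Set Plane) : Prop :=
  ∃ a ∈ e₁, ∃ b ∈ e₂, segment ℝ a b ⊆ ω.region

/-- `s` is a line segment inside `ω` with an endpoint on each of `e` and `e'`. -/
def Joins (ω : Obstacle) (s e e' : Set Plane) : Prop :=
  ∃ a ∈ e, ∃ b ∈ e', s = segment ℝ a b ∧ s ⊆ ω.region

/-- `sH`, `sV` form a cross: `sH` has an endpoint on each horizontal extreme edge, and `sV` has an
endpoint on each vertical extreme edge. -/
def IsCross (ω : Obstacle) (sH sV : Set Plane) : Prop :=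
  (∃ e e', ω.IsExtremeEdge e ∧ ω.IsExtremeEdge e' ∧ e ≠ e' ∧ IsHorizontal e ∧ IsHorizontal e' ∧
      ω.Joins sH e e') ∧
    ∃ e e', ω.IsExtremeEdge e ∧ ω.IsExtremeEdge e' ∧ e ≠ e' ∧ IsVertical e ∧ IsVertical e' ∧
      ω.Joins sV e e'

/-- `ω` has a cross. -/
def HasCross (ω : Obstacle) : Prop := ∃ sH sV, ω.IsCross sH sV

/-- `s` is a line segment inside `ω` with endpoints on `e₁` and `e₂`, of maximum length among
these. -/
def IsMaxLengthAdjacent (ω : Obstacle) (e₁ e₂ s : Set Plane) : Prop :=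
  ∃ a ∈ e₁, ∃ b ∈ e₂, s = segment ℝ a b ∧ segment ℝ a b ⊆ ω.region ∧
    ∀ a' ∈ e₁, ∀ b' ∈ e₂, segment ℝ a' b' ⊆ ω.region → euclLength a' b' ≤ euclLength a b

/-! ### Advancement

A visibility edge advances towards the extreme corner `c`, which is a corner of the bounding box;
its advancement is that of its leading endpoint. All of `ω` is on one side of the horizontal and of
the vertical line through `c`, and what has been covered already is an interval on the side away
from `c`. Hence a larger horizontal (vertical) advancement towards `c` is the same as a smaller
horizontal (vertical) distance from the leading endpoint to `c`. -/

/-- `v` is at least as advanced towards `c` as `w`: first horizontally and, if the horizontal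
advancements agree, vertically. -/
def _root_.RectSkeleton.AdvancesHV (c v w : Plane) : Prop :=
  |v.1 - c.1| < |w.1 - c.1| ∨ (|v.1 - c.1| = |w.1 - c.1| ∧ |v.2 - c.2| ≤ |w.2 - c.2|)

/-- `v` is at least as advanced towards `c` as `w`: first vertically and, if the vertical
advancements agree, horizontally. -/
def _root_.RectSkeleton.AdvancesVH (c v w : Plane) : Prop :=
  |v.2 - c.2| < |w.2 - c.2| ∨ (|v.2 - c.2| = |w.2 - c.2| ∧ |v.1 - c.1| ≤ |w.1 - c.1|)

/-- `s` is a maximal extreme visibility edge for the extreme edge `e` (not incident with `c`):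
among the visibility edges with an endpoint `u` on `e`, its other endpoint `v` maximises the
advancement perpendicular to `e` and, subject to this, the advancement parallel to `e`. -/
def IsMaximalExtremeEdge (ω : Obstacle) (c : Plane) (e s : Set Plane) : Prop :=
  ∃ u v, s = segment ℝ u v ∧ u ∈ e ∧ ω.IsVisibilityEdge u v ∧
    ((IsHorizontal e ∧ ∀ u' v', u' ∈ e → ω.IsVisibilityEdge u' v' → AdvancesVH c v v') ∨
      (IsVertical e ∧ ∀ u' v', u' ∈ e → ω.IsVisibilityEdge u' v' → AdvancesHV c v v'))

/-- `f` is a frontier of the set `S` of segments: the closure of a connected component of the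
intersection of the boundary of the bounding box of `S` with the interior of `ω`. -/
def IsFrontier (ω : Obstacle) (S : Set (Set Plane)) (f : Set Plane) : Prop :=
  ∃ p ∈ frontier (boundingBox (⋃₀ S)) ∩ interior ω.region,
    f = closure (connectedComponentIn (frontier (boundingBox (⋃₀ S)) ∩ interior ω.region) p)

/-- The segment from `u` to `v` is a visibility edge that meets the frontier `f`. -/
def IsFrontierEdge (ω : Obstacle) (f : Set Plane) (u v : Plane) : Prop :=
  ω.IsVisibilityEdge u v ∧ (segment ℝ u v ∩ f).Nonempty

/-- `s` is a maximal frontier visibility edge for `f`, with leading endpoint `v`. If `f` is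
vertical, it maximises the horizontal and then the vertical advancement; if `f` is horizontal, the
vertical and then the horizontal advancement; if `f` is neither (it is L-shaped), one of these
two orders is used. The competitors `u' v'` occur with both orientations, so that `v` is compared
with both endpoints of every frontier visibility edge. -/
def IsMaximalFrontierEdge (ω : Obstacle) (c : Plane) (f s : Set Plane) : Prop :=
  ∃ u v, s = segment ℝ u v ∧ ω.IsFrontierEdge f u v ∧
    ((¬ IsHorizontal f ∧ ∀ u' v', ω.IsFrontierEdge f u' v' → AdvancesHV c v v') ∨
      (¬ IsVertical f ∧ ∀ u' v', ω.IsFrontierEdge f u' v' → AdvancesVH c v v'))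

/-! ### The algorithms, as nondeterministic transition systems -/

/-- The states of the algorithm, with the set of edges constructed so far. -/
inductive _root_.RectSkeleton.State : Type
  /-- at the head of the loop of StaircaseSkeleton, with current frontier `f` -/
  | loop (S : Set (Set Plane)) (f : Set Plane)
  /-- about to compute the frontier of `S` -/
  | advance (S : Set (Set Plane))
  /-- stopped, returning `S` -/
  | halt (S : Set (Set Plane))

/-- The steps of StaircaseSkeleton with termination frontier `{c}`: add a maximal frontier
visibility edge `s` for the current frontier; stop if `s` meets the termination frontier; otherwise
pass to the new frontier. The edges constructed before the call belong to `S`. -/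
inductive StaircaseStep (ω : Obstacle) (c : Plane) : State → State → Prop
  | finish (S : Set (Set Plane)) (f s : Set Plane) (hs : ω.IsMaximalFrontierEdge c f s)
      (hc : (s ∩ {c}).Nonempty) : StaircaseStep ω c (State.loop S f) (State.halt (insert s S))
  | add (S : Set (Set Plane)) (f s : Set Plane) (hs : ω.IsMaximalFrontierEdge c f s)
      (hc : ¬ (s ∩ {c}).Nonempty) : StaircaseStep ω c (State.loop S f) (State.advance (insert s S))
  | newFrontier (S : Set (Set Plane)) (f : Set Plane) (hf : ω.IsFrontier S f) :
      StaircaseStep ω c (State.advance S) (State.loop S f)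

/-- `e₁` and `e₂` are the two extreme edges not incident with the extreme corner `c`. -/
def AreFarEdges (ω : Obstacle) (c : Plane) (e₁ e₂ : Set Plane) : Prop :=
  ω.IsExtremeEdge e₁ ∧ ω.IsExtremeEdge e₂ ∧ e₁ ≠ e₂ ∧ c ∉ e₁ ∧ c ∉ e₂

/-- PartialStaircaseSkeleton up to its call of StaircaseSkeleton. A cross is returned if there is
one. Otherwise the algorithm starts with a maximum length adjacent extreme visibility edge
between the far extreme edges, if these are mutually visible, and with a maximal extreme visibility
edge for each of them, if not. If two such edges leave no frontier, then nothing is left for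
StaircaseSkeleton to add. -/
inductive PartialStaircaseStart (ω : Obstacle) (c : Plane) : State → Prop
  | cross (sH sV : Set Plane) (hX : ω.IsCross sH sV) :
      PartialStaircaseStart ω c (State.halt {sH, sV})
  | adjacent (e₁ e₂ s : Set Plane) (hX : ¬ ω.HasCross) (he : ω.AreFarEdges c e₁ e₂)
      (hvis : ω.MutuallyVisible e₁ e₂) (hs : ω.IsMaxLengthAdjacent e₁ e₂ s) :
      PartialStaircaseStart ω c (State.advance {s})
  | pair (e₁ e₂ s₁ s₂ : Set Plane) (hX : ¬ ω.HasCross) (he : ω.AreFarEdges c e₁ e₂)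
      (hvis : ¬ ω.MutuallyVisible e₁ e₂) (hs₁ : ω.IsMaximalExtremeEdge c e₁ s₁)
      (hs₂ : ω.IsMaximalExtremeEdge c e₂ s₂) (hf : ∃ f, ω.IsFrontier {s₁, s₂} f) :
      PartialStaircaseStart ω c (State.advance {s₁, s₂})
  | pairComplete (e₁ e₂ s₁ s₂ : Set Plane) (hX : ¬ ω.HasCross) (he : ω.AreFarEdges c e₁ e₂)
      (hvis : ¬ ω.MutuallyVisible e₁ e₂) (hs₁ : ω.IsMaximalExtremeEdge c e₁ s₁)
      (hs₂ : ω.IsMaximalExtremeEdge c e₂ s₂) (hf : ¬ ∃ f, ω.IsFrontier {s₁, s₂} f) :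
      PartialStaircaseStart ω c (State.halt {s₁, s₂})

/-- The states that occur in some run of PartialStaircaseSkeleton on `ω`. -/
def Reachable (ω : Obstacle) (c : Plane) (σ : State) : Prop :=
  ∃ σ₀, ω.PartialStaircaseStart c σ₀ ∧ Relation.ReflTransGen (ω.StaircaseStep c) σ₀ σ

end Obstacle

end RectSkeleton

/-!
The algorithm sweeps the staircase towards its extreme corner `c`, and at each moment its segments
span a box whose upper right corner `K` tells how far every other skeleton with as many segments can
have come. The proof makes this precise.

*Reduction.* A reflection (`Mirror`, `Obstacle.IsPartialStaircase.exists_reflect`) moves `c` to the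
top right. What is used of the obstacle is collected in `Staircase`. Rectilinear convexity becomes
the quadrant criterion `RectConvex.mem_of_quadrants`: a point is in the region as soon as its four
closed quadrants meet the region. By general position, a line carries at most one edge; from this and
the simplicity of the polygon it follows that the region is not pinched (`Obstacle.not_pinched`).

*Dominance.* Let `[a, K]` be the box that has been covered (`IsCovered`). Its top and right side
within the interior of the region (`frontierSet`) form one connected set, which is empty only if
`K = c`; so this is the frontier of the algorithm (`Obstacle.isFrontier_iff`), and a segment that
leaves the box meets it. Among the visible points, let `v` be one that is farthest to the right and,
subject to this, as high as possible. Then no segment that starts in the box ends higher than `v`: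
if one did, the point above `v` at its height would be visible from the box too
(`Staircase.exists_segment_chain`). Hence the end of a maximal frontier visibility edge
dominates the end of every segment that starts in the box, in *both* coordinates
(`Staircase.dominates_covered`), whichever of the two lexicographic orders was chosen, and the
covered box grows to `[a, v]` (`Advance`).

*Lower bound.* While `K ≠ c`, every skeleton has a segment that leaves the box
(`Staircase.exists_leaving`): otherwise the skeleton would miss a one-corner path that follows the
sides of a slightly larger box. On the other hand, by dominance, all segments that meet the old box
are inside the new one. So the number of skeleton segments that meet the box grows by at least one
whenever the algorithm adds a segment (`Obstacle.Invariant`). At the start, two segments of the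
skeleton have to be accounted for, which comes from the sides of the bounding box that a skeleton
must touch (`Staircase.two_le_meeting_hi`, `Staircase.two_le_inside`, `Staircase.two_le_encard`).

*Upper bound.* The segments of the algorithm need not have a connected union. They are `Linked`,
however: they project onto both sides of the box, and the quadrants of certain points cannot
separate them without being crossed. This is kept by every advance (`Linked.advance`), and when
`K = c` it forces every path that a skeleton must meet to meet one of the segments
(`Staircase.isSkeletonOf_of_linked`).

*Termination.* At every advance the covered box passes a vertex, horizontally or vertically, so that
`Obstacle.potential` decreases.
-/

namespace RectSkeleton

/-! ### Segments in coordinates -/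

theorem mem_segment_coord {p q z : Plane} :
    z ∈ segment ℝ p q ↔ ∃ t : ℝ, 0 ≤ t ∧ t ≤ 1 ∧
      z.1 = (1 - t) * p.1 + t * q.1 ∧ z.2 = (1 - t) * p.2 + t * q.2 := by
  rw [segment_eq_image]
  constructor
  · rintro ⟨t, ⟨h0, h1⟩, rfl⟩
    exact ⟨t, h0, h1, by simp, by simp⟩
  · rintro ⟨t, h0, h1, hx, hy⟩
    exact ⟨t, ⟨h0, h1⟩, by ext <;> simp [hx, hy]⟩

/-- The point dividing the segment from `p` to `q` in the ratio `t : 1 - t`. -/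
def pointAt (p q : Plane) (t : ℝ) : Plane := ((1 - t) * p.1 + t * q.1, (1 - t) * p.2 + t * q.2)

theorem pointAt_mem {p q : Plane} {t : ℝ} (h0 : 0 ≤ t) (h1 : t ≤ 1) :
    pointAt p q t ∈ segment ℝ p q := mem_segment_coord.2 ⟨t, h0, h1, rfl, rfl⟩

theorem convexComb_le {a b a' b' t : ℝ} (h0 : 0 ≤ t) (h1 : t ≤ 1) (ha : a ≤ a') (hb : b ≤ b') :
    (1 - t) * a + t * b ≤ (1 - t) * a' + t * b' := by
  have := mul_le_mul_of_nonneg_left ha (sub_nonneg.2 h1)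
  have := mul_le_mul_of_nonneg_left hb h0
  linarith

theorem le_convexComb {a b x t : ℝ} (h0 : 0 ≤ t) (h1 : t ≤ 1) (ha : x ≤ a) (hb : x ≤ b) :
    x ≤ (1 - t) * a + t * b := by
  have := convexComb_le h0 h1 ha hb
  linarith

theorem convexComb_le_right {a b x t : ℝ} (h0 : 0 ≤ t) (h1 : t ≤ 1) (ha : a ≤ x) (hb : b ≤ x) :
    (1 - t) * a + t * b ≤ x := by
  have := convexComb_le h0 h1 ha hb
  linarith

/-! ### Staircase regions -/

/-- What the argument uses of a partial staircase with bounding box `[a, c]`, extreme corner `c` at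
the top right. The left edge is `{a.1} × [lo.2, hi.2]`, the bottom edge `[lo.1, hi.1] × {a.2}`, the
top edge begins at `(en.1, c.2)` and the right edge at `(c.1, en.2)`. The conditions are symmetric
under the exchange of the coordinates. -/
structure Staircase (W : Set Plane) (a c lo hi en : Plane) : Prop where
  isCompact : IsCompact W
  ge : ∀ w ∈ W, a.1 ≤ w.1 ∧ a.2 ≤ w.2
  le : ∀ w ∈ W, w.1 ≤ c.1 ∧ w.2 ≤ c.2
  corner : c ∈ W
  not_corner : a ∉ W
  /-- a point lies in the region if the four closed quadrants at it meet the region -/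
  quadrants : ∀ z : Plane, (∃ w ∈ W, w.1 ≤ z.1 ∧ w.2 ≤ z.2) → (∃ w ∈ W, z.1 ≤ w.1 ∧ z.2 ≤ w.2) →
    (∃ w ∈ W, w.1 ≤ z.1 ∧ z.2 ≤ w.2) → (∃ w ∈ W, z.1 ≤ w.1 ∧ w.2 ≤ z.2) → z ∈ W
  left_lo : (a.1, lo.2) ∈ W
  left_hi : (a.1, hi.2) ∈ W
  left_lt : lo.2 < hi.2
  left : ∀ w ∈ W, w.1 = a.1 → lo.2 ≤ w.2 ∧ w.2 ≤ hi.2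
  bot_lo : (lo.1, a.2) ∈ W
  bot_hi : (hi.1, a.2) ∈ W
  bot_lt : lo.1 < hi.1
  bot : ∀ w ∈ W, w.2 = a.2 → lo.1 ≤ w.1 ∧ w.1 ≤ hi.1
  hi_lt_fst : hi.1 < c.1
  hi_lt_snd : hi.2 < c.2
  top : (en.1, c.2) ∈ W
  top_lt : en.1 < c.1
  right : (c.1, en.2) ∈ W
  right_lt : en.2 < c.2
  /-- the region is not pinched -/
  not_pinched : ∀ z ∈ W, a.1 < z.1 → z.1 < c.1 → a.2 < z.2 → z.2 < c.2 →
    (∃ w ∈ W, z.1 < w.1 ∧ w.2 < z.2) ∨ (∃ w ∈ W, w.1 < z.1 ∧ z.2 < w.2)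
  /-- near a point, the upper right quadrant lies either inside or outside the region -/
  localQuadrant : ∀ z : Plane, ∃ δ > 0,
    (∀ w : Plane, z.1 < w.1 → w.1 < z.1 + δ → z.2 < w.2 → w.2 < z.2 + δ → w ∈ W) ∨
    (∀ w : Plane, z.1 < w.1 → w.1 < z.1 + δ → z.2 < w.2 → w.2 < z.2 + δ → w ∉ W)
  /-- a vertical line contains at most one boundary edge -/
  vertical_edge : ∀ x y₁ y₂ y₃ y₄ : ℝ, y₁ < y₂ → y₃ < y₄ →
    (∀ y, y₁ ≤ y → y ≤ y₂ → (x, y) ∈ frontier W) → (∀ y, y₃ ≤ y → y ≤ y₄ → (x, y) ∈ frontier W) →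
    ∀ y, y₁ ≤ y → y ≤ y₄ → (x, y) ∈ frontier W
  /-- a horizontal line contains at most one boundary edge -/
  horizontal_edge : ∀ y x₁ x₂ x₃ x₄ : ℝ, x₁ < x₂ → x₃ < x₄ →
    (∀ x, x₁ ≤ x → x ≤ x₂ → (x, y) ∈ frontier W) → (∀ x, x₃ ≤ x → x ≤ x₄ → (x, y) ∈ frontier W) →
    ∀ x, x₁ ≤ x → x ≤ x₄ → (x, y) ∈ frontier W

theorem swap_image_mem {W : Set Plane} {p : Plane} : p ∈ Prod.swap '' W ↔ p.swap ∈ W := by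
  rw [Set.image_swap_eq_preimage_swap]; rfl

theorem exists_swap_image {W : Set Plane} {P : Plane → Prop} :
    (∃ w ∈ Prod.swap '' W, P w) ↔ ∃ w ∈ W, P w.swap := by
  simp only [Set.mem_image, exists_exists_and_eq_and]

theorem frontier_swap_image (W : Set Plane) :
    frontier (Prod.swap '' W) = Prod.swap '' frontier W :=
  ((Homeomorph.prodComm ℝ ℝ).image_frontier W).symm

theorem interior_swap_image (W : Set Plane) :
    interior (Prod.swap '' W) = Prod.swap '' interior W :=
  ((Homeomorph.prodComm ℝ ℝ).image_interior W).symm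

theorem closure_swap_image (W : Set Plane) :
    closure (Prod.swap '' W) = Prod.swap '' closure W :=
  ((Homeomorph.prodComm ℝ ℝ).image_closure W).symm

theorem swap_image_swap_image (W : Set Plane) : Prod.swap '' (Prod.swap '' W) = W := by
  rw [← Set.image_comp, Prod.swap_swap_eq, Set.image_id]

theorem segment_swap (p q : Plane) : segment ℝ p.swap q.swap = Prod.swap '' segment ℝ p q := by
  ext z
  simp only [swap_image_mem, mem_segment_coord, Prod.fst_swap, Prod.snd_swap]
  constructor <;> rintro ⟨t, h0, h1, hx, hy⟩ <;> exact ⟨t, h0, h1, hy, hx⟩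

theorem segment_swap_subset {p q : Plane} {W : Set Plane} :
    segment ℝ p.swap q.swap ⊆ Prod.swap '' W ↔ segment ℝ p q ⊆ W := by
  rw [segment_swap, Set.image_subset_image_iff Prod.swap_injective]

namespace Staircase

variable {W : Set Plane} {a c lo hi en : Plane}

theorem swap (h : Staircase W a c lo hi en) :
    Staircase (Prod.swap '' W) a.swap c.swap lo.swap hi.swap en.swap where
  isCompact := h.isCompact.image continuous_swap
  ge w hw := (h.ge _ (swap_image_mem.1 hw)).symm
  le w hw := (h.le _ (swap_image_mem.1 hw)).symm
  corner := swap_image_mem.2 h.corner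
  not_corner := fun hc => h.not_corner (swap_image_mem.1 hc)
  quadrants z h1 h2 h3 h4 := by
    rw [exists_swap_image] at h1 h2 h3 h4
    rw [swap_image_mem]
    obtain ⟨w1, m1, i1⟩ := h1
    obtain ⟨w2, m2, i2⟩ := h2
    obtain ⟨w3, m3, i3⟩ := h3
    obtain ⟨w4, m4, i4⟩ := h4
    exact h.quadrants _ ⟨w1, m1, i1.symm⟩ ⟨w2, m2, i2.symm⟩ ⟨w4, m4, i4.symm⟩ ⟨w3, m3, i3.symm⟩
  left_lo := swap_image_mem.2 h.bot_lo
  left_hi := swap_image_mem.2 h.bot_hi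
  left_lt := h.bot_lt
  left w hw := h.bot _ (swap_image_mem.1 hw)
  bot_lo := swap_image_mem.2 h.left_lo
  bot_hi := swap_image_mem.2 h.left_hi
  bot_lt := h.left_lt
  bot w hw := h.left _ (swap_image_mem.1 hw)
  hi_lt_fst := h.hi_lt_snd
  hi_lt_snd := h.hi_lt_fst
  top := swap_image_mem.2 h.right
  top_lt := h.right_lt
  right := swap_image_mem.2 h.top
  right_lt := h.top_lt
  not_pinched z hz h1 h2 h3 h4 := by
    rw [exists_swap_image, exists_swap_image]
    rcases h.not_pinched _ (swap_image_mem.1 hz) h3 h4 h1 h2 with ⟨w, hw, i⟩ | ⟨w, hw, i⟩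
    · exact Or.inr ⟨w, hw, i.symm⟩
    · exact Or.inl ⟨w, hw, i.symm⟩
  localQuadrant z := by
    obtain ⟨δ, h0, hd⟩ := h.localQuadrant z.swap
    refine ⟨δ, h0, hd.imp ?_ ?_⟩
    · intro hh w h1 h2 h3 h4
      exact swap_image_mem.2 (hh w.swap h3 h4 h1 h2)
    · intro hh w h1 h2 h3 h4 hw
      exact hh w.swap h3 h4 h1 h2 (swap_image_mem.1 hw)
  vertical_edge := by
    simpa only [frontier_swap_image, swap_image_mem, Prod.swap_prod_mk] using h.horizontal_edge
  horizontal_edge := by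
    simpa only [frontier_swap_image, swap_image_mem, Prod.swap_prod_mk] using h.vertical_edge

theorem isClosed (h : Staircase W a c lo hi en) : IsClosed W := h.isCompact.isClosed

/-- The quadrant criterion. The upper right quadrant needs no witness, as it contains `c` if the
other quadrants meet the region. -/
theorem mem_of (h : Staircase W a c lo hi en) {z nw se sw : Plane} (hnw : nw ∈ W) (hse : se ∈ W)
    (hsw : sw ∈ W) (h1 : nw.1 ≤ z.1) (h2 : z.2 ≤ nw.2) (h3 : z.1 ≤ se.1) (h4 : se.2 ≤ z.2)
    (h5 : sw.1 ≤ z.1) (h6 : sw.2 ≤ z.2) : z ∈ W :=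
  h.quadrants z ⟨sw, hsw, h5, h6⟩
    ⟨c, h.corner, h3.trans (h.le _ hse).1, h2.trans (h.le _ hnw).2⟩ ⟨nw, hnw, h1, h2⟩
    ⟨se, hse, h3, h4⟩

/-- A point is interior if its open quadrants meet the region. -/
theorem mem_interior_of (h : Staircase W a c lo hi en) {z nw se sw : Plane} (hnw : nw ∈ W)
    (hse : se ∈ W) (hsw : sw ∈ W) (h1 : nw.1 < z.1) (h2 : z.2 < nw.2) (h3 : z.1 < se.1)
    (h4 : se.2 < z.2) (h5 : sw.1 < z.1) (h6 : sw.2 < z.2) : z ∈ interior W := by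
  rw [mem_interior]
  refine ⟨{w | (nw.1 < w.1 ∧ w.2 < nw.2 ∧ w.1 < se.1) ∧ se.2 < w.2 ∧ sw.1 < w.1 ∧ sw.2 < w.2},
    ?_, ?_, ⟨h1, h2, h3⟩, h4, h5, h6⟩
  · rintro w ⟨⟨k1, k2, k3⟩, k4, k5, k6⟩
    exact h.mem_of hnw hse hsw k1.le k2.le k3.le k4.le k5.le k6.le
  · simp only [Set.ofPred_and]
    refine IsOpen.inter (IsOpen.inter ?_ (IsOpen.inter ?_ ?_))
      (IsOpen.inter ?_ (IsOpen.inter ?_ ?_)) <;>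
    exact isOpen_lt (by fun_prop) (by fun_prop)

/-- A square around an interior point lies in the region. -/
theorem exists_of_mem_interior {z : Plane} (hz : z ∈ interior W) :
    ∃ δ > 0, ∀ s t : ℝ, |s| < δ → |t| < δ → (z.1 + s, z.2 + t) ∈ W := by
  obtain ⟨δ, h0, hb⟩ := Metric.mem_nhds_iff.1 (mem_interior_iff_mem_nhds.1 hz)
  refine ⟨δ, h0, fun s t hs ht => hb ?_⟩
  rw [Metric.mem_ball, Prod.dist_eq, max_lt_iff]
  simpa [Real.dist_eq] using And.intro hs ht

theorem interior_lt (h : Staircase W a c lo hi en) {z : Plane} (hz : z ∈ interior W) :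
    a.1 < z.1 ∧ z.1 < c.1 ∧ a.2 < z.2 ∧ z.2 < c.2 := by
  obtain ⟨δ, h0, hd⟩ := exists_of_mem_interior hz
  have h1 := hd (δ / 2) (δ / 2) (by rw [abs_of_pos] <;> linarith) (by rw [abs_of_pos] <;> linarith)
  have h2 := hd (-(δ / 2)) (-(δ / 2)) (by rw [abs_neg, abs_of_pos] <;> linarith)
    (by rw [abs_neg, abs_of_pos] <;> linarith)
  have h3 := h.le _ h1
  have h4 := h.ge _ h2
  simp only at h3 h4
  refine ⟨?_, ?_, ?_, ?_⟩ <;> linarith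

theorem a_le_lo (h : Staircase W a c lo hi en) : a.1 ≤ lo.1 ∧ a.2 ≤ lo.2 :=
  ⟨(h.ge _ h.bot_lo).1, (h.ge _ h.left_lo).2⟩

theorem mem_of_fst_eq (h : Staircase W a c lo hi en) {p q z : Plane} (hp : p ∈ W) (hq : q ∈ W)
    (h1 : p.1 = z.1) (h2 : q.1 = z.1) (h3 : p.2 ≤ z.2) (h4 : z.2 ≤ q.2) : z ∈ W :=
  h.mem_of hq hp hp h2.le h4 h1.ge h3 h1.le h3

theorem segment_subset_of_snd_eq (h : Staircase W a c lo hi en) {p q : Plane} (hp : p ∈ W)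
    (hq : q ∈ W) (h1 : p.2 = q.2) (h2 : p.1 ≤ q.1) : segment ℝ p q ⊆ W := by
  intro z hz
  obtain ⟨t, h0, ht, hx, hy⟩ := mem_segment_coord.1 hz
  have hy' : z.2 = p.2 := by rw [hy, ← h1]; ring
  refine h.mem_of hp hq hp ?_ hy'.le ?_ (by rw [hy', h1]) ?_ hy'.ge
  · rw [hx]; exact le_convexComb h0 ht le_rfl h2
  · rw [hx]; exact convexComb_le_right h0 ht h2 le_rfl
  · rw [hx]; exact le_convexComb h0 ht le_rfl h2

/-! ### Dominance -/

/-- The descending chain consisting of a horizontal segment that ends and a vertical segment that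
begins at `(X, Y)`. -/
def _root_.RectSkeleton.chain (x₀ X y₀ Y : ℝ) : Set Plane :=
  {z | (z.1 = X ∧ y₀ ≤ z.2 ∧ z.2 ≤ Y) ∨ (z.2 = Y ∧ x₀ ≤ z.1 ∧ z.1 ≤ X)}

/-- If two segments start on a descending chain and end beyond it, the second one higher up but
not farther to the right, then the highest point above the end of the first one is also visible
from the chain. -/
theorem exists_segment_chain (h : Staircase W a c lo hi en) {x₀ X y₀ Y : ℝ} (hx₀ : x₀ ≤ X)
    (hy₀ : y₀ ≤ Y)
    (hE : ∀ z : Plane, (X ≤ z.1 ∧ y₀ ≤ z.2) ∨ (Y ≤ z.2 ∧ x₀ ≤ z.1) →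
      ∃ w ∈ W, w.1 ≤ z.1 ∧ w.2 ≤ z.2)
    {m v m' n : Plane} (hm : m ∈ chain x₀ X y₀ Y) (hm' : m' ∈ chain x₀ X y₀ Y)
    (hmv : segment ℝ m v ⊆ W) (hmn : segment ℝ m' n ⊆ W) (hXv : X < v.1) (hYv : Y ≤ v.2)
    (hex : (m'.1 = X ∧ X ≤ n.1) ∨ (m'.2 = Y ∧ Y ≤ n.2)) (hn1 : n.1 ≤ v.1) (hn2 : v.2 < n.2) :
    ∃ m'' ∈ chain x₀ X y₀ Y, segment ℝ m'' (v.1, n.2) ⊆ W := by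
  have hb : ∀ z ∈ chain x₀ X y₀ Y, z.1 ≤ X ∧ z.2 ≤ Y ∧ x₀ ≤ z.1 ∧ y₀ ≤ z.2 := by
    rintro z (⟨h1, h2, h3⟩ | ⟨h1, h2, h3⟩) <;> refine ⟨?_, ?_, ?_, ?_⟩ <;> linarith
  have hchE : ∀ z ∈ chain x₀ X y₀ Y, (X ≤ z.1 ∧ y₀ ≤ z.2) ∨ (Y ≤ z.2 ∧ x₀ ≤ z.1) := by
    rintro z (⟨h1, h2, h3⟩ | ⟨h1, h2, h3⟩)
    · exact Or.inl ⟨h1.ge, h2⟩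
    · exact Or.inr ⟨h1.ge, h2⟩
  have hEup : ∀ z z' : Plane, ((X ≤ z.1 ∧ y₀ ≤ z.2) ∨ (Y ≤ z.2 ∧ x₀ ≤ z.1)) → z.1 ≤ z'.1 →
      z.2 ≤ z'.2 → ∃ w ∈ W, w.1 ≤ z'.1 ∧ w.2 ≤ z'.2 := by
    rintro z z' hz i1 i2
    apply hE
    rcases hz with ⟨h1, h2⟩ | ⟨h1, h2⟩
    · exact Or.inl ⟨h1.trans i1, h2.trans i2⟩
    · exact Or.inr ⟨h1.trans i2, h2.trans i1⟩
  obtain ⟨bm1, bm2, bm3, bm4⟩ := hb m hm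
  obtain ⟨bm1', bm2', bm3', bm4'⟩ := hb m' hm'
  have hnW : n ∈ W := hmn (right_mem_segment _ _ _)
  -- the chain descends, so that the starting points can be compared
  have hcmp : (m'.1 ≤ m.1 ∧ m.2 ≤ m'.2) ∨ (m.1 ≤ m'.1 ∧ m'.2 ≤ m.2) := by
    rcases hm with ⟨h1, h2, h3⟩ | ⟨h1, h2, h3⟩ <;> rcases hm' with ⟨k1, k2, k3⟩ | ⟨k1, k2, k3⟩
    · rcases le_total m.2 m'.2 with i | i
      · exact Or.inl ⟨by linarith, i⟩
      · exact Or.inr ⟨by linarith, i⟩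
    · exact Or.inl ⟨by linarith, by linarith⟩
    · exact Or.inr ⟨by linarith, by linarith⟩
    · rcases le_total m'.1 m.1 with i | i
      · exact Or.inl ⟨i, by linarith⟩
      · exact Or.inr ⟨i, by linarith⟩
  rcases hcmp with ⟨c1, c2⟩ | ⟨c1, c2⟩
  · refine ⟨m', hm', fun z hz => ?_⟩
    obtain ⟨t, h0, h1, hx, hy⟩ := mem_segment_coord.1 hz
    simp only at hx hy
    obtain ⟨w, hw, w1, w2⟩ := hEup m' z (hchE m' hm')
      (by rw [hx]; exact le_convexComb h0 h1 le_rfl (by linarith))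
      (by rw [hy]; exact le_convexComb h0 h1 le_rfl (by linarith))
    exact h.mem_of (hmn (pointAt_mem h0 h1)) (hmv (pointAt_mem h0 h1)) hw
      (by rw [hx]; exact convexComb_le h0 h1 le_rfl hn1) (by rw [hy]; exact le_rfl)
      (by rw [hx]; exact convexComb_le h0 h1 c1 le_rfl)
      (by rw [hy]; exact convexComb_le h0 h1 c2 hn2.le) w1 w2
  by_cases hnm : n.1 ≤ m.1
  · refine ⟨m, hm, fun z hz => ?_⟩
    obtain ⟨t, h0, h1, hx, hy⟩ := mem_segment_coord.1 hz
    simp only at hx hy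
    have e1 : m.1 ≤ z.1 := by rw [hx]; exact le_convexComb h0 h1 le_rfl (by linarith)
    obtain ⟨w, hw, w1, w2⟩ := hEup m z (hchE m hm) e1
      (by rw [hy]; exact le_convexComb h0 h1 le_rfl (by linarith))
    exact h.mem_of hnW (hmv (pointAt_mem h0 h1)) hw (hnm.trans e1)
      (by rw [hy]; exact convexComb_le_right h0 h1 (by linarith) le_rfl)
      (by rw [hx]; exact le_rfl)
      (by rw [hy]; exact convexComb_le h0 h1 le_rfl hn2.le) w1 w2
  rw [not_le] at hnm
  -- the two segments cross at a point `o`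
  have hd1 : 0 < v.1 - m.1 := by linarith
  have hd2 : 0 ≤ v.2 - m.2 := by linarith
  obtain ⟨τ, t, τ0, τ1, t0, t1, o1, o2⟩ : ∃ τ t : ℝ, 0 ≤ τ ∧ τ ≤ 1 ∧ 0 ≤ t ∧ t ≤ 1 ∧
      (1 - τ) * m'.1 + τ * n.1 = (1 - t) * m.1 + t * v.1 ∧
      (1 - τ) * m'.2 + τ * n.2 = (1 - t) * m.2 + t * v.2 := by
    set D' := (v.2 - m.2) * (m'.1 - m.1) - (v.1 - m.1) * (m'.2 - m.2) with hD'
    set D := (v.1 - m.1) * (n.2 - m.2) - (v.2 - m.2) * (n.1 - m.1) with hD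
    have hD'0 : 0 ≤ D' := by
      have := mul_nonneg hd2 (sub_nonneg.2 c1)
      have := mul_nonneg hd1.le (sub_nonneg.2 c2)
      nlinarith
    have hD0 : 0 < D := by
      have := mul_pos hd1 (sub_pos.2 hn2)
      have := mul_nonneg hd2 (sub_nonneg.2 hn1)
      nlinarith
    have hs : D' + D ≠ 0 := by linarith
    have τ0 : 0 ≤ D' / (D' + D) := div_nonneg hD'0 (by linarith)
    have τ1 : D' / (D' + D) ≤ 1 := (div_le_one (by linarith)).2 (by linarith)
    set τ := D' / (D' + D) with hτ
    have key : τ * (D' + D) = D' := div_mul_cancel₀ _ hs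
    have b1 : m.1 ≤ (1 - τ) * m'.1 + τ * n.1 := le_convexComb τ0 τ1 c1 hnm.le
    have b2 : (1 - τ) * m'.1 + τ * n.1 ≤ v.1 := convexComb_le_right τ0 τ1 (by linarith) hn1
    refine ⟨τ, ((1 - τ) * m'.1 + τ * n.1 - m.1) / (v.1 - m.1), τ0, τ1, div_nonneg (by linarith)
      hd1.le, (div_le_one hd1).2 (by linarith), ?_, ?_⟩
    · field_simp; ring
    · field_simp
      rw [hD', hD] at key
      linear_combination key
  set o : Plane := ((1 - t) * m.1 + t * v.1, (1 - t) * m.2 + t * v.2) with ho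
  have hov : o = pointAt m v t := rfl
  have hon : o = pointAt m' n τ := Prod.ext o1.symm o2.symm
  have ho1 : m.1 ≤ o.1 := le_convexComb t0 t1 le_rfl (by linarith)
  have ho2 : m.2 ≤ o.2 := le_convexComb t0 t1 le_rfl (by linarith)
  have ho3 : o.1 ≤ v.1 := convexComb_le_right t0 t1 (by linarith) le_rfl
  have ho4 : o.2 ≤ v.2 := convexComb_le_right t0 t1 (by linarith) le_rfl
  have hmv1 : m ∈ segment ℝ m v := left_mem_segment _ _ _
  have hvv : v ∈ segment ℝ m v := right_mem_segment _ _ _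
  have hmn1 : m' ∈ segment ℝ m' n := left_mem_segment _ _ _
  have hnn : n ∈ segment ℝ m' n := right_mem_segment _ _ _
  have oS : o ∈ segment ℝ m v := hov ▸ pointAt_mem t0 t1
  have oT : o ∈ segment ℝ m' n := hon ▸ pointAt_mem τ0 τ1
  have Smo : segment ℝ m o ⊆ W := ((convex_segment m v).segment_subset hmv1 oS).trans hmv
  have Sov : segment ℝ o v ⊆ W := ((convex_segment m v).segment_subset oS hvv).trans hmv
  have Smo' : segment ℝ m' o ⊆ W := ((convex_segment m' n).segment_subset hmn1 oT).trans hmn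
  have Son : segment ℝ o n ⊆ W := ((convex_segment m' n).segment_subset oT hnn).trans hmn
  -- the line through `o` and `(v.1, n.2)` meets the chain between the two starting points
  have hm0 : 0 ≤ (v.1 - o.1) * (m.2 - o.2) - (n.2 - o.2) * (m.1 - o.1) := by
    have : (v.1 - o.1) * (m.2 - o.2) - (n.2 - o.2) * (m.1 - o.1)
        = t * ((v.1 - m.1) * (n.2 - v.2)) := by simp only [ho]; ring
    rw [this]
    exact mul_nonneg t0 (mul_nonneg hd1.le (by linarith))
  have hm0' : (v.1 - o.1) * (m'.2 - o.2) - (n.2 - o.2) * (m'.1 - o.1) ≤ 0 := by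
    have : (v.1 - o.1) * (m'.2 - o.2) - (n.2 - o.2) * (m'.1 - o.1)
        = -(τ * ((v.1 - n.1) * (n.2 - m'.2))) := by
      have e1 : o.1 = (1 - τ) * m'.1 + τ * n.1 := o1.symm
      have e2 : o.2 = (1 - τ) * m'.2 + τ * n.2 := o2.symm
      rw [e1, e2]; ring
    rw [this]
    have := mul_nonneg τ0 (mul_nonneg (sub_nonneg.2 hn1) (show 0 ≤ n.2 - m'.2 by linarith))
    linarith
  have hzero : ∀ p q : Plane, 0 ≤ (v.1 - o.1) * (p.2 - o.2) - (n.2 - o.2) * (p.1 - o.1) →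
      (v.1 - o.1) * (q.2 - o.2) - (n.2 - o.2) * (q.1 - o.1) ≤ 0 →
      ∃ s : ℝ, 0 ≤ s ∧ s ≤ 1 ∧ (v.1 - o.1) * ((pointAt p q s).2 - o.2)
        - (n.2 - o.2) * ((pointAt p q s).1 - o.1) = 0 := by
    intro p q hp hq
    have hc : ContinuousOn (fun s : ℝ => (v.1 - o.1) * ((pointAt p q s).2 - o.2)
        - (n.2 - o.2) * ((pointAt p q s).1 - o.1)) (Set.Icc 0 1) := by
      unfold pointAt
      fun_prop
    have := intermediate_value_Icc' (zero_le_one) hc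
    obtain ⟨s, hs, e⟩ := this (show (0 : ℝ) ∈ _ from ⟨by simpa [pointAt] using hq,
      by simpa [pointAt] using hp⟩)
    exact ⟨s, hs.1, hs.2, e⟩
  obtain ⟨k, hk, hk0, k1, k2, k3, k4⟩ : ∃ k ∈ chain x₀ X y₀ Y,
      (v.1 - o.1) * (k.2 - o.2) - (n.2 - o.2) * (k.1 - o.1) = 0 ∧
      m.1 ≤ k.1 ∧ k.2 ≤ m.2 ∧ k.1 ≤ m'.1 ∧ m'.2 ≤ k.2 := by
    rcases hm with ⟨h1, h2, h3⟩ | ⟨h1, h2, h3⟩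
    · have h4 : m'.1 = X := le_antisymm bm1' (h1 ▸ c1)
      obtain ⟨s, s0, s1, e⟩ := hzero m m' hm0 hm0'
      have e1 : (pointAt m m' s).1 = X := by simp only [pointAt, h1, h4]; ring
      have e2 : m'.2 ≤ (pointAt m m' s).2 := le_convexComb s0 s1 c2 le_rfl
      have e3 : (pointAt m m' s).2 ≤ m.2 := convexComb_le_right s0 s1 le_rfl c2
      exact ⟨_, Or.inl ⟨e1, by linarith, by linarith⟩, e, by linarith, e3, by linarith, e2⟩
    · rcases hm' with ⟨j1, j2, j3⟩ | ⟨j1, j2, j3⟩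
      · rcases le_total ((v.1 - o.1) * (Y - o.2) - (n.2 - o.2) * (X - o.1)) 0 with i | i
        · obtain ⟨s, s0, s1, e⟩ := hzero m (X, Y) hm0 i
          have e1 : (pointAt m (X, Y) s).2 = Y := by simp only [pointAt, h1]; ring
          have e2 : m.1 ≤ (pointAt m (X, Y) s).1 := le_convexComb s0 s1 le_rfl h3
          have e3 : (pointAt m (X, Y) s).1 ≤ X := convexComb_le_right s0 s1 h3 le_rfl
          exact ⟨_, Or.inr ⟨e1, by linarith, e3⟩, e, e2, by linarith, by linarith, by linarith⟩
        · obtain ⟨s, s0, s1, e⟩ := hzero (X, Y) m' i hm0'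
          have e1 : (pointAt (X, Y) m' s).1 = X := by simp only [pointAt, j1]; ring
          have e2 : m'.2 ≤ (pointAt (X, Y) m' s).2 := le_convexComb s0 s1 j3 le_rfl
          have e3 : (pointAt (X, Y) m' s).2 ≤ Y := convexComb_le_right s0 s1 le_rfl j3
          exact ⟨_, Or.inl ⟨e1, by linarith, e3⟩, e, by linarith, by linarith, by linarith, e2⟩
      · obtain ⟨s, s0, s1, e⟩ := hzero m m' hm0 hm0'
        have e1 : (pointAt m m' s).2 = Y := by simp only [pointAt, h1, j1]; ring
        have e2 : m.1 ≤ (pointAt m m' s).1 := le_convexComb s0 s1 le_rfl c1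
        have e3 : (pointAt m m' s).1 ≤ m'.1 := convexComb_le_right s0 s1 c1 le_rfl
        exact ⟨_, Or.inr ⟨e1, by linarith, by linarith⟩, e, e2, by linarith, e3, by linarith⟩
  obtain ⟨bk1, bk2, bk3, bk4⟩ := hb k hk
  refine ⟨k, hk, ?_⟩
  have hup : segment ℝ o (v.1, n.2) ⊆ W := by
    intro z hz
    obtain ⟨r, h0, h1, hx, hy⟩ := mem_segment_coord.1 hz
    simp only at hx hy
    obtain ⟨w, hw, w1, w2⟩ := hEup m z (hchE m hm)
      (by rw [hx]; exact le_convexComb h0 h1 ho1 (by linarith))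
      (by rw [hy]; exact le_convexComb h0 h1 ho2 (by linarith))
    exact h.mem_of (Son (pointAt_mem h0 h1)) (Sov (pointAt_mem h0 h1)) hw
      (by rw [hx]; exact convexComb_le h0 h1 le_rfl hn1) (by rw [hy]; exact le_rfl)
      (by rw [hx]; exact le_rfl)
      (by rw [hy]; exact convexComb_le h0 h1 le_rfl hn2.le) w1 w2
  have hdown : segment ℝ k o ⊆ W := by
    intro z hz
    obtain ⟨r, h0, h1, hx, hy⟩ := mem_segment_coord.1 hz
    have hsw : ∃ w ∈ W, w.1 ≤ z.1 ∧ w.2 ≤ z.2 := by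
      have hko : (k.1 ≤ o.1 ∧ k.2 ≤ o.2) ∨ (m.1 ≤ k.1 ∧ m.2 ≤ k.2) := by
        rcases hm with ⟨h1, h2, h3⟩ | ⟨h1, h2, h3⟩
        · exact Or.inl ⟨by linarith, by linarith⟩
        · rcases hex with ⟨j1, j2⟩ | ⟨j1, j2⟩
          · left
            refine ⟨?_, by linarith⟩
            have : X ≤ (1 - τ) * m'.1 + τ * n.1 := le_convexComb τ0 τ1 j1.ge j2
            have : o.1 = (1 - τ) * m'.1 + τ * n.1 := o1.symm
            linarith
          · exact Or.inr ⟨k1, by linarith⟩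
      rcases hko with ⟨i1, i2⟩ | ⟨i1, i2⟩
      · exact hEup k z (hchE k hk) (by rw [hx]; exact le_convexComb h0 h1 le_rfl i1)
          (by rw [hy]; exact le_convexComb h0 h1 le_rfl i2)
      · exact hEup m z (hchE m hm) (by rw [hx]; exact le_convexComb h0 h1 i1 ho1)
          (by rw [hy]; exact le_convexComb h0 h1 i2 ho2)
    obtain ⟨w, hw, w1, w2⟩ := hsw
    exact h.mem_of (Smo (pointAt_mem h0 h1)) (Smo' (pointAt_mem h0 h1)) hw
      (by rw [hx]; exact convexComb_le h0 h1 k1 le_rfl)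
      (by rw [hy]; exact convexComb_le h0 h1 k2 le_rfl)
      (by rw [hx]; exact convexComb_le h0 h1 k3 le_rfl)
      (by rw [hy]; exact convexComb_le h0 h1 k4 le_rfl) w1 w2
  -- `k`, `o` and `(v.1, n.2)` lie on a line
  intro z hz
  obtain ⟨r, h0, h1, hx, hy⟩ := mem_segment_coord.1 hz
  simp only at hx hy
  have hpos : 0 < n.2 - o.2 := by linarith
  have hzline : (v.1 - o.1) * (z.2 - o.2) - (n.2 - o.2) * (z.1 - o.1) = 0 := by
    rw [hx, hy]; linear_combination (1 - r) * hk0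
  rcases le_total o.2 z.2 with i | i
  · have hz2 : z.2 ≤ n.2 := by rw [hy]; exact convexComb_le_right h0 h1 (by linarith) le_rfl
    refine hup (mem_segment_coord.2 ⟨(z.2 - o.2) / (n.2 - o.2), div_nonneg (by linarith) hpos.le,
      (div_le_one hpos).2 (by linarith), ?_, ?_⟩)
    · field_simp; linear_combination -hzline
    · field_simp; ring
  · rcases eq_or_lt_of_le (show k.2 ≤ o.2 by linarith) with e | e
    · have hz2 : z.2 = o.2 := by
        refine le_antisymm i ?_
        rw [hy]; exact le_convexComb h0 h1 e.ge (by linarith)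
      have hz1 : z.1 = o.1 := by
        rw [hz2] at hzline
        have := mul_eq_zero.1 (show (n.2 - o.2) * (z.1 - o.1) = 0 by linarith)
        rcases this with this | this <;> linarith
      exact hdown (mem_segment_coord.2 ⟨1, by norm_num, le_rfl, by simp [hz1], by simp [hz2]⟩)
    · have hz2 : k.2 ≤ z.2 := by rw [hy]; exact le_convexComb h0 h1 le_rfl (by linarith)
      have e' : 0 < o.2 - k.2 := by linarith
      refine hdown (mem_segment_coord.2 ⟨(z.2 - k.2) / (o.2 - k.2), div_nonneg (by linarith) e'.le,
        (div_le_one e').2 (by linarith), ?_, ?_⟩)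
      · field_simp
        -- both `k` and `z` are on the line through `o`
        have : (n.2 - o.2) * (z.1 * (o.2 - k.2) - (k.1 * (o.2 - k.2 - (z.2 - k.2))
            + (z.2 - k.2) * o.1)) = 0 := by
          linear_combination (-(o.2 - k.2)) * hzline + (o.2 - z.2) * hk0
        rcases mul_eq_zero.1 this with this | this <;> linarith
      · field_simp; ring

end Staircase

/-! ### Passable lines -/

/-- The line `x = X` carries no boundary edge that has the region on its right: the points of the
region on the line are limits from the left, as far as their heights are concerned. -/
def Passable (W : Set Plane) (X : ℝ) : Prop :=
  ∀ w₀ ∈ W, w₀.1 = X → ∀ y < w₀.2, ∃ w ∈ W, w.1 < X ∧ y < w.2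

/-- A closed set that contains the points just after `z` on a ray contains `z`. -/
theorem mem_of_direction {W : Set Plane} (hW : IsClosed W) {z : Plane} (p q : ℝ) {δ : ℝ}
    (hδ : 0 < δ) (h : ∀ ε, 0 < ε → ε < δ → (z.1 + p * ε, z.2 + q * ε) ∈ W) : z ∈ W := by
  have hc : Filter.Tendsto (fun ε : ℝ => ((z.1 + p * ε, z.2 + q * ε) : Plane))
      (nhdsWithin 0 (Set.Ioi 0)) (nhds z) := by
    have : Continuous (fun ε : ℝ => ((z.1 + p * ε, z.2 + q * ε) : Plane)) := by fun_prop
    have := this.tendsto 0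
    simp only [mul_zero, add_zero, Prod.mk.eta] at this
    exact this.mono_left nhdsWithin_le_nhds
  refine hW.mem_of_tendsto hc ?_
  filter_upwards [Ioo_mem_nhdsGT hδ] with ε hε using h ε hε.1 hε.2

namespace Staircase

variable {W : Set Plane} {a c lo hi en : Plane}

/-- A vertical line is passable if the region has a point `v` on it such that nothing to the right
of the line is as low as `v`, while `v` is approached from the left: a boundary edge with the region
on its right and one with the region on its left would lie on the same line. -/
theorem passable_of (h : Staircase W a c lo hi en) {v m : Plane} (hv : v ∈ W) (hvc : v.1 < c.1)
    (h1 : ∀ w₀ ∈ W, w₀.1 = v.1 → v.2 < w₀.2 → ∀ w ∈ W, v.1 < w.1 → v.2 < w.2) (hm : m ∈ W)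
    (hm1 : m.1 < v.1) (hm2 : m.2 ≤ v.2) (hd : ∀ y < v.2, ∃ w ∈ W, w.1 < v.1 ∧ y < w.2) :
    Passable W v.1 := by
  by_contra hP
  unfold Passable at hP
  push Not at hP
  obtain ⟨w₀, hw₀, e₀, y₁, hy₁, hL⟩ := hP
  have hvy : v.2 ≤ y₁ := by
    by_contra hlt
    obtain ⟨w, hw, i1, i2⟩ := hd y₁ (not_le.1 hlt)
    exact absurd (hL w hw i1) (not_le.2 i2)
  replace h1 := h1 w₀ hw₀ e₀ (by linarith)
  have hfr : ∀ z : Plane, z ∈ W → z ∉ interior W → z ∈ frontier W := fun z k1 k2 => by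
    rw [h.isClosed.frontier_eq]; exact ⟨k1, k2⟩
  have hchord : ∀ y, v.2 ≤ y → y ≤ w₀.2 → ((v.1, y) : Plane) ∈ W := fun y k1 k2 =>
    h.mem_of_fst_eq hv hw₀ rfl e₀ k1 k2
  set A : Set ℝ := Prod.snd '' {w ∈ W | w.1 < v.1} with hA
  have hAb : BddAbove A := ⟨y₁, by rintro _ ⟨w, ⟨k1, k2⟩, rfl⟩; exact hL w k1 k2⟩
  have hAm : ∀ w ∈ W, w.1 < v.1 → w.2 ≤ sSup A := fun w k1 k2 =>
    le_csSup hAb ⟨w, ⟨k1, k2⟩, rfl⟩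
  have hAne : A.Nonempty := ⟨_, m, ⟨hm, hm1⟩, rfl⟩
  have hsy : sSup A ≤ y₁ := csSup_le hAne (by rintro _ ⟨w, ⟨k1, k2⟩, rfl⟩; exact hL w k1 k2)
  have hvs : v.2 ≤ sSup A := by
    refine le_of_forall_lt fun y hy => ?_
    obtain ⟨w, hw, i1, i2⟩ := hd y hy
    exact i2.trans_le (hAm w hw i1)
  have ha1 : a.1 < v.1 := (h.ge _ hm).1.trans_lt hm1
  have hhi : hi.2 ≤ sSup A := hAm (a.1, hi.2) h.left_hi ha1
  -- the upper edge has the region on its right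
  have hI1 : ∀ y, y₁ ≤ y → y ≤ w₀.2 → ((v.1, y) : Plane) ∈ frontier W := by
    intro y k1 k2
    refine hfr _ (hchord y (hvy.trans k1) k2) fun hint => ?_
    obtain ⟨δ, h0, hδ⟩ := exists_of_mem_interior hint
    have := hδ (-(δ / 2)) (δ / 2) (by rw [abs_neg, abs_of_pos] <;> linarith)
      (by rw [abs_of_pos] <;> linarith)
    have := hL _ this (by simp only; linarith)
    simp only at this
    linarith
  -- the lower edge has the region on its left
  obtain ⟨δ, h0, hδ | hδ⟩ := h.localQuadrant v
  · have : ((v.1 + δ / 2, v.2) : Plane) ∈ W := by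
      refine mem_of_direction h.isClosed 0 1 h0 fun ε e1 e2 => hδ _ ?_ ?_ ?_ ?_ <;> simp only <;>
      linarith
    exact absurd (h1 _ this (by simp only; linarith)) (lt_irrefl _)
  have hI2 : ∀ y, v.2 ≤ y → y ≤ min (v.2 + δ / 2) w₀.2 → ((v.1, y) : Plane) ∈ frontier W := by
    intro y k1 k2
    have k3 := k2.trans (min_le_left _ _)
    refine hfr _ (hchord y k1 (k2.trans (min_le_right _ _))) fun hint => ?_
    obtain ⟨δ', h0', hδ'⟩ := exists_of_mem_interior hint
    have hp : 0 < min δ δ' / 4 := by have := lt_min h0 h0'; linarith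
    have hp1 := min_le_left δ δ'
    have hp2 := min_le_right δ δ'
    have := hδ' (min δ δ' / 4) (min δ δ' / 4) (by rw [abs_of_pos hp]; linarith)
      (by rw [abs_of_pos hp]; linarith)
    refine hδ _ ?_ ?_ ?_ ?_ this <;> simp only <;> linarith
  have hI := h.vertical_edge v.1 v.2 (min (v.2 + δ / 2) w₀.2) y₁ w₀.2
    (lt_min (by linarith) (by linarith)) hy₁ hI2 hI1
  have hnoint : ∀ y, v.2 ≤ y → y ≤ w₀.2 → ((v.1, y) : Plane) ∉ interior W := fun y k1 k2 => by
    have := hI y k1 k2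
    rw [h.isClosed.frontier_eq] at this
    exact this.2
  have hlo := h.a_le_lo.2
  have hlt := h.left_lt
  have hw₀c := (h.le _ hw₀).2
  rcases h.not_pinched (v.1, sSup A) (hchord _ hvs (by linarith)) ha1 hvc
    (by simp only; linarith) (by simp only; linarith) with ⟨w, hw, i1, i2⟩ | ⟨w, hw, i1, i2⟩
  · simp only at i1 i2
    have i3 := h1 w hw i1
    obtain ⟨_, ⟨w', ⟨k1, k2⟩, rfl⟩, k3⟩ :=
      exists_lt_of_lt_csSup hAne (show (w.2 + sSup A) / 2 < sSup A by linarith)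
    refine hnoint ((w.2 + sSup A) / 2) (by linarith) (by linarith)
      (h.mem_interior_of k1 hw hm k2 k3 i1 ?_ hm1 ?_) <;> simp only <;> linarith
  · exact absurd (hAm w hw i1) (not_le.2 i2)

/-- The right end of the bottom edge is a point as in `passable_of`: nothing to its right is as low.
-/
theorem passable_hi (h : Staircase W a c lo hi en) : Passable W hi.1 := by
  refine h.passable_of (v := (hi.1, a.2)) (m := (lo.1, a.2)) h.bot_hi h.hi_lt_fst ?_ h.bot_lo
    h.bot_lt le_rfl fun y hy => ⟨_, h.bot_lo, h.bot_lt, hy⟩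
  intro _ _ _ _ w hw h1
  refine lt_of_le_of_ne (h.ge w hw).2 fun e => ?_
  have := (h.bot w hw e.symm).2
  simp only at h1
  linarith

theorem passable_corner (h : Staircase W a c lo hi en) : Passable W c.1 :=
  fun w₀ hw₀ _ _ hy => ⟨_, h.top, h.top_lt, hy.trans_le (h.le w₀ hw₀).2⟩

/-- If an ascending segment cannot be extended beyond its end, then the vertical line through the
end is passable: if the region contains points above the end on this line, then it has none to the
right that are as low as the end, since the quadrant criterion would allow an extension. -/
theorem passable_of_ascending (h : Staircase W a c lo hi en) {m v : Plane}
    (hs : segment ℝ m v ⊆ W) (h1 : m.1 < v.1) (h2 : m.2 ≤ v.2)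
    (hext : ∀ δ > 0, ∃ ε, 0 < ε ∧ ε < δ ∧
      ((v.1 + ε * (v.1 - m.1), v.2 + ε * (v.2 - m.2)) : Plane) ∉ W) :
    Passable W v.1 := by
  have hv : v ∈ W := hs (right_mem_segment _ _ _)
  have hm : m ∈ W := hs (left_mem_segment _ _ _)
  rcases eq_or_lt_of_le (h.le v hv).1 with e | hvc
  · rw [e]; exact h.passable_corner
  refine h.passable_of hv hvc ?_ hm h1 h2 ?_
  · intro w₀ hw₀ e₀ l₀ w hw hvw
    by_contra hle
    rw [not_lt] at hle
    have hd1 : 0 < v.1 - m.1 := by linarith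
    have hd2 : 0 ≤ v.2 - m.2 := by linarith
    obtain ⟨ε, e1, e2, e3⟩ := hext (min ((w.1 - v.1) / (v.1 - m.1)) ((w₀.2 - v.2) /
      (v.2 - m.2 + 1))) (lt_min (div_pos (by linarith) hd1) (div_pos (by linarith) (by linarith)))
    have e4 := (lt_div_iff₀ hd1).1 (e2.trans_le (min_le_left _ _))
    have e5 := (lt_div_iff₀ (by linarith)).1 (e2.trans_le (min_le_right _ _))
    have e6 := mul_pos e1 hd1
    have e7 := mul_nonneg e1.le hd2
    refine e3 (h.mem_of hw₀ hw hv ?_ ?_ ?_ ?_ ?_ ?_) <;> simp only <;> linarith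
  · intro y hy
    rcases lt_or_ge y m.2 with i | i
    · exact ⟨m, hm, h1, i⟩
    · have hd : 0 < v.2 - m.2 := by linarith
      set s := (v.2 - y) / (2 * (v.2 - m.2)) with hs'
      have s0 : 0 < s := div_pos (by linarith) (by linarith)
      have s1 : s ≤ 1 := (div_le_one (by linarith)).2 (by linarith)
      have s2 : s * (2 * (v.2 - m.2)) = v.2 - y := div_mul_cancel₀ _ (by linarith)
      refine ⟨_, hs (pointAt_mem (t := 1 - s) (by linarith) (by linarith)), ?_, ?_⟩
      · simp only [pointAt]
        have := mul_pos s0 (sub_pos.2 h1)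
        linarith
      · simp only [pointAt]
        linarith

/-! ### Advancing from a chain -/

/-- A point that is lexicographically the most advanced one visible from a descending chain bounds
all visible points beyond the chain in both coordinates: if one of them is higher, then the point
above `v` at its height is visible too, by `exists_segment_chain`, and it is more advanced. -/
theorem dominates_of_max (h : Staircase W a c lo hi en) {x₀ X y₀ Y : ℝ} (hx₀ : x₀ ≤ X)
    (hy₀ : y₀ ≤ Y)
    (hE : ∀ z : Plane, (X ≤ z.1 ∧ y₀ ≤ z.2) ∨ (Y ≤ z.2 ∧ x₀ ≤ z.1) →
      ∃ w ∈ W, w.1 ≤ z.1 ∧ w.2 ≤ z.2)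
    (hK : ((X, Y) : Plane) ∈ W) {m v : Plane} (hm : m ∈ chain x₀ X y₀ Y)
    (hmv : segment ℝ m v ⊆ W)
    (hmax : ∀ p ∈ chain x₀ X y₀ Y, ∀ n, segment ℝ p n ⊆ W → (X < n.1 ∨ Y < n.2) →
      n.1 < v.1 ∨ (n.1 = v.1 ∧ n.2 ≤ v.2))
    (hex : ∃ p ∈ chain x₀ X y₀ Y, ∃ n, segment ℝ p n ⊆ W ∧ X < n.1) :
    X < v.1 ∧ Y ≤ v.2 ∧ ∀ p ∈ chain x₀ X y₀ Y, ∀ n, segment ℝ p n ⊆ W →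
      ((p.1 = X ∧ X ≤ n.1) ∨ (p.2 = Y ∧ Y ≤ n.2)) → (X < n.1 ∨ Y < n.2) →
      n.1 ≤ v.1 ∧ n.2 ≤ v.2 := by
  have hX : X < v.1 := by
    obtain ⟨p, hp, n, hpn, hn⟩ := hex
    rcases hmax p hp n hpn (Or.inl hn) with i | ⟨i, -⟩ <;> linarith
  have hv : v ∈ W := hmv (right_mem_segment _ _ _)
  have hKc : ((X, Y) : Plane) ∈ chain x₀ X y₀ Y := Or.inl ⟨rfl, hy₀, le_rfl⟩
  have hY : Y ≤ v.2 := by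
    by_contra hlt
    rw [not_le] at hlt
    have hz : ((v.1, Y) : Plane) ∈ W := h.mem_of hK hv hK hX.le le_rfl le_rfl hlt.le hX.le le_rfl
    rcases hmax _ hKc _ (h.segment_subset_of_snd_eq hK hz rfl hX.le) (Or.inl hX) with i | ⟨-, i⟩
    · exact lt_irrefl _ i
    · exact absurd i (not_le.2 hlt)
  refine ⟨hX, hY, fun p hp n hpn hexit hn => ?_⟩
  have h1 : n.1 ≤ v.1 := by
    rcases hmax p hp n hpn hn with i | ⟨i, -⟩
    exacts [i.le, i.le]
  refine ⟨h1, ?_⟩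
  by_contra hlt
  rw [not_le] at hlt
  obtain ⟨m'', hm'', hseg⟩ := h.exists_segment_chain hx₀ hy₀ hE hm hp hmv hpn hX hY hexit h1 hlt
  rcases hmax m'' hm'' _ hseg (Or.inl hX) with i | ⟨-, i⟩
  · exact lt_irrefl _ i
  · exact absurd i (not_le.2 hlt)

end Staircase

/-- A segment that leaves the box with upper right corner `K` does so through its top or right
side. -/
theorem exists_exit {a K p n : Plane} (hp : p.1 ≤ K.1 ∧ p.2 ≤ K.2) (hpa : a.1 ≤ p.1 ∧ a.2 ≤ p.2)
    (hna : a.1 ≤ n.1 ∧ a.2 ≤ n.2) (hn : K.1 < n.1 ∨ K.2 < n.2) :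
    ∃ m ∈ segment ℝ p n, m ∈ chain a.1 K.1 a.2 K.2 ∧
      ((m.1 = K.1 ∧ K.1 < n.1) ∨ (m.2 = K.2 ∧ K.2 < n.2)) := by
  -- the parameters at which the segment reaches the lines of the two sides
  have key : ∀ u u' k : ℝ, u ≤ k → k < u' → ∃ t, 0 ≤ t ∧ t ≤ 1 ∧ (1 - t) * u + t * u' = k := by
    intro u u' k h1 h2
    refine ⟨(k - u) / (u' - u), div_nonneg (by linarith) (by linarith),
      (div_le_one (by linarith)).2 (by linarith), ?_⟩
    have : u' - u ≠ 0 := by linarith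
    field_simp; ring
  have hge : ∀ t, 0 ≤ t → t ≤ 1 → a.1 ≤ (pointAt p n t).1 ∧ a.2 ≤ (pointAt p n t).2 :=
    fun t h0 h1 => ⟨le_convexComb h0 h1 hpa.1 hna.1, le_convexComb h0 h1 hpa.2 hna.2⟩
  by_cases h1 : K.1 < n.1
  · obtain ⟨t, t0, t1, e⟩ := key _ _ _ hp.1 h1
    by_cases h2 : (pointAt p n t).2 ≤ K.2
    · exact ⟨_, pointAt_mem t0 t1, Or.inl ⟨e, (hge t t0 t1).2, h2⟩, Or.inl ⟨e, h1⟩⟩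
    · rw [not_le] at h2
      have h3 : K.2 < n.2 := by
        by_contra hh
        exact absurd h2 (not_lt.2 (convexComb_le_right t0 t1 hp.2 (not_lt.1 hh)))
      obtain ⟨r, r0, r1, e'⟩ := key _ _ _ hp.2 h3
      have hrt : r ≤ t := by
        by_contra hh
        have h4 : (1 - t) * p.2 + t * n.2 > (1 - r) * p.2 + r * n.2 := by rw [e']; exact h2
        have := mul_nonneg (sub_nonneg.2 (not_le.1 hh).le) (show 0 ≤ n.2 - p.2 by linarith [hp.2])
        linarith
      have h5 : (pointAt p n r).1 ≤ K.1 := by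
        rw [← e]
        simp only [pointAt]
        have := mul_nonneg (sub_nonneg.2 hrt) (show 0 ≤ n.1 - p.1 by linarith [hp.1])
        linarith
      exact ⟨_, pointAt_mem r0 r1, Or.inr ⟨e', (hge r r0 r1).1, h5⟩, Or.inr ⟨e', h3⟩⟩
  · have h3 := hn.resolve_left h1
    obtain ⟨r, r0, r1, e'⟩ := key _ _ _ hp.2 h3
    exact ⟨_, pointAt_mem r0 r1, Or.inr ⟨e', (hge r r0 r1).1,
      convexComb_le_right r0 r1 hp.1 (not_lt.1 h1)⟩, Or.inr ⟨e', h3⟩⟩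

/-! ### The covered box and its frontier -/

/-- The box from the lower left corner of the bounding box to `K` has been covered: it contains the
left and the bottom edge, and its right and top sides lie on passable lines, so that no boundary
edge separates these sides from the part of the region inside the box. -/
structure IsCovered (W : Set Plane) (hi K : Plane) : Prop where
  mem : K ∈ W
  fst_le : hi.1 ≤ K.1
  snd_le : hi.2 ≤ K.2
  passable : Passable W K.1
  passable_swap : Passable (Prod.swap '' W) K.2

theorem IsCovered.swap {W : Set Plane} {hi K : Plane} (h : IsCovered W hi K) :
    IsCovered (Prod.swap '' W) hi.swap K.swap where
  mem := swap_image_mem.2 h.mem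
  fst_le := h.snd_le
  snd_le := h.fst_le
  passable := h.passable_swap
  passable_swap := by
    rw [swap_image_swap_image]
    exact h.passable

/-- The part of the boundary of the covered box that is inside the region. -/
def frontierSet (W : Set Plane) (K : Plane) : Set Plane :=
  {z ∈ interior W | (z.1 = K.1 ∧ z.2 ≤ K.2) ∨ (z.2 = K.2 ∧ z.1 ≤ K.1)}

theorem frontierSet_swap (W : Set Plane) (K : Plane) :
    frontierSet (Prod.swap '' W) K.swap = Prod.swap '' frontierSet W K := by
  ext z
  simp only [frontierSet, interior_swap_image, swap_image_mem, Set.mem_ofPred_eq, Prod.fst_swap,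
    Prod.snd_swap]
  tauto

namespace Staircase

variable {W : Set Plane} {a c lo hi en K : Plane}

theorem a_lt_covered (h : Staircase W a c lo hi en) (hK : IsCovered W hi K) :
    a.1 < K.1 ∧ a.2 < K.2 :=
  ⟨by linarith [h.a_le_lo.1, h.bot_lt, hK.fst_le], by linarith [h.a_le_lo.2, h.left_lt, hK.snd_le]⟩

/-- If the region goes on to the right of the covered box, then the right side of the box is inside
from there to the corner `K`. -/
theorem right_mem_interior (h : Staircase W a c lo hi en) (hK : IsCovered W hi K) {w : Plane}
    (hw : w ∈ W) (h1 : K.1 < w.1) {y : ℝ} (h2 : w.2 < y) (h3 : y < K.2) :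
    ((K.1, y) : Plane) ∈ interior W := by
  obtain ⟨w', hw', i1, i2⟩ := hK.passable K hK.mem rfl y h3
  exact h.mem_interior_of hw' hw h.bot_lo i1 i2 h1 h2 (h.bot_lt.trans_le hK.fst_le)
    ((h.ge w hw).2.trans_lt h2)

theorem top_mem_interior (h : Staircase W a c lo hi en) (hK : IsCovered W hi K) {w : Plane}
    (hw : w ∈ W) (h1 : K.2 < w.2) {x : ℝ} (h2 : w.1 < x) (h3 : x < K.1) :
    ((x, K.2) : Plane) ∈ interior W := by
  have := h.swap.right_mem_interior hK.swap (w := w.swap) (swap_image_mem.2 hw) h1 h2 h3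
  rwa [interior_swap_image, swap_image_mem] at this

/-- The region goes on below the covered corner on the right, or to the left of it on the top. This
is the place where pinched regions have to be excluded. -/
theorem exists_beyond (h : Staircase W a c lo hi en) (hK : IsCovered W hi K) (hc : K ≠ c) :
    (∃ w ∈ W, K.1 < w.1 ∧ w.2 < K.2) ∨ (∃ w ∈ W, w.1 < K.1 ∧ K.2 < w.2) := by
  have hle := h.le K hK.mem
  have ha := h.a_lt_covered hK
  rcases eq_or_lt_of_le hle.1 with e1 | l1
  · rcases eq_or_lt_of_le hle.2 with e2 | l2
    · exact absurd (Prod.ext e1 e2) hc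
    · exact Or.inr ⟨_, h.top, by simpa [e1] using h.top_lt, l2⟩
  · rcases eq_or_lt_of_le hle.2 with e2 | l2
    · exact Or.inl ⟨_, h.right, l1, by simpa [e2] using h.right_lt⟩
    · exact h.not_pinched K hK.mem ha.1 l1 ha.2 l2

theorem covered_mem_closure_of_right (h : Staircase W a c lo hi en) (hK : IsCovered W hi K)
    {w : Plane} (hw : w ∈ W) (h1 : K.1 < w.1) {y : ℝ} (h2 : w.2 ≤ y) (h3 : y < K.2) :
    ((K.1, y) : Plane) ∈ closure (frontierSet W K) ∧ K ∈ closure (frontierSet W K) := by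
  constructor
  · refine mem_of_direction (δ := K.2 - y) isClosed_closure 0 1 (by linarith) fun ε e1 e2 =>
      subset_closure ⟨?_, Or.inl ⟨by simp, by simp only; linarith⟩⟩
    simpa using h.right_mem_interior hK hw h1 (y := y + ε) (by linarith) (by linarith)
  · refine mem_of_direction (δ := K.2 - y) isClosed_closure 0 (-1) (by linarith) fun ε e1 e2 =>
      subset_closure ⟨?_, Or.inl ⟨by simp, by simp only; linarith⟩⟩
    simpa using h.right_mem_interior hK hw h1 (y := K.2 + -1 * ε) (by linarith) (by linarith)

theorem frontierSet_nonempty (h : Staircase W a c lo hi en) (hK : IsCovered W hi K) (hc : K ≠ c) :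
    (frontierSet W K).Nonempty := by
  rcases h.exists_beyond hK hc with ⟨w, hw, h1, h2⟩ | ⟨w, hw, h1, h2⟩
  · exact ⟨(K.1, (w.2 + K.2) / 2), h.right_mem_interior hK hw h1 (by linarith) (by linarith),
      Or.inl ⟨rfl, by simp only; linarith⟩⟩
  · exact ⟨((w.1 + K.1) / 2, K.2), h.top_mem_interior hK hw h2 (by linarith) (by linarith),
      Or.inr ⟨rfl, by simp only; linarith⟩⟩

theorem ne_corner_of_nonempty (h : Staircase W a c lo hi en) (hne : (frontierSet W K).Nonempty) :
    K ≠ c := by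
  rintro rfl
  obtain ⟨z, hz, ⟨e, -⟩ | ⟨e, -⟩⟩ := hne
  · exact absurd e (h.interior_lt hz).2.1.ne
  · exact absurd e (h.interior_lt hz).2.2.2.ne

/-- To the lower right of an interior point there are points of the region. -/
theorem exists_right_of_interior {z : Plane} (hz : z ∈ interior W) :
    ∃ w ∈ W, z.1 < w.1 ∧ w.2 < z.2 := by
  obtain ⟨δ, h0, hδ⟩ := exists_of_mem_interior hz
  exact ⟨_, hδ (δ / 2) (-(δ / 2)) (by rw [abs_of_pos] <;> linarith)
    (by rw [abs_neg, abs_of_pos] <;> linarith), by simp only; linarith, by simp only; linarith⟩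

theorem exists_top_of_interior {z : Plane} (hz : z ∈ interior W) :
    ∃ w ∈ W, w.1 < z.1 ∧ z.2 < w.2 := by
  obtain ⟨δ, h0, hδ⟩ := exists_of_mem_interior hz
  exact ⟨_, hδ (-(δ / 2)) (δ / 2) (by rw [abs_neg, abs_of_pos] <;> linarith)
    (by rw [abs_of_pos] <;> linarith), by simp only; linarith, by simp only; linarith⟩

theorem covered_mem_closure (h : Staircase W a c lo hi en) (hK : IsCovered W hi K) (hc : K ≠ c) :
    K ∈ closure (frontierSet W K) := by
  rcases h.exists_beyond hK hc with ⟨w, hw, h1, h2⟩ | ⟨w, hw, h1, h2⟩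
  · exact (h.covered_mem_closure_of_right hK hw h1 le_rfl h2).2
  · have := (h.swap.covered_mem_closure_of_right hK.swap (w := w.swap) (swap_image_mem.2 hw) h2
      le_rfl h1).2
    rw [frontierSet_swap, closure_swap_image] at this
    simpa using this

/-- A segment that leaves the box through its right side does so at a point of the closed frontier.
-/
theorem exit_mem_closure_right (h : Staircase W a c lo hi en) (hK : IsCovered W hi K)
    (hc : K ≠ c) {m n : Plane} (hmn : segment ℝ m n ⊆ W) (h1 : m.1 = K.1) (h2 : m.2 ≤ K.2)
    (h3 : K.1 < n.1) : m ∈ closure (frontierSet W K) := by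
  rcases eq_or_lt_of_le h2 with e | hlt
  · rw [show m = K from Prod.ext h1 e]; exact h.covered_mem_closure hK hc
  have hm : m = (K.1, m.2) := Prod.ext h1 rfl
  rw [hm]
  -- points of the segment just after `m` are to the lower right of the points just above `m`
  refine mem_of_direction (δ := K.2 - m.2) isClosed_closure 0 1 (by linarith) fun ε e1 e2 =>
      subset_closure ⟨?_, Or.inl ⟨by simp, by simp only; linarith⟩⟩
  set t := min 1 (ε / (2 * (|n.2 - m.2| + 1))) with ht
  have hpos : 0 < 2 * (|n.2 - m.2| + 1) := by positivity
  have t0 : 0 < t := lt_min one_pos (div_pos e1 hpos)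
  have t1 : t ≤ 1 := min_le_left _ _
  have t2 : t * (2 * (|n.2 - m.2| + 1)) ≤ ε := (le_div_iff₀ hpos).1 (min_le_right _ _)
  have t3 : t * (n.2 - m.2) ≤ t * |n.2 - m.2| := mul_le_mul_of_nonneg_left (le_abs_self _) t0.le
  have t4 : 0 ≤ t * |n.2 - m.2| := by positivity
  have := h.right_mem_interior hK (hmn (pointAt_mem t0.le t1)) (y := m.2 + ε) ?_ ?_ (by linarith)
  · simpa using this
  · simp only [pointAt]
    have := mul_pos t0 (sub_pos.2 h3)
    rw [h1]; linarith
  · simp only [pointAt]; linarith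

/-- Every segment that leaves the covered box meets the closure of its frontier. -/
theorem exists_exit_closure (h : Staircase W a c lo hi en) (hK : IsCovered W hi K)
    (hc : K ≠ c) {p n : Plane} (hpn : segment ℝ p n ⊆ W) (hp : p.1 ≤ K.1 ∧ p.2 ≤ K.2)
    (hn : K.1 < n.1 ∨ K.2 < n.2) :
    ∃ m ∈ segment ℝ p n, m ∈ closure (frontierSet W K) := by
  obtain ⟨m, hm, hch, hex⟩ := exists_exit (a := a) hp (h.ge p (hpn (left_mem_segment _ _ _)))
    (h.ge n (hpn (right_mem_segment _ _ _))) hn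
  refine ⟨m, hm, ?_⟩
  have hmn : segment ℝ m n ⊆ W :=
    ((convex_segment p n).segment_subset hm (right_mem_segment _ _ _)).trans hpn
  have hb : m.1 ≤ K.1 ∧ m.2 ≤ K.2 := by
    rcases hch with ⟨i1, i2, i3⟩ | ⟨i1, i2, i3⟩
    exacts [⟨i1.le, i3⟩, ⟨i3, i1.le⟩]
  rcases hex with ⟨e, i⟩ | ⟨e, i⟩
  · exact h.exit_mem_closure_right hK hc hmn e hb.2 i
  · have hc' : K.swap ≠ c.swap := fun e => hc (Prod.swap_injective e)
    have := h.swap.exit_mem_closure_right hK.swap hc' (segment_swap_subset.2 hmn) e hb.1 i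
    rw [frontierSet_swap, closure_swap_image] at this
    simpa using this

theorem isPreconnected_right (h : Staircase W a c lo hi en) (hK : IsCovered W hi K) :
    IsPreconnected {z ∈ interior W | z.1 = K.1 ∧ z.2 ≤ K.2} := by
  refine Convex.isPreconnected (convex_iff_segment_subset.2 ?_)
  rintro p ⟨hp, p1, p2⟩ q ⟨hq, q1, q2⟩ z hz
  obtain ⟨t, t0, t1, e1, e2⟩ := mem_segment_coord.1 hz
  have z1 : z.1 = K.1 := by rw [e1, p1, q1]; ring
  have z2 : z.2 ≤ K.2 := by rw [e2]; exact convexComb_le_right t0 t1 p2 q2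
  refine ⟨?_, z1, z2⟩
  by_cases hzp : z = p
  · rwa [hzp]
  by_cases hzq : z = q
  · rwa [hzq]
  have hz2 : z = (K.1, z.2) := Prod.ext z1 rfl
  have hne : ∀ r : Plane, r.1 = K.1 → z ≠ r → z.2 ≠ r.2 := fun r r1 hr e =>
    hr (Prod.ext (z1.trans r1.symm) e)
  have hpz := hne p p1 hzp
  have hqz := hne q q1 hzq
  -- `z` is strictly between its two ends
  have hbet : (p.2 < z.2 ∧ z.2 < q.2) ∨ (q.2 < z.2 ∧ z.2 < p.2) := by
    rcases le_total p.2 q.2 with i | i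
    · have j1 : p.2 ≤ z.2 := by rw [e2]; exact le_convexComb t0 t1 le_rfl i
      have j2 : z.2 ≤ q.2 := by rw [e2]; exact convexComb_le_right t0 t1 i le_rfl
      exact Or.inl ⟨lt_of_le_of_ne j1 hpz.symm, lt_of_le_of_ne j2 hqz⟩
    · have j1 : q.2 ≤ z.2 := by rw [e2]; exact le_convexComb t0 t1 i le_rfl
      have j2 : z.2 ≤ p.2 := by rw [e2]; exact convexComb_le_right t0 t1 le_rfl i
      exact Or.inr ⟨lt_of_le_of_ne j1 hqz.symm, lt_of_le_of_ne j2 hpz⟩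
  have key : ∀ r : Plane, r ∈ interior W → r.1 = K.1 → r.2 < z.2 → z.2 < K.2 → z ∈ interior W := by
    intro r hr r1 r2 r3
    obtain ⟨w, hw, i1, i2⟩ := exists_right_of_interior hr
    rw [hz2]
    exact h.right_mem_interior hK hw (r1 ▸ i1) (i2.trans r2) r3
  rcases hbet with ⟨i1, i2⟩ | ⟨i1, i2⟩
  · exact key p hp p1 i1 (by linarith)
  · exact key q hq q1 i1 (by linarith)

/-- The frontier is connected: its parts on the right and on the top side of the box are
intervals, and if both are non-empty, they contain `K`. -/
theorem isPreconnected_frontierSet (h : Staircase W a c lo hi en) (hK : IsCovered W hi K) :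
    IsPreconnected (frontierSet W K) := by
  have hR := h.isPreconnected_right hK
  have hT : IsPreconnected {z ∈ interior W | z.2 = K.2 ∧ z.1 ≤ K.1} := by
    have := (h.swap.isPreconnected_right hK.swap).image _ continuous_swap.continuousOn
    convert this using 1
    ext z
    simp only [swap_image_mem, interior_swap_image, Set.mem_ofPred_eq, Prod.fst_swap, Prod.snd_swap,
      Prod.swap_swap]
  have hU : frontierSet W K = {z ∈ interior W | z.1 = K.1 ∧ z.2 ≤ K.2} ∪
      {z ∈ interior W | z.2 = K.2 ∧ z.1 ≤ K.1} := by
    ext z; simp only [frontierSet, Set.mem_ofPred_eq, Set.mem_union]; tauto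
  rw [hU]
  by_cases hRn : {z ∈ interior W | z.1 = K.1 ∧ z.2 ≤ K.2} = ∅
  · rw [hRn, Set.empty_union]; exact hT
  by_cases hTn : {z ∈ interior W | z.2 = K.2 ∧ z.1 ≤ K.1} = ∅
  · rw [hTn, Set.union_empty]; exact hR
  -- if both parts are present, the corner is interior and joins them
  obtain ⟨p, hp, p1, p2⟩ := Set.nonempty_iff_ne_empty.2 hRn
  obtain ⟨q, hq, q1, q2⟩ := Set.nonempty_iff_ne_empty.2 hTn
  obtain ⟨w, hw, i1, i2⟩ := exists_right_of_interior hp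
  obtain ⟨w', hw', j1, j2⟩ := exists_top_of_interior hq
  have ha := h.a_lt_covered hK
  have hKi : K ∈ interior W := h.mem_interior_of hw' hw h.bot_lo (by linarith) (by linarith)
    (by linarith) (by linarith) (h.bot_lt.trans_le hK.fst_le) ha.2
  exact IsPreconnected.union K ⟨hKi, rfl, le_rfl⟩ ⟨hKi, rfl, le_rfl⟩ hR hT

theorem closure_frontierSet_subset (h : Staircase W a c lo hi en) :
    ∀ z ∈ closure (frontierSet W K), z ∈ W ∧ z.1 ≤ K.1 ∧ z.2 ≤ K.2 := by
  have hcl : IsClosed {z : Plane | z ∈ W ∧ z.1 ≤ K.1 ∧ z.2 ≤ K.2} :=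
    h.isClosed.inter ((isClosed_le continuous_fst continuous_const).inter
      (isClosed_le continuous_snd continuous_const))
  refine closure_minimal ?_ hcl
  rintro z ⟨hz, ⟨h1, h2⟩ | ⟨h1, h2⟩⟩
  · exact ⟨interior_subset hz, h1.le, h2⟩
  · exact ⟨interior_subset hz, h2, h1.le⟩

/-- A visible point that is the most advanced one from the covered box bounds every segment that
leaves the box, in both coordinates. -/
theorem dominates_covered (h : Staircase W a c lo hi en) (hK : IsCovered W hi K) {m v : Plane}
    (hm : m.1 ≤ K.1 ∧ m.2 ≤ K.2) (hmv : segment ℝ m v ⊆ W)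
    (hmax : ∀ p n : Plane, (p.1 ≤ K.1 ∧ p.2 ≤ K.2) → segment ℝ p n ⊆ W →
      (K.1 < n.1 ∨ K.2 < n.2) → n.1 < v.1 ∨ (n.1 = v.1 ∧ n.2 ≤ v.2))
    (hR : ∃ z ∈ interior W, z.1 = K.1 ∧ z.2 ≤ K.2) :
    K.1 < v.1 ∧ K.2 ≤ v.2 ∧ ∀ p n : Plane, (p.1 ≤ K.1 ∧ p.2 ≤ K.2) → segment ℝ p n ⊆ W →
      n.1 ≤ v.1 ∧ n.2 ≤ v.2 := by
  have ha := h.a_lt_covered hK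
  have hE : ∀ z : Plane, (K.1 ≤ z.1 ∧ a.2 ≤ z.2) ∨ (K.2 ≤ z.2 ∧ a.1 ≤ z.1) →
      ∃ w ∈ W, w.1 ≤ z.1 ∧ w.2 ≤ z.2 := by
    rintro z (⟨h1, h2⟩ | ⟨h1, h2⟩)
    · exact ⟨_, h.bot_hi, hK.fst_le.trans h1, h2⟩
    · exact ⟨_, h.left_hi, h2, hK.snd_le.trans h1⟩
  have hb : ∀ z ∈ chain a.1 K.1 a.2 K.2, z.1 ≤ K.1 ∧ z.2 ≤ K.2 := by
    rintro z (⟨h1, h2, h3⟩ | ⟨h1, h2, h3⟩)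
    exacts [⟨h1.le, h3⟩, ⟨h3, h1.le⟩]
  obtain ⟨z, hz, z1, z2⟩ := hR
  -- the horizontal ray from an interior point of the right side leaves the box
  obtain ⟨δ, h0, hδ⟩ := exists_of_mem_interior hz
  have hzn : ((z.1 + δ / 2, z.2 + 0) : Plane) ∈ W :=
    hδ (δ / 2) 0 (by rw [abs_of_pos] <;> linarith) (by simpa using h0)
  have hzs := h.segment_subset_of_snd_eq (interior_subset hz) hzn (by simp)
    (by simp only; linarith)
  have hX : K.1 < v.1 := by
    rcases hmax z _ ⟨z1.le, z2⟩ hzs (Or.inl (by simp only; linarith)) with i | ⟨i, -⟩ <;>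
    simp only at i <;> linarith
  obtain ⟨m', hm', hch, -⟩ := exists_exit (a := a) hm (h.ge m (hmv (left_mem_segment _ _ _)))
    (h.ge v (hmv (right_mem_segment _ _ _))) (Or.inl hX)
  have hmv' : segment ℝ m' v ⊆ W :=
    ((convex_segment m v).segment_subset hm' (right_mem_segment _ _ _)).trans hmv
  obtain ⟨h1, h2, h3⟩ := h.dominates_of_max ha.1.le ha.2.le hE (by exact hK.mem) hch hmv'
    (fun p hp n hpn hn => hmax p n (hb p hp) hpn hn)
    ⟨z, Or.inl ⟨z1, (h.ge z (interior_subset hz)).2, z2⟩, _, hzs, by simp only; linarith⟩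
  refine ⟨h1, h2, fun p n hp hpn => ?_⟩
  by_cases hn : K.1 < n.1 ∨ K.2 < n.2
  · obtain ⟨q, hq, hqc, hqe⟩ := exists_exit (a := a) hp (h.ge p (hpn (left_mem_segment _ _ _)))
      (h.ge n (hpn (right_mem_segment _ _ _))) hn
    exact h3 q hqc n (((convex_segment p n).segment_subset hq (right_mem_segment _ _ _)).trans hpn)
      (hqe.imp (fun i => ⟨i.1, i.2.le⟩) (fun i => ⟨i.1, i.2.le⟩)) hn
  · rw [not_or, not_lt, not_lt] at hn
    exact ⟨hn.1.trans h1.le, hn.2.trans h2⟩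

/-- The covered box grows to the most advanced visible point. -/
theorem covered_advance (h : Staircase W a c lo hi en) (hK : IsCovered W hi K) {m v : Plane}
    (hm : m.1 ≤ K.1 ∧ m.2 ≤ K.2) (hmv : segment ℝ m v ⊆ W) (h1 : K.1 < v.1) (h2 : K.2 ≤ v.2)
    (hext : ∀ δ > 0, ∃ ε, 0 < ε ∧ ε < δ ∧
      ((v.1 + ε * (v.1 - m.1), v.2 + ε * (v.2 - m.2)) : Plane) ∉ W) :
    IsCovered W hi v where
  mem := hmv (right_mem_segment _ _ _)
  fst_le := hK.fst_le.trans h1.le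
  snd_le := hK.snd_le.trans h2
  passable := h.passable_of_ascending hmv (hm.1.trans_lt h1) (hm.2.trans h2) hext
  passable_swap := by
    rcases eq_or_lt_of_le h2 with e | hlt
    · rw [← e]; exact hK.passable_swap
    · refine h.swap.passable_of_ascending (m := m.swap) (v := v.swap)
        (segment_swap_subset.2 hmv) (hm.2.trans_lt hlt) (hm.1.trans h1.le) fun δ hδ => ?_
      obtain ⟨ε, e1, e2, e3⟩ := hext δ hδ
      exact ⟨ε, e1, e2, fun hh => e3 (swap_image_mem.1 hh)⟩

end Staircase

/-! ### Maximal segments -/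

/-- The segment from `u` to `v` lies in `W` and is not part of a longer segment in `W`. -/
def MaximalSegment (W : Set Plane) (u v : Plane) : Prop :=
  u ≠ v ∧ segment ℝ u v ⊆ W ∧
    ∀ u' v', segment ℝ u v ⊆ segment ℝ u' v' → segment ℝ u' v' ⊆ W → segment ℝ u' v' = segment ℝ u v

/-- The lexicographic order of the plane, with the first coordinate dominant. -/
def LexLe (w v : Plane) : Prop := w.1 < v.1 ∨ (w.1 = v.1 ∧ w.2 ≤ v.2)

theorem LexLe.trans {p q r : Plane} (h1 : LexLe p q) (h2 : LexLe q r) : LexLe p r := by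
  rcases h1 with i | ⟨i, i'⟩ <;> rcases h2 with j | ⟨j, j'⟩
  · exact Or.inl (i.trans j)
  · exact Or.inl (j ▸ i)
  · exact Or.inl (i ▸ j)
  · exact Or.inr ⟨i.trans j, i'.trans j'⟩

theorem LexLe.fst_le {p q : Plane} (h : LexLe p q) : p.1 ≤ q.1 := by
  rcases h with i | ⟨i, -⟩
  exacts [i.le, i.le]

/-- The lexicographic order is maximised at an end of a segment. -/
theorem lexLe_of_mem_segment {u v z : Plane} (hz : z ∈ segment ℝ u v) : LexLe z u ∨ LexLe z v := by
  obtain ⟨t, h0, h1, hx, hy⟩ := mem_segment_coord.1 hz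
  have key : ∀ p q : ℝ, (1 - t) * p + t * q ≤ p ∨ (1 - t) * p + t * q ≤ q := fun p q => by
    rcases le_total p q with i | i
    · exact Or.inr (convexComb_le_right h0 h1 i le_rfl)
    · exact Or.inl (convexComb_le_right h0 h1 le_rfl i)
  rcases lt_trichotomy u.1 v.1 with i | i | i
  · right
    rcases eq_or_lt_of_le h1 with rfl | h1'
    · right; rw [hx, hy]; constructor <;> simp
    · left
      have := mul_pos (sub_pos.2 h1') (sub_pos.2 i)
      rw [hx]; linarith
  · have e : z.1 = u.1 := by rw [hx, ← i]; ring
    rcases key u.2 v.2 with j | j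
    · exact Or.inl (Or.inr ⟨e, hy ▸ j⟩)
    · exact Or.inr (Or.inr ⟨e.trans i, hy ▸ j⟩)
  · left
    rcases eq_or_lt_of_le h0 with rfl | h0'
    · right; rw [hx, hy]; constructor <;> simp
    · left
      have := mul_pos h0' (sub_pos.2 i)
      rw [hx]; linarith

theorem isClosed_segment_subset {W : Set Plane} (hW : IsClosed W) :
    IsClosed {x : Plane × Plane | segment ℝ x.1 x.2 ⊆ W} := by
  have : {x : Plane × Plane | segment ℝ x.1 x.2 ⊆ W} =
      ⋂ t ∈ Set.Icc (0 : ℝ) 1, (fun x : Plane × Plane => pointAt x.1 x.2 t) ⁻¹' W := by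
    ext x
    simp only [Set.mem_ofPred_eq, Set.mem_iInter, Set.mem_preimage, Set.mem_Icc]
    constructor
    · intro h t ht
      exact h (pointAt_mem ht.1 ht.2)
    · intro h z hz
      obtain ⟨t, h0, h1, hx, hy⟩ := mem_segment_coord.1 hz
      have := h t ⟨h0, h1⟩
      rwa [show pointAt x.1 x.2 t = z from Prod.ext hx.symm hy.symm] at this
  rw [this]
  refine isClosed_biInter fun t _ => hW.preimage ?_
  unfold pointAt
  fun_prop

/-- Every segment is part of a maximal one, by compactness: a longest segment in `W` that contains
it. -/
theorem exists_maximalSegment {W : Set Plane} (hW : IsCompact W) {p q : Plane} (hpq : p ≠ q)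
    (hs : segment ℝ p q ⊆ W) :
    ∃ u v, MaximalSegment W u v ∧ segment ℝ p q ⊆ segment ℝ u v := by
  -- maximise the distance of the ends among the segments that contain the given one
  set C : Set (Plane × Plane) := (W ×ˢ W) ∩ {x | segment ℝ x.1 x.2 ⊆ W} ∩
    {x | p ∈ segment ℝ x.1 x.2 ∧ q ∈ segment ℝ x.1 x.2} with hC
  have hcl : ∀ r : Plane, IsClosed {x : Plane × Plane | r ∈ segment ℝ x.1 x.2} := by
    intro r
    -- the projection along the compact parameter interval is closed
    have h3 : IsClosed (Prod.fst '' {y : (Plane × Plane) × Set.Icc (0 : ℝ) 1 |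
        pointAt y.1.1 y.1.2 y.2 = r}) := by
      refine isClosedMap_fst_of_compactSpace _ ?_
      refine isClosed_eq ?_ continuous_const
      unfold pointAt
      fun_prop
    convert h3 using 1
    ext x
    rw [Set.mem_ofPred_eq, mem_segment_coord]
    constructor
    · rintro ⟨t, h0, h1, hx, hy⟩
      exact ⟨(x, ⟨t, h0, h1⟩), Prod.ext hx.symm hy.symm, rfl⟩
    · rintro ⟨⟨x, t, h0, h1⟩, rfl, rfl⟩
      exact ⟨t, h0, h1, rfl, rfl⟩
  have hCc : IsCompact C := by
    refine ((hW.prod hW).inter_right (isClosed_segment_subset hW.isClosed)).inter_right ?_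
    exact IsClosed.inter (hcl p) (hcl q)
  have hpqC : (p, q) ∈ C := ⟨⟨⟨hs (left_mem_segment _ _ _), hs (right_mem_segment _ _ _)⟩, hs⟩,
    left_mem_segment _ _ _, right_mem_segment _ _ _⟩
  obtain ⟨⟨u, v⟩, ⟨⟨huvW, huv⟩, hp, hq⟩, hmax⟩ := hCc.exists_isMaxOn ⟨_, hpqC⟩
    (f := fun x : Plane × Plane => dist x.1 x.2) (by fun_prop)
  refine ⟨u, v, ⟨?_, huv, ?_⟩, (convex_segment u v).segment_subset hp hq⟩
  · rintro rfl
    simp only [segment_same, Set.mem_singleton_iff] at hp hq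
    exact hpq (hp.trans hq.symm)
  intro u' v' hsub hW'
  have hd : dist u' v' ≤ dist u v := hmax (show (u', v') ∈ C from
    ⟨⟨⟨hW' (left_mem_segment _ _ _), hW' (right_mem_segment _ _ _)⟩, hW'⟩,
      hsub hp, hsub hq⟩)
  have hu := hsub (left_mem_segment _ _ _)
  have hv := hsub (right_mem_segment _ _ _)
  refine Set.Subset.antisymm ?_ hsub
  rw [segment_eq_image_lineMap] at hu hv
  obtain ⟨s, ⟨s0, s1⟩, rfl⟩ := hu
  obtain ⟨t, ⟨t0, t1⟩, rfl⟩ := hv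
  rw [dist_lineMap_lineMap] at hd
  have hpos : 0 < dist u' v' := by
    rw [dist_pos]
    rintro rfl
    simp only [AffineMap.lineMap_same, AffineMap.const_apply, segment_same,
      Set.mem_singleton_iff] at hp hq
    exact hpq (hp.trans hq.symm)
  have hst : 1 ≤ dist s t := by
    by_contra hlt
    have := mul_lt_mul_of_pos_right (not_le.1 hlt) hpos
    linarith
  rw [Real.dist_eq] at hst
  rcases le_abs.1 hst with i | i
  · rw [show s = 1 by linarith, show t = 0 by linarith]
    simp [segment_symm]
  · rw [show s = 0 by linarith, show t = 1 by linarith]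
    simp

theorem MaximalSegment.symm {W : Set Plane} {u v : Plane} (h : MaximalSegment W u v) :
    MaximalSegment W v u := by
  refine ⟨h.1.symm, by rw [segment_symm]; exact h.2.1, fun u' v' h1 h2 => ?_⟩
  rw [segment_symm ℝ v u] at h1 ⊢
  exact h.2.2 u' v' h1 h2

theorem MaximalSegment.swap {W : Set Plane} {u v : Plane} (h : MaximalSegment W u v) :
    MaximalSegment (Prod.swap '' W) u.swap v.swap := by
  refine ⟨fun e => h.1 (Prod.swap_injective e), segment_swap_subset.2 h.2.1, fun u' v' h1 h2 => ?_⟩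
  have e : segment ℝ u' v' = Prod.swap '' segment ℝ u'.swap v'.swap := by
    rw [← segment_swap, Prod.swap_swap, Prod.swap_swap]
  rw [segment_swap, e] at h1 ⊢
  rw [e] at h2
  rw [Set.image_subset_image_iff Prod.swap_injective] at h1 h2
  rw [h.2.2 _ _ h1 h2]

theorem maximalSegment_swap {W : Set Plane} {u v : Plane} :
    MaximalSegment (Prod.swap '' W) u.swap v.swap ↔ MaximalSegment W u v := by
  refine ⟨fun h => ?_, MaximalSegment.swap⟩
  have := h.swap
  rwa [swap_image_swap_image, Prod.swap_swap, Prod.swap_swap] at this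

/-- A maximal segment cannot be extended beyond its end `v`. -/
theorem MaximalSegment.not_extend {W : Set Plane} {u v m : Plane} (h : MaximalSegment W u v)
    (hm : m ∈ segment ℝ u v) (hmv : m ≠ v) : ∀ δ > 0, ∃ ε, 0 < ε ∧ ε < δ ∧
      ((v.1 + ε * (v.1 - m.1), v.2 + ε * (v.2 - m.2)) : Plane) ∉ W := by
  intro δ hδ
  by_contra hcon
  push Not at hcon
  obtain ⟨t, t0, t1, e1, e2⟩ := mem_segment_coord.1 hm
  have t1' : t < 1 := by
    refine lt_of_le_of_ne t1 ?_
    rintro rfl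
    exact hmv (Prod.ext (by rw [e1]; ring) (by rw [e2]; ring))
  set w : Plane := (v.1 + δ / 2 * (v.1 - m.1), v.2 + δ / 2 * (v.2 - m.2)) with hw
  set k := δ / 2 * (1 - t) with hk
  have hk0 : 0 < k := mul_pos (by linarith) (by linarith)
  have w1 : w.1 = v.1 + k * (v.1 - u.1) := by simp only [hw, hk, e1]; ring
  have w2 : w.2 = v.2 + k * (v.2 - u.2) := by simp only [hw, hk, e2]; ring
  have hsub : segment ℝ u v ⊆ segment ℝ u w := by
    refine (convex_segment u w).segment_subset (left_mem_segment _ _ _)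
      (mem_segment_coord.2 ⟨1 / (1 + k), by positivity, (div_le_one (by linarith)).2 (by linarith),
        ?_, ?_⟩)
    · rw [w1]; field_simp; ring
    · rw [w2]; field_simp; ring
  have hin : segment ℝ u w ⊆ W := by
    intro z hz
    obtain ⟨r, r0, r1, z1, z2⟩ := mem_segment_coord.1 hz
    rcases le_total (r * (1 + k)) 1 with i | i
    · refine h.2.1 (mem_segment_coord.2 ⟨r * (1 + k), by positivity, i, ?_, ?_⟩)
      · rw [z1, w1]; ring
      · rw [z2, w2]; ring
    · rcases eq_or_lt_of_le i with e | i'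
      · refine h.2.1 (mem_segment_coord.2 ⟨r * (1 + k), by positivity, e.ge, ?_, ?_⟩)
        · rw [z1, w1]; ring
        · rw [z2, w2]; ring
      · have hpos : 0 < 1 - t := by linarith
        have := hcon ((r * (1 + k) - 1) / (1 - t)) (div_pos (by linarith) hpos) (by
          rw [div_lt_iff₀ hpos]
          have : r * (1 + k) ≤ 1 * (1 + k) := mul_le_mul_of_nonneg_right r1 (by linarith)
          have : k < δ * (1 - t) := by rw [hk]; nlinarith
          linarith)
        have e : z = (v.1 + (r * (1 + k) - 1) / (1 - t) * (v.1 - m.1),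
            v.2 + (r * (1 + k) - 1) / (1 - t) * (v.2 - m.2)) := by
          refine Prod.ext ?_ ?_ <;> simp only
          · rw [z1, w1, e1]; field_simp; ring
          · rw [z2, w2, e2]; field_simp; ring
        rwa [e]
  have hwv : w ∈ segment ℝ u v := by
    rw [← h.2.2 u w hsub hin]; exact right_mem_segment _ _ _
  obtain ⟨r, r0, r1, z1, z2⟩ := mem_segment_coord.1 hwv
  have h1 : (1 + k - r) * (v.1 - u.1) = 0 := by rw [w1] at z1; linear_combination z1
  have h2 : (1 + k - r) * (v.2 - u.2) = 0 := by rw [w2] at z2; linear_combination z2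
  have hne : 1 + k - r ≠ 0 := by linarith
  refine h.1 (Prod.ext ?_ ?_)
  · linarith [(mul_eq_zero.1 h1).resolve_left hne]
  · linarith [(mul_eq_zero.1 h2).resolve_left hne]

/-- Among the points visible from a compact set there is a most advanced one. -/
theorem exists_lexMax {W F : Set Plane} (hW : IsCompact W) (hF : IsCompact F) (hFW : F ⊆ W)
    (hne : F.Nonempty) : ∃ m ∈ F, ∃ v, segment ℝ m v ⊆ W ∧
      ∀ p ∈ F, ∀ n, segment ℝ p n ⊆ W → LexLe n v := by
  set C : Set (Plane × Plane) := (F ×ˢ W) ∩ {x | segment ℝ x.1 x.2 ⊆ W} with hC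
  have hCc : IsCompact C := (hF.prod hW).inter_right (isClosed_segment_subset hW.isClosed)
  obtain ⟨p, hp⟩ := hne
  have hCn : C.Nonempty := ⟨(p, p), ⟨hp, hFW hp⟩, by simpa using hFW hp⟩
  obtain ⟨x, hx, hmax⟩ := hCc.exists_isMaxOn hCn (f := fun x => x.2.1) (by fun_prop)
  have hC' : IsCompact (C ∩ {y | y.2.1 = x.2.1}) :=
    hCc.inter_right (isClosed_eq (by fun_prop) (by fun_prop))
  obtain ⟨y, ⟨hy, hy1⟩, hmax'⟩ := hC'.exists_isMaxOn ⟨x, hx, rfl⟩ (f := fun x => x.2.2)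
    (by fun_prop)
  refine ⟨y.1, hy.1.1, y.2, hy.2, fun p hp n hpn => ?_⟩
  have hpC : (p, n) ∈ C := ⟨⟨hp, hpn (right_mem_segment _ _ _)⟩, hpn⟩
  have h1 : n.1 ≤ x.2.1 := hmax hpC
  have hy1' : y.2.1 = x.2.1 := hy1
  rcases eq_or_lt_of_le h1 with e | e
  · exact Or.inr ⟨e.trans hy1'.symm, hmax' (show (p, n) ∈ _ from ⟨hpC, e⟩)⟩
  · exact Or.inl (hy1' ▸ e)

/-- The segment from `u` to `v` is a maximal segment that meets `f`. -/
def MeetsMaximal (W f : Set Plane) (u v : Plane) : Prop :=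
  MaximalSegment W u v ∧ (segment ℝ u v ∩ f).Nonempty

theorem MeetsMaximal.symm {W f : Set Plane} {u v : Plane} (h : MeetsMaximal W f u v) :
    MeetsMaximal W f v u := ⟨h.1.symm, by rw [segment_symm]; exact h.2⟩

/-- To bound the ends of all segments that start in `f` it suffices to bound the ends of the maximal
ones. -/
theorem lexLe_of_meetsMaximal {W f : Set Plane} (hW : IsCompact W) {v : Plane}
    (hmax : ∀ u' v', MeetsMaximal W f u' v' → LexLe v' v) {p n : Plane} (hp : p ∈ f) (hpn : p ≠ n)
    (hs : segment ℝ p n ⊆ W) : LexLe n v := by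
  obtain ⟨u', v', huv, hsub⟩ := exists_maximalSegment hW hpn hs
  have hm : MeetsMaximal W f u' v' := ⟨huv, p, hsub (left_mem_segment _ _ _), hp⟩
  rcases lexLe_of_mem_segment (hsub (right_mem_segment ℝ p n)) with i | i
  · exact i.trans (hmax _ _ hm.symm)
  · exact i.trans (hmax _ _ hm)

theorem exists_meetsMaximal {W f : Set Plane} (hW : IsCompact W) (hf : IsCompact f) (hfW : f ⊆ W)
    (hne : ∃ p ∈ f, ∃ n, segment ℝ p n ⊆ W ∧ ∀ q ∈ f, q.1 < n.1) :
    ∃ u v, MeetsMaximal W f u v ∧ ∀ u' v', MeetsMaximal W f u' v' → LexLe v' v := by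
  obtain ⟨p, hp, n, hpn, hlt⟩ := hne
  obtain ⟨m, hm, v, hmv, hmax⟩ := exists_lexMax hW hf hfW ⟨p, hp⟩
  have hne : m ≠ v := by
    rintro rfl
    have := (hmax p hp n hpn).fst_le
    have := hlt m hm
    linarith
  obtain ⟨u', v', huv, hsub⟩ := exists_maximalSegment hW hne hmv
  have hM : MeetsMaximal W f u' v' := ⟨huv, m, hsub (left_mem_segment _ _ _), hm⟩
  have hmax' : ∀ u'' v'', MeetsMaximal W f u'' v'' → LexLe v'' v := by
    rintro u'' v'' ⟨h1, q, hq, hqf⟩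
    exact hmax q hqf v'' (((convex_segment u'' v'').segment_subset hq
      (right_mem_segment _ _ _)).trans h1.2.1)
  rcases lexLe_of_mem_segment (hsub (right_mem_segment ℝ m v)) with i | i
  · exact ⟨v', u', hM.symm, fun _ _ hh => (hmax' _ _ hh).trans i⟩
  · exact ⟨u', v', hM, fun _ _ hh => (hmax' _ _ hh).trans i⟩

/-! ### Advancing from the covered box -/

/-- The maximal segment from `u` to `v` leads from the box with corner `K` to the new corner `v`,
and every segment of the region that starts in the old box ends in the new one. -/
structure Advance (W : Set Plane) (hi K u v : Plane) : Prop where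
  maximal : MaximalSegment W u v
  lower : u.1 ≤ K.1 ∧ u.2 ≤ K.2
  upper : K.1 ≤ v.1 ∧ K.2 ≤ v.2
  covered : IsCovered W hi v
  dominates : ∀ p n : Plane, (p.1 ≤ K.1 ∧ p.2 ≤ K.2) → segment ℝ p n ⊆ W → n.1 ≤ v.1 ∧ n.2 ≤ v.2

theorem Advance.swap {W : Set Plane} {hi K u v : Plane} (h : Advance W hi K u v) :
    Advance (Prod.swap '' W) hi.swap K.swap u.swap v.swap where
  maximal := h.maximal.swap
  lower := h.lower.symm
  upper := h.upper.symm
  covered := h.covered.swap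
  dominates p n hp hpn := by
    refine (h.dominates p.swap n.swap hp.symm ?_).symm
    rwa [← segment_swap_subset, Prod.swap_swap, Prod.swap_swap]

namespace Staircase

variable {W : Set Plane} {a c lo hi en K : Plane}

theorem isCompact_closure_frontierSet (h : Staircase W a c lo hi en) :
    IsCompact (closure (frontierSet W K)) :=
  h.isCompact.of_isClosed_subset isClosed_closure fun z hz => (h.closure_frontierSet_subset z hz).1

/-- A horizontal segment leads from an interior point to the right. -/
theorem exists_ray (h : Staircase W a c lo hi en) {z : Plane} (hz : z ∈ interior W) :
    ∃ n, segment ℝ z n ⊆ W ∧ z.1 < n.1 ∧ n.2 = z.2 := by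
  obtain ⟨δ, h0, hδ⟩ := exists_of_mem_interior hz
  have hzn : ((z.1 + δ / 2, z.2 + 0) : Plane) ∈ W :=
    hδ (δ / 2) 0 (by rw [abs_of_pos] <;> linarith) (by simpa using h0)
  exact ⟨_, h.segment_subset_of_snd_eq (interior_subset hz) hzn (by simp) (by simp only; linarith),
    by simp only; linarith, by simp⟩

theorem exists_right_edge (h : Staircase W a c lo hi en)
    (hR : ∃ z ∈ interior W, z.1 = K.1 ∧ z.2 ≤ K.2) :
    ∃ u v, MeetsMaximal W (closure (frontierSet W K)) u v ∧
      ∀ u' v', MeetsMaximal W (closure (frontierSet W K)) u' v' → LexLe v' v := by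
  obtain ⟨z, hz, z1, z2⟩ := hR
  obtain ⟨n, hn, h1, -⟩ := h.exists_ray hz
  refine exists_meetsMaximal h.isCompact h.isCompact_closure_frontierSet
    (fun z hz => (h.closure_frontierSet_subset z hz).1)
    ⟨z, subset_closure ⟨hz, Or.inl ⟨z1, z2⟩⟩, n, hn, fun q hq => ?_⟩
  have := (h.closure_frontierSet_subset q hq).2.1
  linarith

theorem advance_right (h : Staircase W a c lo hi en) (hK : IsCovered W hi K) (hc : K ≠ c)
    (hR : ∃ z ∈ interior W, z.1 = K.1 ∧ z.2 ≤ K.2) {u v : Plane}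
    (huv : MeetsMaximal W (closure (frontierSet W K)) u v)
    (hmax : ∀ u' v', MeetsMaximal W (closure (frontierSet W K)) u' v' → LexLe v' v) :
    Advance W hi K u v ∧ ∀ z ∈ W, z.2 ≤ K.2 → segment ℝ (K.1, z.2) z ⊆ W → z.1 ≤ v.1 := by
  obtain ⟨huv, m, hm, hmf⟩ := huv
  have hmK := (h.closure_frontierSet_subset m hmf).2
  have hmv : segment ℝ m v ⊆ W :=
    ((convex_segment u v).segment_subset hm (right_mem_segment _ _ _)).trans huv.2.1
  have hmax' : ∀ p n : Plane, (p.1 ≤ K.1 ∧ p.2 ≤ K.2) → segment ℝ p n ⊆ W →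
      (K.1 < n.1 ∨ K.2 < n.2) → n.1 < v.1 ∨ (n.1 = v.1 ∧ n.2 ≤ v.2) := by
    intro p n hp hpn hn
    obtain ⟨q, hq, hqf⟩ := h.exists_exit_closure hK hc hpn hp hn
    have hqK := (h.closure_frontierSet_subset q hqf).2
    refine lexLe_of_meetsMaximal h.isCompact hmax hqf ?_
      (((convex_segment p n).segment_subset hq (right_mem_segment _ _ _)).trans hpn)
    rintro rfl
    rcases hn with i | i
    exacts [absurd hqK.1 (not_le.2 i), absurd hqK.2 (not_le.2 i)]
  obtain ⟨h1, h2, h3⟩ := h.dominates_covered hK hmK hmv hmax' hR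
  have hne : m ≠ v := by
    rintro rfl
    exact absurd hmK.1 (not_le.2 h1)
  obtain ⟨t, t0, t1, e1, e2⟩ := mem_segment_coord.1 hm
  have t1' : t < 1 := by
    refine lt_of_le_of_ne t1 ?_
    rintro rfl
    exact hne (Prod.ext (by rw [e1]; ring) (by rw [e2]; ring))
  have low : ∀ x y k l : ℝ, k = (1 - t) * x + t * y → k ≤ l → l ≤ y → x ≤ l := by
    intro x y k l e i j
    by_contra hh
    have := mul_lt_mul_of_pos_left (not_le.1 hh) (sub_pos.2 t1')
    have := mul_le_mul_of_nonneg_left j t0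
    linarith
  refine ⟨⟨huv, ⟨low _ _ _ _ e1 hmK.1 h1.le, low _ _ _ _ e2 hmK.2 h2⟩, ⟨h1.le, h2⟩,
    h.covered_advance hK hmK hmv h1 h2 (huv.not_extend hm hne), h3⟩, fun z hz hz2 hs => ?_⟩
  exact (h3 (K.1, z.2) z ⟨le_rfl, hz2⟩ hs).1

/-! ### The first segments -/

/-- The end of a most advanced maximal segment from the left edge is the corner of a covered box,
which contains every segment that meets the left edge. -/
theorem covered_left (h : Staircase W a c lo hi en) {u v : Plane} (hu : u.1 = a.1)
    (huv : MaximalSegment W u v)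
    (hmax : ∀ u' v', u'.1 = a.1 → MaximalSegment W u' v' → LexLe v' v) :
    IsCovered W hi v ∧ (u.1 ≤ v.1 ∧ u.2 ≤ v.2) ∧
      ∀ p n : Plane, p.1 = a.1 → segment ℝ p n ⊆ W → n.1 ≤ v.1 ∧ n.2 ≤ v.2 := by
  have hmax' : ∀ p n : Plane, p.1 = a.1 → segment ℝ p n ⊆ W → a.1 < n.1 → LexLe n v := by
    intro p n hp hpn hn
    obtain ⟨u', v', huv', hsub⟩ := exists_maximalSegment h.isCompact
      (show p ≠ n by rintro rfl; exact hn.ne' hp) hpn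
    have hpm := hsub (left_mem_segment ℝ p n)
    have hnm := hsub (right_mem_segment ℝ p n)
    -- `p` is an end of the maximal segment
    have key : ∀ u' v' : Plane, MaximalSegment W u' v' → p ∈ segment ℝ u' v' →
        n ∈ segment ℝ u' v' → u'.1 < v'.1 → LexLe n v := by
      intro u' v' huv' hpm hnm hlt
      obtain ⟨t, t0, t1, e1, e2⟩ := mem_segment_coord.1 hpm
      have hu' := (h.ge u' (huv'.2.1 (left_mem_segment _ _ _))).1
      have ht : t * (v'.1 - u'.1) ≤ 0 := by linarith
      have ht' : t = 0 := by
        by_contra hh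
        have := mul_pos (lt_of_le_of_ne t0 (Ne.symm hh)) (sub_pos.2 hlt)
        linarith
      have hu1 : u'.1 = a.1 := by rw [← hp, e1, ht']; ring
      rcases lexLe_of_mem_segment hnm with i | i
      · have := i.fst_le; linarith
      · exact i.trans (hmax u' v' hu1 huv')
    rcases lt_trichotomy u'.1 v'.1 with i | i | i
    · exact key u' v' huv' hpm hnm i
    · obtain ⟨t, t0, t1, e1, e2⟩ := mem_segment_coord.1 hpm
      obtain ⟨s, s0, s1, e3, e4⟩ := mem_segment_coord.1 hnm
      rw [← i] at e1 e3
      exact absurd (show n.1 = a.1 by rw [← hp, e1, e3]; ring) hn.ne'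
    · rw [segment_symm] at hpm hnm
      exact key v' u' huv'.symm hpm hnm i
  have huW : u ∈ W := huv.2.1 (left_mem_segment _ _ _)
  have hvW : v ∈ W := huv.2.1 (right_mem_segment _ _ _)
  have ha := h.a_le_lo
  have hl1 := h.bot_lt
  have hl2 := h.left_lt
  have hch : ∀ p : Plane, p ∈ chain a.1 a.1 lo.2 hi.2 → p.1 = a.1 := by
    rintro p (⟨i, -, -⟩ | ⟨-, i, j⟩)
    exacts [i, le_antisymm j i]
  have hch' : ∀ p ∈ W, p.1 = a.1 → p ∈ chain a.1 a.1 lo.2 hi.2 := fun p hp e =>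
    Or.inl ⟨e, h.left p hp e⟩
  have hpt : ((hi.1, hi.2) : Plane) ∈ W := h.mem_of h.left_hi h.bot_hi h.left_hi
    (by simp only; linarith) le_rfl le_rfl (by simp only; linarith) (by simp only; linarith) le_rfl
  have hseg : segment ℝ ((a.1, hi.2) : Plane) (hi.1, hi.2) ⊆ W :=
    h.segment_subset_of_snd_eq h.left_hi hpt rfl (by simp only; linarith)
  have hE : ∀ z : Plane, (a.1 ≤ z.1 ∧ lo.2 ≤ z.2) ∨ (hi.2 ≤ z.2 ∧ a.1 ≤ z.1) →
      ∃ w ∈ W, w.1 ≤ z.1 ∧ w.2 ≤ z.2 := by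
    rintro z (⟨i, j⟩ | ⟨i, j⟩)
    exacts [⟨_, h.left_lo, i, j⟩, ⟨_, h.left_hi, j, i⟩]
  have hlt : ∀ n : Plane, n ∈ W → (a.1 < n.1 ∨ hi.2 < n.2) → a.1 < n.1 := by
    intro n hn i
    refine lt_of_le_of_ne (h.ge n hn).1 fun e => ?_
    rcases i with i | i
    · exact i.ne e
    · exact absurd (h.left n hn e.symm).2 (not_le.2 i)
  obtain ⟨h1, h2, h3⟩ := h.dominates_of_max le_rfl hl2.le hE h.left_hi (hch' u huW hu) huv.2.1
    (fun p hp n hpn hn => hmax' p n (hch p hp) hpn (hlt n (hpn (right_mem_segment _ _ _)) hn))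
    ⟨_, hch' _ h.left_hi rfl, _, hseg, by simp only; linarith⟩
  have h4 : hi.1 ≤ v.1 := (hmax' (a.1, hi.2) (hi.1, hi.2) rfl hseg (by simp only; linarith)).fst_le
  have huh := (h.left u huW hu).2
  have hext := huv.not_extend (left_mem_segment ℝ u v) huv.1
  refine ⟨⟨hvW, h4, h2, ?_, ?_⟩, ⟨by linarith, by linarith⟩, fun p n hp hpn => ?_⟩
  · exact h.passable_of_ascending huv.2.1 (by linarith) (by linarith) hext
  · rcases eq_or_lt_of_le h2 with e | i
    · rw [← e]; exact h.swap.passable_hi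
    · refine h.swap.passable_of_ascending (m := u.swap) (v := v.swap)
        (segment_swap_subset.2 huv.2.1) (huh.trans_lt i) (hu.trans_le h1.le) fun δ hδ => ?_
      obtain ⟨ε, e1, e2, e3⟩ := hext δ hδ
      exact ⟨ε, e1, e2, fun hh => e3 (swap_image_mem.1 hh)⟩
  · have hpW := hpn (left_mem_segment _ _ _)
    have hnW := hpn (right_mem_segment _ _ _)
    rcases eq_or_lt_of_le (h.ge n hnW).1 with e | i
    · exact ⟨by linarith, (h.left n hnW e.symm).2.trans h2⟩
    · exact h3 p (hch' p hpW hp) n hpn (Or.inl ⟨hp, i.le⟩) (Or.inl i)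

theorem exists_left (h : Staircase W a c lo hi en) :
    ∃ u v, u.1 = a.1 ∧ MaximalSegment W u v ∧
      ∀ u' v', u'.1 = a.1 → MaximalSegment W u' v' → LexLe v' v := by
  have hF : IsCompact (W ∩ {z | z.1 = a.1}) :=
    h.isCompact.inter_right (isClosed_eq continuous_fst continuous_const)
  obtain ⟨m, ⟨hm, hm1⟩, v, hmv, hmax⟩ := exists_lexMax h.isCompact hF Set.inter_subset_left
    ⟨_, h.left_hi, rfl⟩
  have ha := h.a_le_lo
  have hl1 := h.bot_lt
  have hl2 := h.left_lt
  have hpt : ((hi.1, hi.2) : Plane) ∈ W := h.mem_of h.left_hi h.bot_hi h.left_hi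
    (by simp only; linarith) le_rfl le_rfl (by simp only; linarith) (by simp only; linarith) le_rfl
  have hseg : segment ℝ ((a.1, hi.2) : Plane) (hi.1, hi.2) ⊆ W :=
    h.segment_subset_of_snd_eq h.left_hi hpt rfl (by simp only; linarith)
  have hv1 : hi.1 ≤ v.1 := (hmax _ ⟨h.left_hi, rfl⟩ _ hseg).fst_le
  have hm1' : m.1 = a.1 := hm1
  have hmax' : ∀ u' v', u'.1 = a.1 → MaximalSegment W u' v' → LexLe v' v := fun u' v' hu hv =>
    hmax u' ⟨hv.2.1 (left_mem_segment _ _ _), hu⟩ v' hv.2.1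
  obtain ⟨u', v', huv, hsub⟩ := exists_maximalSegment h.isCompact
    (show m ≠ v by rintro rfl; linarith) hmv
  have hmm := hsub (left_mem_segment ℝ m v)
  have hvm := hsub (right_mem_segment ℝ m v)
  have key : ∀ u' v' : Plane, MaximalSegment W u' v' → m ∈ segment ℝ u' v' →
      v ∈ segment ℝ u' v' → u'.1 < v'.1 → ∃ u v, u.1 = a.1 ∧ MaximalSegment W u v ∧
      ∀ u' v', u'.1 = a.1 → MaximalSegment W u' v' → LexLe v' v := by
    intro u' v' huv' hpm hnm hlt
    obtain ⟨t, t0, t1, e1, e2⟩ := mem_segment_coord.1 hpm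
    have hu' := (h.ge u' (huv'.2.1 (left_mem_segment _ _ _))).1
    have ht : t * (v'.1 - u'.1) ≤ 0 := by linarith
    have ht' : t = 0 := by
      by_contra hh
      have := mul_pos (lt_of_le_of_ne t0 (Ne.symm hh)) (sub_pos.2 hlt)
      linarith
    have hu1 : u'.1 = a.1 := by rw [← hm1', e1, ht']; ring
    refine ⟨u', v', hu1, huv', fun u'' v'' i j => (hmax' u'' v'' i j).trans ?_⟩
    rcases lexLe_of_mem_segment hnm with i | i
    · have := i.fst_le; linarith
    · exact i
  rcases lt_trichotomy u'.1 v'.1 with i | i | i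
  · exact key u' v' huv hmm hvm i
  · obtain ⟨t, t0, t1, e1, e2⟩ := mem_segment_coord.1 hmm
    obtain ⟨s, s0, s1, e3, e4⟩ := mem_segment_coord.1 hvm
    rw [← i] at e1 e3
    have : v.1 = m.1 := by rw [e1, e3]; ring
    linarith
  · rw [segment_symm] at hmm hvm
    exact key v' u' huv.symm hmm hvm i

/-- The box that contains two covered boxes is covered. -/
theorem covered_sup (h : Staircase W a c lo hi en) {v₁ v₂ : Plane} (h1 : IsCovered W hi v₁)
    (h2 : IsCovered W hi v₂) : IsCovered W hi (max v₁.1 v₂.1, max v₁.2 v₂.2) where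
  mem := by
    rcases le_total v₁.1 v₂.1 with i | i <;> rcases le_total v₁.2 v₂.2 with j | j <;>
    simp only [i, j, max_eq_left, max_eq_right]
    · exact h2.mem
    · exact h.mem_of h1.mem h2.mem h1.mem i le_rfl le_rfl j i le_rfl
    · exact h.mem_of h2.mem h1.mem h1.mem i le_rfl le_rfl j le_rfl j
    · exact h1.mem
  fst_le := h1.fst_le.trans (le_max_left _ _)
  snd_le := h1.snd_le.trans (le_max_left _ _)
  passable := by
    rcases max_choice v₁.1 v₂.1 with e | e <;> simp only [e]
    exacts [h1.passable, h2.passable]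
  passable_swap := by
    rcases max_choice v₁.2 v₂.2 with e | e <;> simp only [e]
    exacts [h1.passable_swap, h2.passable_swap]

/-- If the segment from the left edge reaches as far to the right as the one from the bottom edge,
it meets this one or passes above its end, and a point above the end would be visible from the
bottom edge. -/
theorem meet_of_le (h : Staircase W a c lo hi en) {u₁ v₁ u₂ v₂ : Plane} (hu₁ : u₁.1 = a.1)
    (hu₂ : u₂.2 = a.2) (hs₁ : segment ℝ u₁ v₁ ⊆ W) (hs₂ : segment ℝ u₂ v₂ ⊆ W)
    (ha₁ : u₁.2 ≤ v₁.2) (ha₂ : u₂.1 ≤ v₂.1) (hv₁ : a.1 < v₁.1)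
    (hd₂ : ∀ p n : Plane, p.2 = a.2 → segment ℝ p n ⊆ W → n.2 ≤ v₂.2) (hle : v₂.1 ≤ v₁.1) :
    (segment ℝ u₁ v₁ ∩ segment ℝ u₂ v₂).Nonempty := by
  have hd : 0 < v₁.1 - u₁.1 := by linarith
  have hu₁W := h.ge u₁ (hs₁ (left_mem_segment _ _ _))
  have hu₂W := h.ge u₂ (hs₂ (left_mem_segment _ _ _))
  have hv₂W := h.ge v₂ (hs₂ (right_mem_segment _ _ _))
  have hdiv : ∀ x, a.1 ≤ x → x ≤ v₁.1 → 0 ≤ (x - u₁.1) / (v₁.1 - u₁.1) ∧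
      (x - u₁.1) / (v₁.1 - u₁.1) ≤ 1 ∧
      (pointAt u₁ v₁ ((x - u₁.1) / (v₁.1 - u₁.1))).1 = x := by
    intro x h1 h2
    refine ⟨div_nonneg (by linarith) hd.le, (div_le_one hd).2 (by linarith), ?_⟩
    simp only [pointAt]; field_simp; ring
  obtain ⟨μ0, μ1, e⟩ := hdiv v₂.1 hv₂W.1 hle
  set μ := (v₂.1 - u₁.1) / (v₁.1 - u₁.1) with hμ
  rcases le_or_gt (pointAt u₁ v₁ μ).2 v₂.2 with i | i
  · -- the ends of the second segment are on both sides of the line of the first one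
    have hc : ContinuousOn (fun t : ℝ => (v₁.1 - u₁.1) * ((pointAt u₂ v₂ t).2 - u₁.2)
        - (v₁.2 - u₁.2) * ((pointAt u₂ v₂ t).1 - u₁.1)) (Set.Icc 0 1) := by
      unfold pointAt; fun_prop
    have hm0 : μ * (v₁.1 - u₁.1) = v₂.1 - u₁.1 := div_mul_cancel₀ _ hd.ne'
    obtain ⟨t, ⟨t0, t1⟩, ht⟩ := intermediate_value_Icc zero_le_one hc
      (show (0 : ℝ) ∈ _ by
        constructor
        · simp only [pointAt]
          have := mul_nonneg (sub_nonneg.2 ha₁) (show 0 ≤ u₂.1 - u₁.1 by linarith)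
          have := mul_nonneg hd.le (show 0 ≤ u₁.2 - u₂.2 by linarith)
          linarith
        · simp only [pointAt] at i ⊢
          have := mul_nonneg hd.le (sub_nonneg.2 i)
          have e2 := congrArg (fun y => (v₁.2 - u₁.2) * y) hm0
          linarith)
    simp only at ht
    set o := pointAt u₂ v₂ t with ho
    have o1 : a.1 ≤ o.1 := le_convexComb t0 t1 hu₂W.1 hv₂W.1
    have o2 : o.1 ≤ v₁.1 := convexComb_le_right t0 t1 (by linarith) hle
    obtain ⟨ν0, ν1, e'⟩ := hdiv o.1 o1 o2
    refine ⟨o, mem_segment_coord.2 ⟨_, ν0, ν1, e'.symm, ?_⟩, pointAt_mem t0 t1⟩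
    field_simp
    linear_combination ht
  · -- otherwise a higher point is visible from the lower edge
    have hoW := hs₁ (pointAt_mem μ0 μ1)
    set o := pointAt u₁ v₁ μ with ho
    have hs : segment ℝ u₂ o ⊆ W := by
      intro z hz
      obtain ⟨t, t0, t1, e1, e2⟩ := mem_segment_coord.1 hz
      have hmo : segment ℝ u₁ o ⊆ W := ((convex_segment u₁ v₁).segment_subset
        (left_mem_segment _ _ _) (pointAt_mem μ0 μ1)).trans hs₁
      refine h.mem_of (hmo (pointAt_mem t0 t1)) (hs₂ (pointAt_mem t0 t1))
        (hs₂ (left_mem_segment _ _ _)) ?_ ?_ ?_ ?_ ?_ ?_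
      · rw [e1]; exact convexComb_le t0 t1 (by linarith) le_rfl
      · rw [e2]; exact convexComb_le t0 t1 (by linarith) le_rfl
      · rw [e1]; exact convexComb_le t0 t1 le_rfl e.le
      · rw [e2]; exact convexComb_le t0 t1 le_rfl i.le
      · rw [e1]; exact le_convexComb t0 t1 le_rfl (by linarith)
      · rw [e2]; exact le_convexComb t0 t1 le_rfl (by linarith)
    exact absurd (hd₂ u₂ o hu₂ hs) (not_le.2 i)

/-- Most advanced segments from the left and the bottom edge meet. -/
theorem meet_of_dominates (h : Staircase W a c lo hi en) {u₁ v₁ u₂ v₂ : Plane} (hu₁ : u₁.1 = a.1)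
    (hu₂ : u₂.2 = a.2) (hs₁ : segment ℝ u₁ v₁ ⊆ W) (hs₂ : segment ℝ u₂ v₂ ⊆ W)
    (ha₁ : u₁.2 ≤ v₁.2) (ha₂ : u₂.1 ≤ v₂.1) (hv₁ : a.1 < v₁.1) (hv₂ : a.2 < v₂.2)
    (hd₁ : ∀ p n : Plane, p.1 = a.1 → segment ℝ p n ⊆ W → n.1 ≤ v₁.1)
    (hd₂ : ∀ p n : Plane, p.2 = a.2 → segment ℝ p n ⊆ W → n.2 ≤ v₂.2) :
    (segment ℝ u₁ v₁ ∩ segment ℝ u₂ v₂).Nonempty := by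
  rcases le_or_gt v₂.1 v₁.1 with i | i
  · exact h.meet_of_le hu₁ hu₂ hs₁ hs₂ ha₁ ha₂ hv₁ hd₂ i
  rcases le_or_gt v₁.2 v₂.2 with j | j
  · have := h.swap.meet_of_le (u₁ := u₂.swap) (v₁ := v₂.swap) (u₂ := u₁.swap) (v₂ := v₁.swap)
      hu₂ hu₁ (segment_swap_subset.2 hs₂) (segment_swap_subset.2 hs₁) ha₂ ha₁ hv₂
      (fun p n hp hpn => hd₁ p.swap n.swap hp (by
        rwa [← segment_swap_subset, Prod.swap_swap, Prod.swap_swap])) j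
    rw [segment_swap, segment_swap, ← Set.image_inter Prod.swap_injective, Set.image_nonempty,
      Set.inter_comm] at this
    exact this
  · have hv₁W := hs₁ (right_mem_segment ℝ u₁ v₁)
    have hv₂W := hs₂ (right_mem_segment ℝ u₂ v₂)
    have hu₁W := h.ge u₁ (hs₁ (left_mem_segment _ _ _))
    have hu₂W := h.ge u₂ (hs₂ (left_mem_segment _ _ _))
    have hs : segment ℝ u₂ ((v₂.1, v₁.2) : Plane) ⊆ W := by
      intro z hz
      obtain ⟨t, t0, t1, e1, e2⟩ := mem_segment_coord.1 hz
      simp only at e1 e2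
      refine h.mem_of (hs₁ (pointAt_mem t0 t1)) (hs₂ (pointAt_mem t0 t1))
        (hs₂ (left_mem_segment _ _ _)) ?_ ?_ ?_ ?_ ?_ ?_
      · rw [e1]; exact convexComb_le t0 t1 (by linarith) i.le
      · rw [e2]; exact convexComb_le t0 t1 (by linarith) le_rfl
      · rw [e1]; exact le_rfl
      · rw [e2]; exact convexComb_le t0 t1 le_rfl j.le
      · rw [e1]; exact le_convexComb t0 t1 le_rfl (by linarith)
      · rw [e2]; exact le_convexComb t0 t1 le_rfl (by linarith)
    exact absurd (hd₂ u₂ _ hu₂ hs) (not_le.2 j)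

end Staircase

/-! ### Linked sets of segments are skeletons -/

/-- `Obstacle.IsSkeleton` for an arbitrary region. -/
def IsSkeletonOf (W : Set Plane) (S : Set (Set Plane)) : Prop :=
  (∀ s ∈ S, (∃ a b : Plane, a ≠ b ∧ s = segment ℝ a b) ∧ s ⊆ W) ∧
    ∀ p q : Plane, p ∉ interior W → q ∉ interior W →
      (∀ P, IsOneCornerPath p q P → (P ∩ interior W).Nonempty) →
        ∀ P, IsOneCornerPath p q P → ∃ s ∈ S, (P ∩ s).Nonempty

/-- The condition on a set of segments inside the box `[a, K]` that makes it meet every path that a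
skeleton has to meet. The segments project onto both sides of the box. Their union need not be
connected, but quadrants cannot separate it: if every segment lies either in the open lower left
quadrant at a point or outside the closed one, and if a certain connected part `U` of the union that
touches the left and the bottom edge lies in it, then so do all segments; and if every segment lies
either in the open upper right quadrant at a point of the region or outside the closed one, then all
of them are outside. -/
structure Linked (W : Set Plane) (a K : Plane) (S : Set (Set Plane)) : Prop where
  finite : S.Finite
  segments : ∀ s ∈ S, ∃ p q : Plane, p ≠ q ∧ s = segment ℝ p q
  subset : ∀ s ∈ S, s ⊆ W
  le : ∀ s ∈ S, ∀ w ∈ s, w.1 ≤ K.1 ∧ w.2 ≤ K.2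
  cover_fst : ∀ x, a.1 ≤ x → x ≤ K.1 → ∃ s ∈ S, ∃ w ∈ s, w.1 = x
  cover_snd : ∀ y, a.2 ≤ y → y ≤ K.2 → ∃ s ∈ S, ∃ w ∈ s, w.2 = y
  lowerLeft : ∃ U ⊆ ⋃₀ S, IsPreconnected U ∧ (∃ w ∈ U, w.1 = a.1) ∧ (∃ w ∈ U, w.2 = a.2) ∧
    ∀ z : Plane, (∀ s ∈ S, (∀ w ∈ s, w.1 < z.1 ∧ w.2 < z.2) ∨
      ∀ w ∈ s, ¬ (w.1 ≤ z.1 ∧ w.2 ≤ z.2)) → (∀ w ∈ U, w.1 < z.1 ∧ w.2 < z.2) →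
        ∀ s ∈ S, ∀ w ∈ s, w.1 < z.1 ∧ w.2 < z.2
  upperRight : ∀ z ∈ W, (∀ s ∈ S, (∀ w ∈ s, z.1 < w.1 ∧ z.2 < w.2) ∨
      ∀ w ∈ s, ¬ (z.1 ≤ w.1 ∧ z.2 ≤ w.2)) → ∀ s ∈ S, ∀ w ∈ s, ¬ (z.1 ≤ w.1 ∧ z.2 ≤ w.2)

theorem Linked.isCompact {W : Set Plane} {a K : Plane} {S : Set (Set Plane)}
    (h : Linked W a K S) : IsCompact (⋃₀ S) := by
  refine h.finite.isCompact_sUnion fun s hs => ?_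
  obtain ⟨p, q, -, rfl⟩ := h.segments s hs
  rw [segment_eq_image]
  exact isCompact_Icc.image (by fun_prop)

theorem exists_fst_of_preconnected {U : Set Plane} (hU : IsPreconnected U) {p q : Plane}
    (hp : p ∈ U) (hq : q ∈ U) {x : ℝ} (h1 : p.1 ≤ x) (h2 : x ≤ q.1) : ∃ w ∈ U, w.1 = x :=
  (hU.image Prod.fst continuous_fst.continuousOn).ordConnected.out ⟨p, hp, rfl⟩ ⟨q, hq, rfl⟩
    ⟨h1, h2⟩

theorem exists_snd_of_preconnected {U : Set Plane} (hU : IsPreconnected U) {p q : Plane}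
    (hp : p ∈ U) (hq : q ∈ U) {x : ℝ} (h1 : p.2 ≤ x) (h2 : x ≤ q.2) : ∃ w ∈ U, w.2 = x :=
  (hU.image Prod.snd continuous_snd.continuousOn).ordConnected.out ⟨p, hp, rfl⟩ ⟨q, hq, rfl⟩
    ⟨h1, h2⟩

theorem isPreconnected_segment (p q : Plane) : IsPreconnected (segment ℝ p q) :=
  (convex_segment p q).isPreconnected

/-- A connected union of segments, each of which touches the left or the bottom edge, is linked. -/
theorem linked_of_preconnected {W : Set Plane} {a K : Plane} {S : Set (Set Plane)}
    (hge : ∀ w ∈ W, a.1 ≤ w.1 ∧ a.2 ≤ w.2) (hfin : S.Finite)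
    (hseg : ∀ s ∈ S, ∃ p q : Plane, p ≠ q ∧ s = segment ℝ p q) (hsub : ∀ s ∈ S, s ⊆ W)
    (hle : ∀ s ∈ S, ∀ w ∈ s, w.1 ≤ K.1 ∧ w.2 ≤ K.2) (hU : IsPreconnected (⋃₀ S))
    (htouch : ∀ s ∈ S, ∃ w ∈ s, w.1 = a.1 ∨ w.2 = a.2) (hl : ∃ w ∈ ⋃₀ S, w.1 = a.1)
    (hb : ∃ w ∈ ⋃₀ S, w.2 = a.2) (hr : ∃ w ∈ ⋃₀ S, w.1 = K.1) (ht : ∃ w ∈ ⋃₀ S, w.2 = K.2) :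
    Linked W a K S where
  finite := hfin
  segments := hseg
  subset := hsub
  le := hle
  cover_fst x h1 h2 := by
    obtain ⟨l, hl, e1⟩ := hl
    obtain ⟨r, hr, e2⟩ := hr
    obtain ⟨w, ⟨s, hs, hw⟩, e⟩ := exists_fst_of_preconnected hU hl hr (e1.trans_le h1)
      (h2.trans e2.ge)
    exact ⟨s, hs, w, hw, e⟩
  cover_snd x h1 h2 := by
    obtain ⟨l, hl, e1⟩ := hb
    obtain ⟨r, hr, e2⟩ := ht
    obtain ⟨w, ⟨s, hs, hw⟩, e⟩ := exists_snd_of_preconnected hU hl hr (e1.trans_le h1)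
      (h2.trans e2.ge)
    exact ⟨s, hs, w, hw, e⟩
  lowerLeft := ⟨⋃₀ S, subset_rfl, hU, hl, hb, fun _ _ hin s hs w hw => hin w ⟨s, hs, hw⟩⟩
  upperRight z hz hS s hs := by
    refine (hS s hs).resolve_left fun hin => ?_
    obtain ⟨w, hw, e | e⟩ := htouch s hs
    · exact absurd (hin w hw).1 (not_lt.2 (e ▸ (hge z hz).1))
    · exact absurd (hin w hw).2 (not_lt.2 (e ▸ (hge z hz).2))

/-- A linked set stays linked when the covered box advances. If the new segment lay to the upper
right of a point `z` of the region and the others did not, then it could be extended beyond its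
lower end: the four quadrants at a point just before this end contain `z`, the corner `c`, and the
points at which the old segments reach the right and the top side of the old box. -/
theorem Linked.advance {W : Set Plane} {a c lo hi en K u v : Plane} {S : Set (Set Plane)}
    (hW : Staircase W a c lo hi en) (h : Linked W a K S) (hK : IsCovered W hi K)
    (hA : Advance W hi K u v) : Linked W a v (insert (segment ℝ u v) S) where
  finite := h.finite.insert _
  segments := by
    rintro s (rfl | hs)
    exacts [⟨u, v, hA.maximal.1, rfl⟩, h.segments s hs]
  subset := by
    rintro s (rfl | hs)
    exacts [hA.maximal.2.1, h.subset s hs]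
  le := by
    rintro s (rfl | hs) w hw
    · obtain ⟨t, t0, t1, e1, e2⟩ := mem_segment_coord.1 hw
      rw [e1, e2]
      exact ⟨convexComb_le_right t0 t1 (hA.lower.1.trans hA.upper.1) le_rfl,
        convexComb_le_right t0 t1 (hA.lower.2.trans hA.upper.2) le_rfl⟩
    · exact ⟨(h.le s hs w hw).1.trans hA.upper.1, (h.le s hs w hw).2.trans hA.upper.2⟩
  cover_fst x h1 h2 := by
    rcases le_total x K.1 with i | i
    · obtain ⟨s, hs, w, hw, e⟩ := h.cover_fst x h1 i
      exact ⟨s, Or.inr hs, w, hw, e⟩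
    · obtain ⟨w, hw, e⟩ := exists_fst_of_preconnected (isPreconnected_segment u v)
        (left_mem_segment _ _ _) (right_mem_segment _ _ _) (hA.lower.1.trans i) h2
      exact ⟨_, Or.inl rfl, w, hw, e⟩
  cover_snd x h1 h2 := by
    rcases le_total x K.2 with i | i
    · obtain ⟨s, hs, w, hw, e⟩ := h.cover_snd x h1 i
      exact ⟨s, Or.inr hs, w, hw, e⟩
    · obtain ⟨w, hw, e⟩ := exists_snd_of_preconnected (isPreconnected_segment u v)
        (left_mem_segment _ _ _) (right_mem_segment _ _ _) (hA.lower.2.trans i) h2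
      exact ⟨_, Or.inl rfl, w, hw, e⟩
  lowerLeft := by
    obtain ⟨U, hU, hUc, hl, hb, hin⟩ := h.lowerLeft
    have ha := hW.a_lt_covered hK
    refine ⟨U, hU.trans (Set.sUnion_subset_sUnion (Set.subset_insert _ _)), hUc, hl, hb,
      fun z hz hUz => ?_⟩
    have hS := hin z (fun s hs => hz s (Or.inr hs)) hUz
    obtain ⟨s1, hs1, w1, hw1, e1⟩ := h.cover_fst K.1 ha.1.le le_rfl
    obtain ⟨s2, hs2, w2, hw2, e2⟩ := h.cover_snd K.2 ha.2.le le_rfl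
    have k1 := (hS s1 hs1 w1 hw1).1
    have k2 := (hS s2 hs2 w2 hw2).2
    rintro s (rfl | hs)
    · exact (hz _ (Or.inl rfl)).resolve_right fun hh => hh u (left_mem_segment _ _ _)
        ⟨by linarith [hA.lower.1], by linarith [hA.lower.2]⟩
    · exact hS s hs
  upperRight z hz hS := by
    have ha := hW.a_lt_covered hK
    have hold := h.upperRight z hz fun s hs => hS s (Or.inr hs)
    rintro s (rfl | hs)
    swap
    · exact hold s hs
    refine (hS _ (Or.inl rfl)).resolve_left fun hin => ?_
    have hu := hin u (left_mem_segment _ _ _)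
    obtain ⟨s1, hs1, w1, hw1, e1⟩ := h.cover_fst K.1 ha.1.le le_rfl
    obtain ⟨s2, hs2, w2, hw2, e2⟩ := h.cover_snd K.2 ha.2.le le_rfl
    have hl := hA.lower
    have hup := hA.upper
    have k1 : w1.2 < z.2 := by
      by_contra hh
      exact hold s1 hs1 w1 hw1 ⟨by linarith [hu.1], not_lt.1 hh⟩
    have k2 : w2.1 < z.1 := by
      by_contra hh
      exact hold s2 hs2 w2 hw2 ⟨not_lt.1 hh, by linarith [hu.2]⟩
    have d1 : 0 ≤ v.1 - u.1 := by linarith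
    have d2 : 0 ≤ v.2 - u.2 := by linarith
    obtain ⟨ε, ε0, εδ, hε⟩ := hA.maximal.symm.not_extend (left_mem_segment ℝ v u)
      hA.maximal.1.symm (min ((u.1 - z.1) / (v.1 - u.1 + 1)) ((u.2 - z.2) / (v.2 - u.2 + 1)))
      (lt_min (div_pos (by linarith) (by linarith)) (div_pos (by linarith) (by linarith)))
    have k3 := (lt_div_iff₀ (by linarith)).1 (εδ.trans_le (min_le_left _ _))
    have k4 := (lt_div_iff₀ (by linarith)).1 (εδ.trans_le (min_le_right _ _))
    have k5 := mul_nonneg ε0.le d1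
    have k6 := mul_nonneg ε0.le d2
    refine hε (hW.mem_of (h.subset s2 hs2 hw2) (h.subset s1 hs1 hw1) hz ?_ ?_ ?_ ?_ ?_ ?_) <;>
    simp only <;> linarith

theorem isClosed_segment_meets {U : Set Plane} (hU : IsClosed U) {f g : Plane × Plane → Plane}
    (hf : Continuous f) (hg : Continuous g) :
    IsClosed {x | (segment ℝ (f x) (g x) ∩ U).Nonempty} := by
  have h3 : IsClosed (Prod.fst '' {y : (Plane × Plane) × Set.Icc (0 : ℝ) 1 |
      pointAt (f y.1) (g y.1) y.2 ∈ U}) := by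
    refine isClosedMap_fst_of_compactSpace _ (hU.preimage ?_)
    unfold pointAt
    fun_prop
  convert h3 using 1
  ext x
  simp only [Set.mem_ofPred_eq, Set.mem_image, Prod.exists, exists_and_right, exists_eq_right,
    Subtype.exists]
  constructor
  · rintro ⟨z, hz, hzU⟩
    obtain ⟨t, h0, h1, hx, hy⟩ := mem_segment_coord.1 hz
    exact ⟨t, ⟨h0, h1⟩, by rwa [show pointAt (f x) (g x) t = z from Prod.ext hx.symm hy.symm]⟩
  · rintro ⟨t, ⟨h0, h1⟩, ht⟩
    exact ⟨_, pointAt_mem h0 h1, ht⟩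

theorem isOpen_segment_meets {O : Set Plane} (hO : IsOpen O) {f g : Plane × Plane → Plane}
    (hf : Continuous f) (hg : Continuous g) :
    IsOpen {x | (segment ℝ (f x) (g x) ∩ O).Nonempty} := by
  have : {x | (segment ℝ (f x) (g x) ∩ O).Nonempty} =
      ⋃ t ∈ Set.Icc (0 : ℝ) 1, {x | pointAt (f x) (g x) t ∈ O} := by
    ext x
    simp only [Set.mem_ofPred_eq, Set.mem_iUnion, Set.mem_Icc, exists_prop]
    constructor
    · rintro ⟨z, hz, hzU⟩
      obtain ⟨t, h0, h1, hx, hy⟩ := mem_segment_coord.1 hz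
      exact ⟨t, ⟨h0, h1⟩, by rwa [show pointAt (f x) (g x) t = z from Prod.ext hx.symm hy.symm]⟩
    · rintro ⟨t, ⟨h0, h1⟩, ht⟩
      exact ⟨_, pointAt_mem h0 h1, ht⟩
  rw [this]
  refine isOpen_biUnion fun t _ => hO.preimage ?_
  unfold pointAt
  fun_prop

/-- A connected set that does not meet the boundary layer `C \ O` is on one side of it. -/
theorem preconnected_dichotomy {T O C : Set Plane} (hT : IsPreconnected T) (hO : IsOpen O)
    (hC : IsClosed C) (hOC : O ⊆ C) (h : ∀ w ∈ T, w ∈ C → w ∈ O) :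
    (∀ w ∈ T, w ∈ O) ∨ ∀ w ∈ T, w ∉ C := by
  refine hT.subset_or_subset hO hC.isOpen_compl ?_ ?_
  · exact Set.disjoint_left.2 fun w h1 h2 => h2 (hOC h1)
  · intro w hw
    by_cases hc : w ∈ C
    exacts [Or.inl (h w hw hc), Or.inr hc]

theorem mem_segment_of_snd_eq {p z k : Plane} (h1 : p.2 = z.2) (h2 : k.2 = z.2)
    (h : (p.1 ≤ k.1 ∧ k.1 ≤ z.1) ∨ (z.1 ≤ k.1 ∧ k.1 ≤ p.1)) : k ∈ segment ℝ p z := by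
  have key : ∀ p z : Plane, p.2 = z.2 → k.2 = z.2 → p.1 ≤ k.1 → k.1 ≤ z.1 →
      k ∈ segment ℝ p z := by
    intro p z h1 h2 h3 h4
    rcases eq_or_lt_of_le (h3.trans h4) with e | e
    · rw [show k = p from Prod.ext (by linarith) (h2.trans h1.symm)]
      exact left_mem_segment _ _ _
    · have : z.1 - p.1 ≠ 0 := by linarith
      refine mem_segment_coord.2 ⟨(k.1 - p.1) / (z.1 - p.1), div_nonneg (by linarith) (by linarith),
        (div_le_one (by linarith)).2 (by linarith), ?_, ?_⟩
      · field_simp; ring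
      · rw [h1, h2]; ring
  rcases h with ⟨i, j⟩ | ⟨i, j⟩
  · exact key p z h1 h2 i j
  · rw [segment_symm]
    exact key z p h1.symm (h2.trans h1.symm) i j

theorem mem_segment_of_fst_eq {p z k : Plane} (h1 : p.1 = z.1) (h2 : k.1 = z.1)
    (h : (p.2 ≤ k.2 ∧ k.2 ≤ z.2) ∨ (z.2 ≤ k.2 ∧ k.2 ≤ p.2)) : k ∈ segment ℝ p z := by
  have := mem_segment_of_snd_eq (p := p.swap) (z := z.swap) (k := k.swap) h1 h2 h
  rwa [segment_swap, Set.mem_image_iff_of_inverse Prod.swap_leftInverse Prod.swap_rightInverse,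
    Prod.swap_swap] at this

theorem snd_eq_of_mem_segment {p z k : Plane} (h1 : p.2 = z.2) (h : k ∈ segment ℝ p z) :
    k.2 = z.2 ∧ ((p.1 ≤ k.1 ∧ k.1 ≤ z.1) ∨ (z.1 ≤ k.1 ∧ k.1 ≤ p.1)) := by
  obtain ⟨t, t0, t1, e1, e2⟩ := mem_segment_coord.1 h
  refine ⟨by rw [e2, h1]; ring, ?_⟩
  rw [e1]
  rcases le_total p.1 z.1 with i | i
  · exact Or.inl ⟨le_convexComb t0 t1 le_rfl i, convexComb_le_right t0 t1 i le_rfl⟩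
  · exact Or.inr ⟨le_convexComb t0 t1 i le_rfl, convexComb_le_right t0 t1 le_rfl i⟩

theorem fst_eq_of_mem_segment {p z k : Plane} (h1 : p.1 = z.1) (h : k ∈ segment ℝ p z) :
    k.1 = z.1 ∧ ((p.2 ≤ k.2 ∧ k.2 ≤ z.2) ∨ (z.2 ≤ k.2 ∧ k.2 ≤ p.2)) := by
  refine snd_eq_of_mem_segment (p := p.swap) (z := z.swap) (k := k.swap) h1 ?_
  rw [segment_swap]
  exact ⟨k, h, rfl⟩

namespace Staircase

variable {W : Set Plane} {a c lo hi en : Plane} {S : Set (Set Plane)}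

/-- The case of ends outside the region: a path from `p` along a horizontal and then along a
vertical segment to `q` meets one of the segments, provided that the other one-corner path meets the
interior. -/
theorem path_meets_of_not_mem (h : Staircase W a c lo hi en) (hS : Linked W a c S) {p q : Plane}
    (hp : p ∉ W) (hq : q ∉ W)
    (hH : (segment ℝ p (q.1, p.2) ∩ interior W).Nonempty ∨
      (segment ℝ (q.1, p.2) q ∩ interior W).Nonempty)
    (hV : (segment ℝ q (p.1, q.2) ∩ interior W).Nonempty ∨
      (segment ℝ (p.1, q.2) p ∩ interior W).Nonempty)
    (hno : ∀ s ∈ S, ∀ w ∈ s, w ∉ segment ℝ p (q.1, p.2) ∧ w ∉ segment ℝ (q.1, p.2) q) :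
    False := by
  set z : Plane := (q.1, p.2) with hz
  have hSW : ∀ s ∈ S, ∀ w ∈ s, w ∈ W := fun s hs w hw => hS.subset s hs hw
  -- if the corner is outside, a whole horizontal or vertical chord is crossed
  by_cases hzW : z ∈ W
  swap
  · rcases hH with ⟨w, hw, hwi⟩ | ⟨w, hw, hwi⟩
    · have hwW := interior_subset hwi
      obtain ⟨e, hb⟩ := snd_eq_of_mem_segment (p := p) (z := z) rfl hw
      obtain ⟨s, hs, k, hk, ek⟩ := hS.cover_snd w.2 (h.ge w hwW).2 (h.le w hwW).2
      have hkW := hSW s hs k hk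
      refine (hno s hs k hk).1 (mem_segment_of_snd_eq rfl (ek.trans e) ?_)
      have hk2 : k.2 = p.2 := ek.trans e
      have hw2 : w.2 = p.2 := e
      by_contra hcon
      rw [not_or, not_and_or, not_and_or, not_le, not_le, not_le, not_le] at hcon
      have hpn : ∀ l r : Plane, l ∈ W → r ∈ W → l.2 = p.2 → r.2 = p.2 → l.1 ≤ p.1 → p.1 ≤ r.1 →
          False := fun l r hl hr e1 e2 i j =>
        hp (h.mem_of hl hr hl i e1.ge j e2.le i e1.le)
      have hzn : ∀ l r : Plane, l ∈ W → r ∈ W → l.2 = p.2 → r.2 = p.2 → l.1 ≤ z.1 → z.1 ≤ r.1 →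
          False := fun l r hl hr e1 e2 i j =>
        hzW (h.mem_of hl hr hl i e1.ge j e2.le i e1.le)
      rcases hb with ⟨b1, b2⟩ | ⟨b1, b2⟩
      · rcases hcon.1 with i | i
        · exact hpn k w hkW hwW hk2 hw2 i.le b1
        · exact hzn w k hwW hkW hw2 hk2 b2 i.le
      · rcases hcon.2 with i | i
        · exact hzn k w hkW hwW hk2 hw2 i.le b1
        · exact hpn w k hwW hkW hw2 hk2 b2 i.le
    · have hwW := interior_subset hwi
      obtain ⟨e, hb⟩ := fst_eq_of_mem_segment (p := z) (z := q) rfl hw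
      obtain ⟨s, hs, k, hk, ek⟩ := hS.cover_fst w.1 (h.ge w hwW).1 (h.le w hwW).1
      have hkW := hSW s hs k hk
      refine (hno s hs k hk).2 (mem_segment_of_fst_eq rfl (ek.trans e) ?_)
      have hk2 : k.1 = q.1 := ek.trans e
      have hw2 : w.1 = q.1 := e
      by_contra hcon
      rw [not_or, not_and_or, not_and_or, not_le, not_le, not_le, not_le] at hcon
      have hpn : ∀ l r : Plane, l ∈ W → r ∈ W → l.1 = q.1 → r.1 = q.1 → l.2 ≤ q.2 → q.2 ≤ r.2 →
          False := fun l r hl hr e1 e2 i j => hq (h.mem_of_fst_eq hl hr e1 e2 i j)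
      have hzn : ∀ l r : Plane, l ∈ W → r ∈ W → l.1 = q.1 → r.1 = q.1 → l.2 ≤ z.2 → z.2 ≤ r.2 →
          False := fun l r hl hr e1 e2 i j => hzW (h.mem_of_fst_eq hl hr e1 e2 i j)
      rcases hb with ⟨b1, b2⟩ | ⟨b1, b2⟩
      · rcases hcon.1 with i | i
        · exact hzn k w hkW hwW hk2 hw2 i.le b1
        · exact hpn w k hwW hkW hw2 hk2 b2 i.le
      · rcases hcon.2 with i | i
        · exact hpn k w hkW hwW hk2 hw2 i.le b1
        · exact hzn w k hwW hkW hw2 hk2 b2 i.le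
  have hzge := h.ge z hzW
  have hzle := h.le z hzW
  have z2 : p.2 = z.2 := rfl
  have z1 : q.1 = z.1 := rfl
  have hac := h.ge c h.corner
  obtain ⟨U, hUS, hUc, ⟨A, hAU, hA⟩, ⟨B, hBU, hB⟩, hin⟩ := hS.lowerLeft
  have hUW : ∀ w ∈ U, w ∈ W := fun w hw => by
    obtain ⟨s, hs, hws⟩ := hUS hw
    exact hSW s hs w hws
  have hAW := hUW A hAU
  have hBW := hUW B hBU
  have hSc : ∀ s ∈ S, IsPreconnected s := fun s hs => by
    obtain ⟨p, q, -, rfl⟩ := hS.segments s hs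
    exact isPreconnected_segment p q
  obtain ⟨sr, hsr, r, hr, hr1⟩ := hS.cover_fst c.1 hac.1 le_rfl
  obtain ⟨st, hst, t, ht, ht2⟩ := hS.cover_snd c.2 hac.2 le_rfl
  have hrW := hSW sr hsr r hr
  have htW := hSW st hst t ht
  have hUS' : ∀ {P : Plane → Prop}, (∀ s ∈ S, ∀ w ∈ s, P w) → ∀ w ∈ U, P w := fun hP w hw => by
    obtain ⟨s, hs, hws⟩ := hUS hw
    exact hP s hs w hws
  have hp_ne : p.1 ≠ z.1 := fun e => hp (by rwa [show p = z from Prod.ext e z2])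
  have hq_ne : q.2 ≠ z.2 := fun e => hq (by rwa [show q = z from Prod.ext z1 e])
  -- the segments do not meet the rays from the corner through the two ends
  have hrayL : p.1 < z.1 → ∀ s ∈ S, ∀ w ∈ s, w.2 = z.2 → z.1 < w.1 := by
    intro hlt s hs w hw e
    by_contra hh
    rw [not_lt] at hh
    rcases le_total p.1 w.1 with i | i
    · exact (hno s hs w hw).1 (mem_segment_of_snd_eq rfl e (Or.inl ⟨i, hh⟩))
    · have hwW := hSW s hs w hw
      exact hp (h.mem_of hwW hzW hwW i e.ge hlt.le le_rfl i e.le)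
  have hrayR : z.1 < p.1 → ∀ s ∈ S, ∀ w ∈ s, w.2 = z.2 → w.1 < z.1 := by
    intro hlt s hs w hw e
    by_contra hh
    rw [not_lt] at hh
    rcases le_total w.1 p.1 with i | i
    · exact (hno s hs w hw).1 (mem_segment_of_snd_eq rfl e (Or.inr ⟨hh, i⟩))
    · have hwW := hSW s hs w hw
      exact hp (h.mem_of hzW hwW hzW hlt.le le_rfl i e.le hlt.le le_rfl)
  have hrayD : q.2 < z.2 → ∀ s ∈ S, ∀ w ∈ s, w.1 = z.1 → z.2 < w.2 := by
    intro hlt s hs w hw e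
    by_contra hh
    rw [not_lt] at hh
    rcases le_total q.2 w.2 with i | i
    · exact (hno s hs w hw).2 (mem_segment_of_fst_eq rfl e (Or.inr ⟨i, hh⟩))
    · exact hq (h.mem_of_fst_eq (hSW s hs w hw) hzW e rfl i hlt.le)
  have hrayU : z.2 < q.2 → ∀ s ∈ S, ∀ w ∈ s, w.1 = z.1 → w.2 < z.2 := by
    intro hlt s hs w hw e
    by_contra hh
    rw [not_lt] at hh
    rcases le_total w.2 q.2 with i | i
    · exact (hno s hs w hw).2 (mem_segment_of_fst_eq rfl e (Or.inl ⟨hh, i⟩))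
    · exact hq (h.mem_of_fst_eq hzW (hSW s hs w hw) rfl e hlt.le i)
  -- the points of the other path
  have hV' : ∃ w ∈ interior W, (w.2 = q.2 ∧ ((q.1 ≤ w.1 ∧ w.1 ≤ p.1) ∨ (p.1 ≤ w.1 ∧ w.1 ≤ q.1))) ∨
      (w.1 = p.1 ∧ ((q.2 ≤ w.2 ∧ w.2 ≤ p.2) ∨ (p.2 ≤ w.2 ∧ w.2 ≤ q.2))) := by
    rcases hV with ⟨w, hw, hwi⟩ | ⟨w, hw, hwi⟩
    · exact ⟨w, hwi, Or.inl (snd_eq_of_mem_segment (p := q) (z := (p.1, q.2)) rfl hw)⟩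
    · exact ⟨w, hwi, Or.inr (fst_eq_of_mem_segment (p := (p.1, q.2)) (z := p) rfl hw)⟩
  obtain ⟨w, hwi, hw⟩ := hV'
  have hwW := interior_subset hwi
  have hwge := h.ge w hwW
  have hwle := h.le w hwW
  have o1 : ∀ k : ℝ, IsOpen {x : Plane | x.1 < k} := fun k => isOpen_lt continuous_fst
    continuous_const
  have o2 : ∀ k : ℝ, IsOpen {x : Plane | k < x.1} := fun k => isOpen_lt continuous_const
    continuous_fst
  have o3 : ∀ k : ℝ, IsOpen {x : Plane | x.2 < k} := fun k => isOpen_lt continuous_snd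
    continuous_const
  have o4 : ∀ k : ℝ, IsOpen {x : Plane | k < x.2} := fun k => isOpen_lt continuous_const
    continuous_snd
  have c1 : ∀ k : ℝ, IsClosed {x : Plane | x.1 ≤ k} := fun k => isClosed_le continuous_fst
    continuous_const
  have c2 : ∀ k : ℝ, IsClosed {x : Plane | k ≤ x.1} := fun k => isClosed_le continuous_const
    continuous_fst
  have c3 : ∀ k : ℝ, IsClosed {x : Plane | x.2 ≤ k} := fun k => isClosed_le continuous_snd
    continuous_const
  have c4 : ∀ k : ℝ, IsClosed {x : Plane | k ≤ x.2} := fun k => isClosed_le continuous_const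
    continuous_snd
  rcases lt_or_gt_of_ne hp_ne with hpz | hpz <;> rcases lt_or_gt_of_ne hq_ne with hqz | hqz
  · -- `p` is to the left and `q` below
    have hd : ∀ s ∈ S, ∀ w ∈ s, (w.1 ≤ z.1 ∧ w.2 ≤ z.2) → w.1 < z.1 ∧ w.2 < z.2 := by
      intro s hs w hw ⟨i, j⟩
      refine ⟨lt_of_le_of_ne i fun e => ?_, lt_of_le_of_ne j fun e => ?_⟩
      · exact absurd (hrayD hqz s hs w hw e) (not_lt.2 j)
      · exact absurd (hrayL hpz s hs w hw e) (not_lt.2 i)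
    have hdi : ∀ T : Set Plane, IsPreconnected T → (∀ w ∈ T, (w.1 ≤ z.1 ∧ w.2 ≤ z.2) →
        w.1 < z.1 ∧ w.2 < z.2) → (∀ w ∈ T, w.1 < z.1 ∧ w.2 < z.2) ∨
        ∀ w ∈ T, ¬ (w.1 ≤ z.1 ∧ w.2 ≤ z.2) := fun T hT hd =>
      preconnected_dichotomy hT ((o1 z.1).inter (o3 z.2)) ((c1 z.1).inter (c3 z.2))
        (fun w hw => ⟨hw.1.le, hw.2.le⟩) hd
    rcases hdi U hUc (hUS' hd) with hU | hU
    · have := hin z (fun s hs => hdi s (hSc s hs) (hd s hs)) hU st hst t ht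
      linarith [this.2]
    · have hA2 : z.2 < A.2 := by
        by_contra hh
        exact hU A hAU ⟨by linarith, not_lt.1 hh⟩
      have hB1 : z.1 < B.1 := by
        by_contra hh
        exact hU B hBU ⟨not_lt.1 hh, by linarith⟩
      rcases hw with ⟨e, i⟩ | ⟨e, i⟩
      · refine hq (h.mem_of hzW hBW hwW z1.ge hqz.le (by linarith) (by linarith) ?_ e.le)
        rcases i with i | i <;> linarith
      · refine hp (h.mem_of hAW hzW hwW (by linarith) (by linarith) hpz.le z2.ge e.le ?_)
        rcases i with i | i <;> linarith
  · -- `p` is to the left and `q` above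
    have hd : ∀ s ∈ S, ∀ w ∈ s, (w.1 ≤ z.1 ∧ z.2 ≤ w.2) → w.1 < z.1 ∧ z.2 < w.2 := by
      intro s hs w hw ⟨i, j⟩
      refine ⟨lt_of_le_of_ne i fun e => ?_, lt_of_le_of_ne j fun e => ?_⟩
      · exact absurd (hrayU hqz s hs w hw e) (not_lt.2 j)
      · exact absurd (hrayL hpz s hs w hw e.symm) (not_lt.2 i)
    have hU := (preconnected_dichotomy hUc ((o1 z.1).inter (o4 z.2)) ((c1 z.1).inter (c4 z.2))
      (fun w hw => ⟨(show w.1 < z.1 from hw.1).le, (show z.2 < w.2 from hw.2).le⟩)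
      (hUS' hd)).resolve_left fun hh => by
        have : z.2 < B.2 := (hh B hBU).2
        linarith
    have hA2 : A.2 < z.2 := by
      by_contra hh
      exact hU A hAU ⟨show A.1 ≤ z.1 by linarith, not_lt.1 hh⟩
    rcases hw with ⟨e, i⟩ | ⟨e, i⟩
    · refine hq (h.mem_of hwW hzW hzW ?_ e.ge z1.le hqz.le z1.ge hqz.le)
      rcases i with i | i <;> linarith
    · refine hp (h.mem_of hwW hzW hAW e.le ?_ hpz.le z2.ge (by linarith) (by linarith))
      rcases i with i | i <;> linarith
  · -- `p` is to the right and `q` below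
    have hd : ∀ s ∈ S, ∀ w ∈ s, (z.1 ≤ w.1 ∧ w.2 ≤ z.2) → z.1 < w.1 ∧ w.2 < z.2 := by
      intro s hs w hw ⟨i, j⟩
      refine ⟨lt_of_le_of_ne i fun e => ?_, lt_of_le_of_ne j fun e => ?_⟩
      · exact absurd (hrayD hqz s hs w hw e.symm) (not_lt.2 j)
      · exact absurd (hrayR hpz s hs w hw e) (not_lt.2 i)
    have hU := (preconnected_dichotomy hUc ((o2 z.1).inter (o3 z.2)) ((c2 z.1).inter (c3 z.2))
      (fun w hw => ⟨(show z.1 < w.1 from hw.1).le, (show w.2 < z.2 from hw.2).le⟩)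
      (hUS' hd)).resolve_left fun hh => by
        have : z.1 < A.1 := (hh A hAU).1
        linarith
    have hB1 : B.1 < z.1 := by
      by_contra hh
      exact hU B hBU ⟨not_lt.1 hh, show B.2 ≤ z.2 by linarith⟩
    rcases hw with ⟨e, i⟩ | ⟨e, i⟩
    · refine hq (h.mem_of hzW hwW hBW z1.ge hqz.le ?_ e.le (by linarith) (by linarith))
      rcases i with i | i <;> linarith
    · refine hp (h.mem_of hzW hwW hzW hpz.le z2.le e.ge ?_ hpz.le z2.ge)
      rcases i with i | i <;> linarith
  · -- `p` is to the right and `q` above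
    have hd : ∀ s ∈ S, ∀ w ∈ s, (z.1 ≤ w.1 ∧ z.2 ≤ w.2) → z.1 < w.1 ∧ z.2 < w.2 := by
      intro s hs w hw ⟨i, j⟩
      refine ⟨lt_of_le_of_ne i fun e => ?_, lt_of_le_of_ne j fun e => ?_⟩
      · exact absurd (hrayU hqz s hs w hw e.symm) (not_lt.2 j)
      · exact absurd (hrayR hpz s hs w hw e.symm) (not_lt.2 i)
    have hall := hS.upperRight z hzW fun s hs =>
      preconnected_dichotomy (hSc s hs) ((o2 z.1).inter (o4 z.2)) ((c2 z.1).inter (c4 z.2))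
        (fun w hw => ⟨hw.1.le, hw.2.le⟩) (hd s hs)
    have hr2 : r.2 < z.2 := by
      by_contra hh
      exact hall sr hsr r hr ⟨by linarith, not_lt.1 hh⟩
    have ht1 : t.1 < z.1 := by
      by_contra hh
      exact hall st hst t ht ⟨not_lt.1 hh, by linarith⟩
    have hpc : c.1 < p.1 := by
      by_contra hh
      exact hp (h.mem_of hzW hrW hzW hpz.le z2.le (by linarith) (by linarith) hpz.le z2.ge)
    have hqc : c.2 < q.2 := by
      by_contra hh
      exact hq (h.mem_of htW hzW hzW (by linarith) (by linarith) z1.le hqz.le z1.ge hqz.le)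
    rcases hw with ⟨e, i⟩ | ⟨e, i⟩ <;> linarith

/-- Points outside the interior are limits of points outside the region, and a path that misses the
compact union of the segments still does so after a small motion of its ends. -/
theorem path_meets (h : Staircase W a c lo hi en) (hS : Linked W a c S) {p q : Plane}
    (hp : p ∉ interior W) (hq : q ∉ interior W)
    (hH : (segment ℝ p (q.1, p.2) ∩ interior W).Nonempty ∨
      (segment ℝ (q.1, p.2) q ∩ interior W).Nonempty)
    (hV : (segment ℝ q (p.1, q.2) ∩ interior W).Nonempty ∨
      (segment ℝ (p.1, q.2) p ∩ interior W).Nonempty) :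
    (segment ℝ p (q.1, p.2) ∩ ⋃₀ S).Nonempty ∨ (segment ℝ (q.1, p.2) q ∩ ⋃₀ S).Nonempty := by
  by_contra hcon
  -- the ends can be moved a little, so that they are outside
  have hUc := hS.isCompact.isClosed
  set A : Set (Plane × Plane) := {x | (segment ℝ x.1 (x.2.1, x.1.2) ∩ ⋃₀ S).Nonempty} ∪
    {x | (segment ℝ (x.2.1, x.1.2) x.2 ∩ ⋃₀ S).Nonempty} with hA
  have hAc : IsClosed A := (isClosed_segment_meets hUc (by fun_prop) (by fun_prop)).union
    (isClosed_segment_meets hUc (by fun_prop) (by fun_prop))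
  set B : Set (Plane × Plane) := {x | (segment ℝ x.1 (x.2.1, x.1.2) ∩ interior W).Nonempty} ∪
    {x | (segment ℝ (x.2.1, x.1.2) x.2 ∩ interior W).Nonempty} with hB
  have hBo : IsOpen B := (isOpen_segment_meets isOpen_interior (by fun_prop) (by fun_prop)).union
    (isOpen_segment_meets isOpen_interior (by fun_prop) (by fun_prop))
  set C : Set (Plane × Plane) := {x | (segment ℝ x.2 (x.1.1, x.2.2) ∩ interior W).Nonempty} ∪
    {x | (segment ℝ (x.1.1, x.2.2) x.1 ∩ interior W).Nonempty} with hC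
  have hCo : IsOpen C := (isOpen_segment_meets isOpen_interior (by fun_prop) (by fun_prop)).union
    (isOpen_segment_meets isOpen_interior (by fun_prop) (by fun_prop))
  have hO : IsOpen (Aᶜ ∩ (B ∩ C)) := hAc.isOpen_compl.inter (hBo.inter hCo)
  have hcl : (p, q) ∈ closure (Wᶜ ×ˢ Wᶜ) := by
    rw [closure_prod_eq, closure_compl]
    exact ⟨hp, hq⟩
  obtain ⟨⟨p', q'⟩, ⟨hA', hB', hC'⟩, hp', hq'⟩ :=
    mem_closure_iff.1 hcl _ hO ⟨hcon, hH, hV⟩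
  refine h.path_meets_of_not_mem hS hp' hq' hB' hC' fun s hs w hw => ⟨fun h1 => hA' ?_,
    fun h1 => hA' ?_⟩
  · exact Or.inl ⟨w, h1, s, hs, hw⟩
  · exact Or.inr ⟨w, h1, s, hs, hw⟩

/-- A linked set of segments that spans the bounding box is a skeleton. -/
theorem isSkeletonOf_of_linked (h : Staircase W a c lo hi en) (hS : Linked W a c S) :
    IsSkeletonOf W S := by
  refine ⟨fun s hs => ⟨hS.segments s hs, hS.subset s hs⟩, fun p q hp hq hall P hP => ?_⟩
  have h1 := hall _ (Or.inr rfl)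
  have h2 := hall _ (Or.inl rfl)
  rw [Set.union_inter_distrib_right, Set.union_nonempty] at h1 h2
  have h2' : (segment ℝ q (p.1, q.2) ∩ interior W).Nonempty ∨
      (segment ℝ (p.1, q.2) p ∩ interior W).Nonempty := by
    rw [segment_symm ℝ q, segment_symm ℝ _ p]; exact h2.symm
  have conv : ∀ {T : Set Plane}, (T ∩ ⋃₀ S).Nonempty → ∃ s ∈ S, (T ∩ s).Nonempty := by
    rintro T ⟨w, hw, s, hs, hws⟩
    exact ⟨s, hs, w, hw, hws⟩
  have key : (P ∩ ⋃₀ S).Nonempty := by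
    rcases hP with rfl | rfl
    · rw [Set.union_inter_distrib_right, Set.union_nonempty, segment_symm ℝ p,
        segment_symm ℝ _ q]
      refine (h.path_meets hS hq hp h2' ?_).symm
      exact h1
    · rw [Set.union_inter_distrib_right, Set.union_nonempty]
      exact h.path_meets hS hp hq h1 h2'
  exact conv key

end Staircase

/-! ### Lower bounds for the size of a skeleton -/

theorem IsOneCornerPath.swap {p q : Plane} {P : Set Plane} (h : IsOneCornerPath p q P) :
    IsOneCornerPath p.swap q.swap (Prod.swap '' P) := by
  rcases h with rfl | rfl
  · right
    rw [Set.image_union, ← segment_swap, ← segment_swap]; rfl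
  · left
    rw [Set.image_union, ← segment_swap, ← segment_swap]; rfl

theorem IsSkeletonOf.swap {W : Set Plane} {S : Set (Set Plane)} (h : IsSkeletonOf W S) :
    IsSkeletonOf (Prod.swap '' W) (Set.image Prod.swap '' S) := by
  refine ⟨?_, fun p q hp hq hall P hP => ?_⟩
  · rintro _ ⟨s, hs, rfl⟩
    obtain ⟨⟨x, y, hxy, rfl⟩, hsW⟩ := h.1 s hs
    exact ⟨⟨x.swap, y.swap, fun e => hxy (Prod.swap_injective e), (segment_swap x y).symm⟩,
      Set.image_mono hsW⟩
  · rw [interior_swap_image, swap_image_mem] at hp hq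
    obtain ⟨s, hs, z, hz, hzs⟩ := h.2 p.swap q.swap hp hq (fun Q hQ => by
      obtain ⟨z, hz, hzi⟩ := hall _ (by simpa using hQ.swap)
      rw [swap_image_mem] at hz
      rw [interior_swap_image, swap_image_mem] at hzi
      exact ⟨z.swap, hz, hzi⟩) _ hP.swap
    rw [swap_image_mem] at hz
    exact ⟨_, ⟨s, hs, rfl⟩, z.swap, hz, z, hzs, rfl⟩

/-- The segments of `S` that meet the box with upper right corner `K`. -/
def meeting (S : Set (Set Plane)) (K : Plane) : Set (Set Plane) :=
  {s ∈ S | ∃ w ∈ s, w.1 ≤ K.1 ∧ w.2 ≤ K.2}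

/-- The segments of `S` inside the box with upper right corner `K`. -/
def inside (S : Set (Set Plane)) (K : Plane) : Set (Set Plane) :=
  {s ∈ S | ∀ w ∈ s, w.1 ≤ K.1 ∧ w.2 ≤ K.2}

theorem IsSkeletonOf.isCompact {W : Set Plane} {S T : Set (Set Plane)} (h : IsSkeletonOf W S)
    (hfin : S.Finite) (hT : T ⊆ S) : IsCompact (⋃₀ T) := by
  refine (hfin.subset hT).isCompact_sUnion fun s hs => ?_
  obtain ⟨⟨p, q, -, rfl⟩, -⟩ := h.1 s (hT hs)
  rw [segment_eq_image]
  exact isCompact_Icc.image (by fun_prop)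

namespace Staircase

variable {W : Set Plane} {a c lo hi en K : Plane} {S : Set (Set Plane)}

/-- A skeleton meets every vertical line that meets the interior, since the ends of the chord can be
joined outside only by this line. -/
theorem exists_fst_eq (h : Staircase W a c lo hi en) (hS : IsSkeletonOf W S) {z : Plane}
    (hz : z ∈ interior W) : ∃ w ∈ ⋃₀ S, w.1 = z.1 := by
  have hzlt := h.interior_lt hz
  have key : ∀ P, IsOneCornerPath ((z.1, a.2) : Plane) (z.1, c.2) P →
      z ∈ P ∧ ∀ w ∈ P, w.1 = z.1 := by
    have e1 : z ∈ segment ℝ ((z.1, a.2) : Plane) (z.1, c.2) :=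
      mem_segment_of_fst_eq rfl rfl (Or.inl ⟨hzlt.2.2.1.le, hzlt.2.2.2.le⟩)
    rintro P (rfl | rfl)
    · refine ⟨Or.inl e1, ?_⟩
      rintro w (hw | hw) <;> exact (fst_eq_of_mem_segment (by rfl) hw).1
    · refine ⟨Or.inr e1, ?_⟩
      rintro w (hw | hw) <;> exact (fst_eq_of_mem_segment (by rfl) hw).1
  obtain ⟨s, hs, w, hw, hws⟩ := hS.2 (z.1, a.2) (z.1, c.2)
    (fun hi => lt_irrefl _ (h.interior_lt hi).2.2.1)
    (fun hi => lt_irrefl _ (h.interior_lt hi).2.2.2)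
    (fun P hP => ⟨z, (key P hP).1, hz⟩) _ (Or.inl rfl)
  exact ⟨w, ⟨s, hs, hws⟩, (key _ (Or.inl rfl)).2 w hw⟩

theorem left_interior (h : Staircase W a c lo hi en) {z : Plane} (h1 : a.1 < z.1) (h2 : z.1 < hi.1)
    (h3 : lo.2 < z.2) (h4 : z.2 < hi.2) : z ∈ interior W :=
  h.mem_interior_of h.left_hi h.bot_hi h.left_lo h1 h4 h2 (lt_of_le_of_lt h.a_le_lo.2 h3) h1 h3

theorem a_lt_hi (h : Staircase W a c lo hi en) : a.1 < hi.1 ∧ a.2 < hi.2 :=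
  ⟨lt_of_le_of_lt h.a_le_lo.1 h.bot_lt, lt_of_le_of_lt h.a_le_lo.2 h.left_lt⟩

/-- A skeleton touches the left edge. -/
theorem exists_left_touch (h : Staircase W a c lo hi en) (hS : IsSkeletonOf W S) (hfin : S.Finite) :
    ∃ s ∈ S, ∃ w ∈ s, w.1 = a.1 := by
  have hU := ((hS.isCompact hfin subset_rfl).image continuous_fst).isClosed
  have hsub : Set.Ioo a.1 hi.1 ⊆ Prod.fst '' ⋃₀ S := fun x hx => by
    have := h.left_lt
    obtain ⟨w, hw, e⟩ := h.exists_fst_eq hS (h.left_interior (z := (x, (lo.2 + hi.2) / 2)) hx.1 hx.2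
      (by simp only; linarith) (by simp only; linarith))
    exact ⟨w, hw, e⟩
  have hcl := closure_minimal hsub hU
  rw [closure_Ioo h.a_lt_hi.1.ne] at hcl
  obtain ⟨w, ⟨s, hs, hw⟩, e⟩ := hcl ⟨le_rfl, h.a_lt_hi.1.le⟩
  exact ⟨s, hs, w, hw, e⟩

/-- A skeleton touches the right edge. -/
theorem exists_right_touch (h : Staircase W a c lo hi en) (hS : IsSkeletonOf W S)
    (hfin : S.Finite) : ∃ s ∈ S, ∃ w ∈ s, w.1 = c.1 := by
  have hU := ((hS.isCompact hfin subset_rfl).image continuous_fst).isClosed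
  have hlt : max en.1 hi.1 < c.1 := max_lt h.top_lt h.hi_lt_fst
  have hsub : Set.Ioo (max en.1 hi.1) c.1 ⊆ Prod.fst '' ⋃₀ S := fun x hx => by
    obtain ⟨h1, h2⟩ := max_lt_iff.1 hx.1
    have hr := h.right_lt
    have hge := (h.ge _ h.right).2
    simp only at hge
    obtain ⟨w, hw, e⟩ := h.exists_fst_eq hS (z := (x, (en.2 + c.2) / 2))
      (h.mem_interior_of h.top h.right h.bot_hi h1 (by simp only; linarith) hx.2
        (by simp only; linarith) h2 (by simp only; linarith))
    exact ⟨w, hw, e⟩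
  have hcl := closure_minimal hsub hU
  rw [closure_Ioo hlt.ne] at hcl
  obtain ⟨w, ⟨s, hs, hw⟩, e⟩ := hcl ⟨hlt.le, le_rfl⟩
  exact ⟨s, hs, w, hw, e⟩

theorem exists_bottom_touch (h : Staircase W a c lo hi en) (hS : IsSkeletonOf W S)
    (hfin : S.Finite) : ∃ s ∈ S, ∃ w ∈ s, w.2 = a.2 := by
  obtain ⟨_, ⟨s, hs, rfl⟩, _, ⟨w, hw, rfl⟩, e⟩ :=
    h.swap.exists_left_touch hS.swap (hfin.image _)
  exact ⟨s, hs, w, hw, e⟩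

/-- As long as the covered box is not everything, some segment of a skeleton leaves it: otherwise
the boundary of a slightly larger box contains a path that the skeleton does not meet. -/
theorem exists_leaving (h : Staircase W a c lo hi en) (hS : IsSkeletonOf W S) (hfin : S.Finite)
    (hK : IsCovered W hi K) (hc : K ≠ c) :
    ∃ s ∈ S, (∃ w ∈ s, w.1 ≤ K.1 ∧ w.2 ≤ K.2) ∧ ∃ w ∈ s, ¬ (w.1 ≤ K.1 ∧ w.2 ≤ K.2) := by
  by_contra! hcon
  obtain ⟨z, hz, hzK⟩ := h.frontierSet_nonempty hK hc
  have hza := h.interior_lt hz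
  have hopen : ∃ η > 0, ∀ ε, 0 < ε → ε < η → (z.1 + ε, z.2) ∈ interior W ∧
      (z.1, z.2 + ε) ∈ interior W := by
    obtain ⟨r, r0, hr⟩ := Metric.isOpen_iff.1 isOpen_interior z hz
    refine ⟨r, r0, fun ε e0 e1 => ⟨hr ?_, hr ?_⟩⟩ <;>
    · rw [Metric.mem_ball, Prod.dist_eq, max_lt_iff]
      simp [abs_of_pos e0, e1, r0]
  obtain ⟨η, η0, hη⟩ := hopen
  -- the segments outside the box keep a distance from it
  have hout : ∃ ρ > 0, ∀ w ∈ ⋃₀ (S \ meeting S K), w.1 < K.1 + ρ → w.2 < K.2 + ρ → False := by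
    have hcomp := hS.isCompact hfin (T := S \ meeting S K) Set.sdiff_subset
    rcases (⋃₀ (S \ meeting S K)).eq_empty_or_nonempty with he | hne
    · exact ⟨1, one_pos, fun w hw => by rw [he] at hw; exact hw.elim⟩
    · obtain ⟨w, hw, hmin⟩ := hcomp.exists_isMinOn hne
        (f := fun w : Plane => max (w.1 - K.1) (w.2 - K.2)) (by fun_prop)
      have hpos : 0 < max (w.1 - K.1) (w.2 - K.2) := by
        obtain ⟨s, hs, hws⟩ := hw
        by_contra! hle
        obtain ⟨h1, h2⟩ := max_le_iff.1 hle
        exact hs.2 ⟨hs.1, w, hws, by linarith, by linarith⟩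
      refine ⟨_, hpos, fun u hu h1 h2 => ?_⟩
      have := hmin hu
      exact absurd (show max (w.1 - K.1) (w.2 - K.2) ≤ max (u.1 - K.1) (u.2 - K.2) from this)
        (not_le.2 (max_lt (by linarith) (by linarith)))
  obtain ⟨ρ, ρ0, hρ⟩ := hout
  set ε := min η ρ / 2 with hε
  have hε0 : 0 < ε := by have := lt_min η0 ρ0; linarith
  have hεη : ε < η := by have := min_le_left η ρ; linarith
  have hερ : ε < ρ := by have := min_le_right η ρ; linarith
  -- a starting point outside the region, near its left edge
  have hp : ∃ δ > 0, δ < z.1 - a.1 ∧ δ < hi.1 - a.1 ∧ ((a.1 + δ, K.2 + ε) : Plane) ∉ W := by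
    by_contra! hall
    have hm : ((a.1, K.2 + ε) : Plane) ∈ W := by
      have hlt : 0 < min (z.1 - a.1) (hi.1 - a.1) :=
        lt_min (by linarith [hza.1]) (by linarith [h.a_lt_hi.1])
      refine mem_of_direction h.isClosed (z := (a.1, K.2 + ε)) 1 0 hlt fun δ d0 d1 => ?_
      have := hall δ d0 (d1.trans_le (min_le_left _ _)) (d1.trans_le (min_le_right _ _))
      simpa using this
    have := (h.left _ hm rfl).2
    have := hK.snd_le
    simp only at *
    linarith
  obtain ⟨δ, δ0, δ1, δ2, hp⟩ := hp
  set p : Plane := (a.1 + δ, K.2 + ε) with hpdef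
  set q : Plane := (K.1 + ε, a.2) with hqdef
  have hzK1 : z.1 ≤ K.1 ∧ z.2 ≤ K.2 := by
    rcases hzK with ⟨e, i⟩ | ⟨e, i⟩
    · exact ⟨e.le, i⟩
    · exact ⟨i, e.le⟩
  have hq1 : q.1 = K.1 + ε := rfl
  have hq2 : q.2 = a.2 := rfl
  have hp1 : p.1 = a.1 + δ := rfl
  have hp2 : p.2 = K.2 + ε := rfl
  have hsk := hS.2 p q (fun hi => hp (interior_subset hi))
    (fun hi => lt_irrefl _ (h.interior_lt hi).2.2.1) ?_ _ (Or.inr rfl)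
  · obtain ⟨s, hs, w, hw, hws⟩ := hsk
    have hw' : w.1 ≤ K.1 + ε ∧ w.2 ≤ K.2 + ε ∧ (K.1 < w.1 ∨ K.2 < w.2) := by
      rcases hw with hw | hw
      · obtain ⟨e, i⟩ := snd_eq_of_mem_segment (by rfl) hw
        simp only [hq1, hp1, hp2] at e i
        refine ⟨?_, e.le, Or.inr (by linarith)⟩
        rcases i with i | i <;> linarith
      · obtain ⟨e, i⟩ := fst_eq_of_mem_segment (by rfl) hw
        simp only [hq1, hq2, hp2] at e i
        have := hzK1.2
        refine ⟨e.le, ?_, Or.inl (by linarith)⟩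
        rcases i with i | i <;> linarith
    by_cases hm : s ∈ meeting S K
    · obtain ⟨k1, k2⟩ := hcon s hs hm.2 w hws
      rcases hw'.2.2 with k | k <;> linarith
    · exact hρ w ⟨s, ⟨hs, hm⟩, hws⟩ (by linarith) (by linarith)
  · rintro P (rfl | rfl)
    · have hl := h.left_lt
      have ha := h.a_le_lo.2
      have hK2 := hK.snd_le
      refine ⟨(a.1 + δ, (lo.2 + hi.2) / 2), Or.inl (mem_segment_of_fst_eq rfl rfl (Or.inr ?_)),
        h.left_interior ?_ ?_ ?_ ?_⟩ <;> simp only [hq2, hp2] <;> try linarith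
      constructor <;> linarith
    · rcases hzK with ⟨e, i⟩ | ⟨e, i⟩
      · refine ⟨(z.1 + ε, z.2), Or.inr (mem_segment_of_fst_eq rfl ?_ (Or.inr ?_)), (hη ε hε0 hεη).1⟩
        · simp only [hq1, e]
        · simp only [hq2, hp2]
          constructor <;> linarith
      · refine ⟨(z.1, z.2 + ε), Or.inl (mem_segment_of_snd_eq rfl ?_ (Or.inl ?_)), (hη ε hε0 hεη).2⟩
        · simp only [hp2, e]
        · simp only [hq1, hp1]
          constructor <;> linarith

/-- Not all segments of a skeleton that meet the covered box are inside it. -/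
theorem encard_inside_add_one_le (h : Staircase W a c lo hi en) (hS : IsSkeletonOf W S)
    (hfin : S.Finite) (hK : IsCovered W hi K) (hc : K ≠ c) :
    (inside S K).encard + 1 ≤ (meeting S K).encard := by
  obtain ⟨s, hs, hm, w, hw, hwK⟩ := h.exists_leaving hS hfin hK hc
  have hns : s ∉ inside S K := fun hi => hwK (hi.2 w hw)
  rw [← Set.encard_insert_of_notMem hns]
  refine Set.encard_le_encard (Set.insert_subset ⟨hs, hm⟩ fun t ht => ⟨ht.1, ?_⟩)
  obtain ⟨⟨x, y, -, rfl⟩, -⟩ := hS.1 t ht.1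
  exact ⟨x, left_mem_segment ℝ x y, ht.2 x (left_mem_segment ℝ x y)⟩

theorem _root_.RectSkeleton.IsSkeletonOf.segment_subset (hS : IsSkeletonOf W S) {s : Set Plane}
    (hs : s ∈ S) {p n : Plane} (hp : p ∈ s) (hn : n ∈ s) : segment ℝ p n ⊆ W := by
  obtain ⟨⟨x, y, -, rfl⟩, hsW⟩ := hS.1 s hs
  exact ((convex_segment x y).segment_subset hp hn).trans hsW

/-- The segments that meet the old box are inside the new one. -/
theorem _root_.RectSkeleton.Advance.meeting_subset {u v : Plane} (hA : Advance W hi K u v)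
    (hS : IsSkeletonOf W S) : meeting S K ⊆ inside S v := by
  rintro s ⟨hs, p, hp, hpK⟩
  exact ⟨hs, fun n hn => hA.dominates p n hpK (hS.segment_subset hs hp hn)⟩

theorem end_of_touch {π : Plane → ℝ} (hπ : π = Prod.fst ∨ π = Prod.snd) {x y w : Plane} {m : ℝ}
    (hx : m ≤ π x) (hy : m ≤ π y) (hw : w ∈ segment ℝ x y) (e : π w = m) : π x = m ∨ π y = m := by
  by_contra! hne
  have hx' := lt_of_le_of_ne hx hne.1.symm
  have hy' := lt_of_le_of_ne hy hne.2.symm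
  obtain ⟨t, t0, t1, e1, e2⟩ := mem_segment_coord.1 hw
  have hco : π w = (1 - t) * π x + t * π y := by rcases hπ with rfl | rfl <;> assumption
  have := le_convexComb t0 t1 (min_le_left (π x) (π y)) (min_le_right (π x) (π y))
  have := lt_min hx' hy'
  linarith

/-- A segment that touches the left and the bottom edge has one end on each of them. -/
theorem ends_of_touch (h : Staircase W a c lo hi en) {x y : Plane} (hs : segment ℝ x y ⊆ W)
    (h1 : ∃ w ∈ segment ℝ x y, w.1 = a.1) (h2 : ∃ w ∈ segment ℝ x y, w.2 = a.2) :
    (x.1 = a.1 ∧ y.2 = a.2) ∨ (y.1 = a.1 ∧ x.2 = a.2) := by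
  have hx := hs (left_mem_segment ℝ x y)
  have hy := hs (right_mem_segment ℝ x y)
  obtain ⟨w1, m1, e1⟩ := h1
  obtain ⟨w2, m2, e2⟩ := h2
  have ha : ∀ z ∈ W, z.1 = a.1 → z.2 ≠ a.2 := fun z hz i j => h.not_corner (Prod.ext i j ▸ hz)
  rcases end_of_touch (Or.inl rfl) (h.ge x hx).1 (h.ge y hy).1 m1 e1 with i | i <;>
    rcases end_of_touch (Or.inr rfl) (h.ge x hx).2 (h.ge y hy).2 m2 e2 with j | j
  · exact absurd j (ha x hx i)
  · exact Or.inl ⟨i, j⟩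
  · exact Or.inr ⟨i, j⟩
  · exact absurd j (ha y hy i)

/-- A segment that touches the left and the bottom edge is in the box spanned by these edges. -/
theorem touch_le (h : Staircase W a c lo hi en) {x y : Plane} (hs : segment ℝ x y ⊆ W)
    (h1 : ∃ w ∈ segment ℝ x y, w.1 = a.1) (h2 : ∃ w ∈ segment ℝ x y, w.2 = a.2) :
    ∀ w ∈ segment ℝ x y, w.1 ≤ hi.1 ∧ w.2 ≤ hi.2 := by
  have hx := hs (left_mem_segment ℝ x y)
  have hy := hs (right_mem_segment ℝ x y)
  intro w hw
  obtain ⟨t, t0, t1, e1, e2⟩ := mem_segment_coord.1 hw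
  have hlt := h.a_lt_hi
  rw [e1, e2]
  rcases h.ends_of_touch hs h1 h2 with ⟨i, j⟩ | ⟨i, j⟩
  · exact ⟨convexComb_le_right t0 t1 (i ▸ hlt.1.le) (h.bot y hy j).2,
      convexComb_le_right t0 t1 (h.left x hx i).2 (j ▸ hlt.2.le)⟩
  · exact ⟨convexComb_le_right t0 t1 (h.bot x hx j).2 (i ▸ hlt.1.le),
      convexComb_le_right t0 t1 (j ▸ hlt.2.le) (h.left y hy i).2⟩

theorem covered_hi (h : Staircase W a c lo hi en) (hm : hi ∈ W) : IsCovered W hi hi :=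
  ⟨hm, le_rfl, le_rfl, h.passable_hi, h.swap.passable_hi⟩

theorem two_le_encard_of_ne {α : Type*} {T : Set α} {x y : α} (hx : x ∈ T) (hy : y ∈ T)
    (hxy : x ≠ y) : 2 ≤ T.encard := by
  rw [← Set.encard_pair hxy]
  exact Set.encard_le_encard (Set.insert_subset hx (Set.singleton_subset_iff.2 hy))

/-- At least two segments of a skeleton meet the box spanned by the left and the bottom edge. -/
theorem two_le_meeting_hi (h : Staircase W a c lo hi en) (hS : IsSkeletonOf W S) (hfin : S.Finite)
    (hm : hi ∈ W) : 2 ≤ (meeting S hi).encard := by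
  obtain ⟨s, hs, w, hw, e⟩ := h.exists_left_touch hS hfin
  obtain ⟨t, ht, v, hv, e'⟩ := h.exists_bottom_touch hS hfin
  have hsm : s ∈ meeting S hi :=
    ⟨hs, w, hw, e ▸ h.a_lt_hi.1.le, (h.left w ((hS.1 s hs).2 hw) e).2⟩
  have htm : t ∈ meeting S hi :=
    ⟨ht, v, hv, (h.bot v ((hS.1 t ht).2 hv) e').2, e' ▸ h.a_lt_hi.2.le⟩
  by_cases hst : s = t
  · subst hst
    have hcc : hi ≠ c := fun e => h.hi_lt_fst.ne (congrArg Prod.fst e)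
    obtain ⟨r, hr, hrm, u, hu, huK⟩ := h.exists_leaving hS hfin (h.covered_hi hm) hcc
    refine two_le_encard_of_ne hsm ⟨hr, hrm⟩ fun hsr => huK ?_
    subst hsr
    obtain ⟨⟨x, y, -, rfl⟩, hsW⟩ := hS.1 s hs
    exact h.touch_le hsW ⟨w, hw, e⟩ ⟨v, hv, e'⟩ u hu
  · exact two_le_encard_of_ne hsm htm hst

/-- If no point of the left edge is visible from the bottom edge, then two segments of a skeleton
are in the box to which all segments from these edges belong. -/
theorem two_le_inside (h : Staircase W a c lo hi en) (hS : IsSkeletonOf W S) (hfin : S.Finite)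
    (hvis : ∀ p q : Plane, p.1 = a.1 → q.2 = a.2 → ¬ segment ℝ p q ⊆ W)
    (h1 : ∀ p n : Plane, p.1 = a.1 → segment ℝ p n ⊆ W → n.1 ≤ K.1 ∧ n.2 ≤ K.2)
    (h2 : ∀ p n : Plane, p.2 = a.2 → segment ℝ p n ⊆ W → n.1 ≤ K.1 ∧ n.2 ≤ K.2) :
    2 ≤ (inside S K).encard := by
  obtain ⟨s, hs, w, hw, e⟩ := h.exists_left_touch hS hfin
  obtain ⟨t, ht, v, hv, e'⟩ := h.exists_bottom_touch hS hfin
  refine two_le_encard_of_ne (x := s) (y := t)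
    ⟨hs, fun n hn => h1 w n e (hS.segment_subset hs hw hn)⟩
    ⟨ht, fun n hn => h2 v n e' (hS.segment_subset ht hv hn)⟩ ?_
  rintro rfl
  exact hvis w v e e' (hS.segment_subset hs hw hv)

/-- A single segment cannot touch the left, the bottom and the right edge. -/
theorem two_le_encard (h : Staircase W a c lo hi en) (hS : IsSkeletonOf W S) (hfin : S.Finite) :
    2 ≤ S.encard := by
  obtain ⟨s, hs, w, hw, e⟩ := h.exists_left_touch hS hfin
  obtain ⟨t, ht, v, hv, e'⟩ := h.exists_bottom_touch hS hfin
  obtain ⟨r, hr, u, hu, e''⟩ := h.exists_right_touch hS hfin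
  by_cases hst : s = t
  · by_cases hsr : s = r
    · exfalso
      subst hst hsr
      obtain ⟨⟨x, y, -, rfl⟩, hsW⟩ := hS.1 s hs
      have := (h.touch_le hsW ⟨w, hw, e⟩ ⟨v, hv, e'⟩ u hu).1
      have := h.hi_lt_fst
      linarith
    · exact two_le_encard_of_ne hs hr hsr
  · exact two_le_encard_of_ne hs ht hst

end Staircase

/-! ### Rectilinear convexity -/

theorem l1Dist_triangle (p q r : Plane) : l1Dist p r ≤ l1Dist p q + l1Dist q r := by
  have h1 := abs_sub_le p.1 q.1 r.1
  have h2 := abs_sub_le p.2 q.2 r.2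
  unfold l1Dist
  linarith

theorem l1Dist_add_of_mem_segment {p q z : Plane} (hz : z ∈ segment ℝ p q) :
    l1Dist p z + l1Dist z q = l1Dist p q := by
  obtain ⟨t, h0, h1, e1, e2⟩ := mem_segment_coord.1 hz
  have a1 : p.1 - z.1 = t * (p.1 - q.1) := by rw [e1]; ring
  have a2 : p.2 - z.2 = t * (p.2 - q.2) := by rw [e2]; ring
  have a3 : z.1 - q.1 = (1 - t) * (p.1 - q.1) := by rw [e1]; ring
  have a4 : z.2 - q.2 = (1 - t) * (p.2 - q.2) := by rw [e2]; ring
  unfold l1Dist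
  rw [a1, a2, a3, a4, abs_mul, abs_mul, abs_mul, abs_mul, abs_of_nonneg h0,
    abs_of_nonneg (sub_nonneg.2 h1)]
  ring

/-- The points of a rectilinear path form a connected set. -/
theorem RectPathIn.exists_preconnected {A : Set Plane} {p q : Plane} {L : ℝ}
    (h : RectPathIn A p q L) : l1Dist p q ≤ L ∧ ∃ P ⊆ A, IsPreconnected P ∧ p ∈ P ∧ q ∈ P ∧
      ∀ z ∈ P, l1Dist p z + l1Dist z q ≤ L := by
  induction h with
  | refl p hp =>
    refine ⟨by simp [l1Dist], {p}, by simpa using hp, isPreconnected_singleton, rfl, rfl, ?_⟩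
    rintro z rfl
    simp [l1Dist]
  | step p r q L haxis hseg hrest ih =>
    obtain ⟨hL, P, hPA, hP, hr, hq, hd⟩ := ih
    refine ⟨(l1Dist_triangle p r q).trans (by linarith), segment ℝ p r ∪ P,
      Set.union_subset hseg hPA, (isPreconnected_segment p r).union r
        (right_mem_segment ℝ p r) hr hP, Or.inl (left_mem_segment ℝ p r), Or.inr hq, ?_⟩
    rintro z (hz | hz)
    · have h1 := l1Dist_add_of_mem_segment hz
      have h2 := l1Dist_triangle z r q
      linarith
    · have h1 := hd z hz
      have h2 := l1Dist_triangle p r z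
      linarith

theorem between_of_abs {a b z : ℝ} (h : |a - z| + |z - b| ≤ |a - b|) :
    min a b ≤ z ∧ z ≤ max a b := by
  rcases le_total a b with hab | hab
  · rw [abs_of_nonpos (sub_nonpos.2 hab)] at h
    rw [min_eq_left hab, max_eq_right hab]
    constructor
    · linarith [le_abs_self (a - z), neg_abs_le (z - b), le_abs_self (z - b), neg_abs_le (a - z)]
    · linarith [le_abs_self (a - z), neg_abs_le (z - b), le_abs_self (z - b), neg_abs_le (a - z)]
  · rw [abs_of_nonneg (sub_nonneg.2 hab)] at h
    rw [min_eq_right hab, max_eq_left hab]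
    constructor
    · linarith [le_abs_self (a - z), neg_abs_le (z - b), le_abs_self (z - b), neg_abs_le (a - z)]
    · linarith [le_abs_self (a - z), neg_abs_le (z - b), le_abs_self (z - b), neg_abs_le (a - z)]

/-- Two points of a rectilinearly convex set belong to a connected subset of the box that they
span. -/
theorem RectConvex.exists_preconnected {W : Set Plane} (h : RectConvex W) {p q : Plane}
    (hp : p ∈ W) (hq : q ∈ W) : ∃ P ⊆ W, IsPreconnected P ∧ p ∈ P ∧ q ∈ P ∧
      ∀ z ∈ P, (min p.1 q.1 ≤ z.1 ∧ z.1 ≤ max p.1 q.1) ∧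
        (min p.2 q.2 ≤ z.2 ∧ z.2 ≤ max p.2 q.2) := by
  obtain ⟨-, P, hPW, hP, hpP, hqP, hd⟩ := (h p hp q hq).exists_preconnected
  refine ⟨P, hPW, hP, hpP, hqP, fun z hz => ?_⟩
  have h1 := hd z hz
  unfold l1Dist at h1
  have h2 := abs_sub_le p.1 z.1 q.1
  have h3 := abs_sub_le p.2 z.2 q.2
  exact ⟨between_of_abs (by linarith), between_of_abs (by linarith)⟩

theorem RectConvex.exists_fst {W : Set Plane} (h : RectConvex W) {p q : Plane}
    (hp : p ∈ W) (hq : q ∈ W) {x : ℝ} (h1 : p.1 ≤ x) (h2 : x ≤ q.1) :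
    ∃ y, (x, y) ∈ W ∧ min p.2 q.2 ≤ y ∧ y ≤ max p.2 q.2 := by
  obtain ⟨P, hPW, hP, hpP, hqP, hb⟩ := h.exists_preconnected hp hq
  obtain ⟨w, hw, rfl⟩ := exists_fst_of_preconnected hP hpP hqP h1 h2
  exact ⟨w.2, hPW hw, (hb w hw).2⟩

theorem RectConvex.exists_snd {W : Set Plane} (h : RectConvex W) {p q : Plane}
    (hp : p ∈ W) (hq : q ∈ W) {y : ℝ} (h1 : p.2 ≤ y) (h2 : y ≤ q.2) :
    ∃ x, (x, y) ∈ W ∧ min p.1 q.1 ≤ x ∧ x ≤ max p.1 q.1 := by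
  obtain ⟨P, hPW, hP, hpP, hqP, hb⟩ := h.exists_preconnected hp hq
  obtain ⟨w, hw, rfl⟩ := exists_snd_of_preconnected hP hpP hqP h1 h2
  exact ⟨w.1, hPW hw, (hb w hw).1⟩

theorem RectConvex.mem_of_fst {W : Set Plane} (h : RectConvex W) {x y₁ y y₂ : ℝ}
    (h1 : (x, y₁) ∈ W) (h2 : (x, y₂) ∈ W) (i1 : y₁ ≤ y) (i2 : y ≤ y₂) : (x, y) ∈ W := by
  obtain ⟨x', hx', i, j⟩ := h.exists_snd h1 h2 i1 i2
  simp only [min_self, max_self] at i j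
  rwa [← le_antisymm j i]

theorem RectConvex.mem_of_snd {W : Set Plane} (h : RectConvex W) {x₁ x x₂ y : ℝ}
    (h1 : (x₁, y) ∈ W) (h2 : (x₂, y) ∈ W) (i1 : x₁ ≤ x) (i2 : x ≤ x₂) : (x, y) ∈ W := by
  obtain ⟨y', hy', i, j⟩ := h.exists_fst h1 h2 i1 i2
  simp only [min_self, max_self] at i j
  rwa [← le_antisymm j i]

/-- A path between opposite quadrants at `z` and one between the other two pass `z` on opposite
sides, on its vertical or on its horizontal line. -/
theorem RectConvex.mem_of_quadrants {W : Set Plane} (h : RectConvex W) (z : Plane)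
    (hsw : ∃ w ∈ W, w.1 ≤ z.1 ∧ w.2 ≤ z.2) (hne : ∃ w ∈ W, z.1 ≤ w.1 ∧ z.2 ≤ w.2)
    (hnw : ∃ w ∈ W, w.1 ≤ z.1 ∧ z.2 ≤ w.2) (hse : ∃ w ∈ W, z.1 ≤ w.1 ∧ w.2 ≤ z.2) : z ∈ W := by
  obtain ⟨w1, m1, i1, j1⟩ := hsw
  obtain ⟨w2, m2, i2, j2⟩ := hne
  obtain ⟨w3, m3, i3, j3⟩ := hnw
  obtain ⟨w4, m4, i4, j4⟩ := hse
  obtain ⟨y, hy, -⟩ := h.exists_fst m1 m2 i1 i2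
  obtain ⟨y', hy', -⟩ := h.exists_fst m3 m4 i3 i4
  rcases le_total y z.2 with k | k <;> rcases le_total y' z.2 with k' | k'
  · obtain ⟨x, hx, ix, -⟩ := h.exists_snd (y := z.2) hy m2 k j2
    obtain ⟨x', hx', -, ix'⟩ := h.exists_snd (y := z.2) hy' m3 k' j3
    refine h.mem_of_snd hx' hx (ix'.trans ?_) (le_trans ?_ ix)
    · exact max_le le_rfl i3
    · exact le_min le_rfl i2
  · exact h.mem_of_fst hy hy' k k'
  · exact h.mem_of_fst hy' hy k' k
  · obtain ⟨x, hx, -, ix⟩ := h.exists_snd (y := z.2) m1 hy j1 k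
    obtain ⟨x', hx', ix', -⟩ := h.exists_snd (y := z.2) m4 hy' j4 k'
    refine h.mem_of_snd hx hx' (ix.trans ?_) (le_trans ?_ ix')
    · exact max_le i1 le_rfl
    · exact le_min i4 le_rfl

/-! ### The boundary of an obstacle -/

theorem mem_frontier_Icc {a c z : Plane} : z ∈ frontier (Set.Icc a c) ↔
    z ∈ Set.Icc a c ∧ ¬ ((a.1 < z.1 ∧ z.1 < c.1) ∧ (a.2 < z.2 ∧ z.2 < c.2)) := by
  have : Set.Icc a c = Set.Icc a.1 c.1 ×ˢ Set.Icc a.2 c.2 := by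
    rw [Set.Icc_prod_Icc]
  rw [frontier, isClosed_Icc.closure_eq, this, interior_prod_eq, interior_Icc, interior_Icc]
  rfl

theorem collinear_of_fst {p q r : Plane} {x : ℝ} (hp : p.1 = x) (hq : q.1 = x) (hr : r.1 = x) :
    Collinear ℝ ({p, q, r} : Set Plane) := by
  rw [collinear_iff_exists_forall_eq_smul_vadd]
  refine ⟨(x, 0), (0, 1), ?_⟩
  rintro z (rfl | rfl | rfl) <;> exact ⟨z.2, by ext <;> simp [*]⟩

/-- The open quadrant at `z` in the direction `(σ, τ)` is locally contained in `W`. -/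
def FullQuadrant (W : Set Plane) (z : Plane) (σ τ : ℝ) : Prop :=
  ∃ δ > 0, ∀ s t : ℝ, 0 < s → s < δ → 0 < t → t < δ → (z.1 + σ * s, z.2 + τ * t) ∈ W

/-- The open quadrant at `z` in the direction `(σ, τ)` is locally disjoint from `W`. -/
def EmptyQuadrant (W : Set Plane) (z : Plane) (σ τ : ℝ) : Prop :=
  ∃ δ > 0, ∀ s t : ℝ, 0 < s → s < δ → 0 < t → t < δ → (z.1 + σ * s, z.2 + τ * t) ∉ W

namespace Obstacle

variable (ω : Obstacle)

instance : NeZero ω.n := ⟨by have := ω.four_le; omega⟩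

theorem isClosed : IsClosed ω.region := by
  rw [← ω.regular]; exact isClosed_closure

theorem isCompact : IsCompact ω.region :=
  Metric.isCompact_of_isClosed_isBounded ω.isClosed ω.bounded

theorem edge_subset_frontier (i : ZMod ω.n) : ω.edge i ⊆ frontier ω.region := by
  rw [ω.boundary_eq]; exact Set.subset_iUnion (fun i => segment ℝ (ω.vertex i) (ω.vertex (i + 1))) i

theorem edge_subset (i : ZMod ω.n) : ω.edge i ⊆ ω.region :=
  (ω.edge_subset_frontier i).trans ω.isClosed.frontier_subset

theorem nat_cast_ne_zero {k : ℕ} (h0 : 0 < k) (h4 : k < 4) : (k : ZMod ω.n) ≠ 0 := by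
  intro h
  have := Nat.le_of_dvd h0 ((ZMod.natCast_eq_zero_iff k ω.n).1 h)
  have := ω.four_le
  omega

theorem add_one_ne (i : ZMod ω.n) : i + 1 ≠ i := by
  have := ω.nat_cast_ne_zero (k := 1) (by norm_num) (by norm_num)
  simpa using this

theorem add_two_ne (i : ZMod ω.n) : i + 1 + 1 ≠ i := by
  have := ω.nat_cast_ne_zero (k := 2) (by norm_num) (by norm_num)
  intro h
  apply this
  push_cast
  linear_combination h

theorem vertex_ne (i : ZMod ω.n) : ω.vertex i ≠ ω.vertex (i + 1) :=
  fun h => ω.add_one_ne i (ω.vertex_injective h).symm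

/-- Different edges do not lie on the same vertical line. -/
theorem eq_of_fst {x : ℝ} {i j : ZMod ω.n} (hi : (ω.vertex i).1 = x)
    (hi' : (ω.vertex (i + 1)).1 = x) (hj : (ω.vertex j).1 = x) (hj' : (ω.vertex (j + 1)).1 = x) :
    i = j := by
  by_contra hij
  rcases eq_or_ne j (i + 1) with rfl | hj1
  · exact ω.general_position i (i + 1) (i + 1 + 1) (ω.add_one_ne i).symm (ω.add_two_ne i).symm
      (ω.add_one_ne _).symm (collinear_of_fst hi hi' hj')
  · exact ω.general_position i (i + 1) j (ω.add_one_ne i).symm hij hj1.symm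
      (collinear_of_fst hi hi' hj)

/-- A vertical segment of the boundary is part of a single edge. -/
theorem exists_edge_of_vertical {x y₁ y₂ : ℝ} (h12 : y₁ < y₂)
    (h : ∀ y, y₁ ≤ y → y ≤ y₂ → (x, y) ∈ frontier ω.region) :
    ∃ i, (ω.vertex i).1 = x ∧ (ω.vertex (i + 1)).1 = x ∧
      ∀ y, y₁ ≤ y → y ≤ y₂ → ((x, y) : Plane) ∈ ω.edge i := by
  classical
  set V : ZMod ω.n → Prop := fun i => (ω.vertex i).1 = x ∧ (ω.vertex (i + 1)).1 = x with hV
  -- every other edge meets the line in at most one point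
  have hsub : ∀ i, ¬ V i → {y | ((x, y) : Plane) ∈ ω.edge i}.Subsingleton := by
    intro i hi y hy y' hy'
    obtain ⟨t, -, -, e1, e2⟩ := mem_segment_coord.1 hy
    obtain ⟨t', -, -, e1', e2'⟩ := mem_segment_coord.1 hy'
    simp only at e1 e2 e1' e2'
    rcases ω.rectilinear i with hr | hr
    · have : (ω.vertex i).1 = x := by rw [e1, ← hr]; ring
      exact absurd ⟨this, hr.symm.trans this⟩ hi
    · rw [e2, e2', ← hr]; ring
  have hN : (⋃ i ∈ {i | ¬ V i}, {y | ((x, y) : Plane) ∈ ω.edge i}).Finite :=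
    (Set.toFinite _).biUnion fun i hi => (hsub i hi).finite
  set N := ⋃ i ∈ {i | ¬ V i}, {y | ((x, y) : Plane) ∈ ω.edge i}
  have hcov : ∀ y, y₁ ≤ y → y ≤ y₂ → y ∉ N → ∃ i, V i ∧ ((x, y) : Plane) ∈ ω.edge i := by
    intro y i1 i2 hy
    have := h y i1 i2
    rw [ω.boundary_eq, Set.mem_iUnion] at this
    obtain ⟨i, hi⟩ := this
    refine ⟨i, ?_, hi⟩
    by_contra hV
    exact hy (Set.mem_biUnion (show i ∈ {i | ¬ V i} from hV) hi)
  have hdense : Dense (Nᶜ) := hN.countable.dense_compl ℝ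
  have hcl : Set.Icc y₁ y₂ ⊆ closure (Set.Ioo y₁ y₂ ∩ Nᶜ) := by
    rw [← closure_Ioo h12.ne]
    exact closure_minimal (hdense.open_subset_closure_inter isOpen_Ioo) isClosed_closure
  obtain ⟨y₀, hy₀, hy₀'⟩ := hdense.inter_open_nonempty (Set.Ioo y₁ y₂) isOpen_Ioo
    (Set.nonempty_Ioo.2 h12)
  obtain ⟨i, hi, -⟩ := hcov y₀ hy₀.1.le hy₀.2.le hy₀'
  refine ⟨i, hi.1, hi.2, fun y i1 i2 => ?_⟩
  have hclosed : IsClosed {y | ((x, y) : Plane) ∈ ω.edge i} := by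
    have hc : IsClosed (ω.edge i) := by
      unfold edge
      rw [segment_eq_image]
      exact (isCompact_Icc.image (by fun_prop)).isClosed
    exact hc.preimage (by fun_prop)
  refine closure_minimal ?_ hclosed (hcl ⟨i1, i2⟩)
  rintro y ⟨⟨k1, k2⟩, k3⟩
  obtain ⟨j, hj, hy⟩ := hcov y k1.le k2.le k3
  rwa [ω.eq_of_fst hi.1 hi.2 hj.1 hj.2]

/-- Two different edges meet only in a common vertex. -/
theorem mem_edge_inter {i j : ZMod ω.n} (hij : i ≠ j) {z : Plane} (hi : z ∈ ω.edge i)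
    (hj : z ∈ ω.edge j) : (z = ω.vertex (i + 1) ∧ z = ω.vertex j) ∨
      (z = ω.vertex i ∧ z = ω.vertex (j + 1)) := by
  by_cases h1 : j = i + 1
  · subst h1
    have : z ∈ ({ω.vertex (i + 1)} : Set Plane) := ω.consecutive_edges i ▸ ⟨hi, hj⟩
    exact Or.inl ⟨this, this⟩
  by_cases h2 : i = j + 1
  · subst h2
    have : z ∈ ({ω.vertex (j + 1)} : Set Plane) := ω.consecutive_edges j ▸ ⟨hj, hi⟩
    exact Or.inr ⟨this, this⟩
  exact absurd hj (Set.disjoint_left.1 (ω.disjoint_edges i j (Ne.symm hij) h1 h2) hi)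

/-- Near a point, an open quadrant misses the boundary, and it is connected. -/
theorem quadrant_full_or_empty (z : Plane) {σ τ : ℝ} (hσ : σ ≠ 0) (hτ : τ ≠ 0) :
    FullQuadrant ω.region z σ τ ∨ EmptyQuadrant ω.region z σ τ := by
  classical
  -- a distance below which the quadrant misses the edge `i`
  have hd : ∀ i, ∃ δ > 0, ∀ s t : ℝ, 0 < s → s < δ → 0 < t → t < δ →
      ((z.1 + σ * s, z.2 + τ * t) : Plane) ∉ ω.edge i := by
    intro i
    have hone : ∀ (u ρ : ℝ), ρ ≠ 0 → ∃ δ > 0, ∀ s, 0 < s → s < δ → ρ * s ≠ u := by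
      intro u ρ hρ
      by_cases hu : 0 < u / ρ
      · refine ⟨u / ρ, hu, fun s _ hs e => ?_⟩
        rw [← e, mul_div_cancel_left₀ _ hρ] at hs
        exact lt_irrefl _ hs
      · refine ⟨1, one_pos, fun s h0 _ e => hu ?_⟩
        rwa [← e, mul_div_cancel_left₀ _ hρ]
    rcases ω.rectilinear i with hr | hr
    · obtain ⟨δ, h0, hδ⟩ := hone ((ω.vertex i).1 - z.1) σ hσ
      refine ⟨δ, h0, fun s t s0 s1 _ _ hm => hδ s s0 s1 ?_⟩
      obtain ⟨t', -, -, e1, -⟩ := mem_segment_coord.1 hm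
      simp only [← hr] at e1
      linarith
    · obtain ⟨δ, h0, hδ⟩ := hone ((ω.vertex i).2 - z.2) τ hτ
      refine ⟨δ, h0, fun s t _ _ t0 t1 hm => hδ t t0 t1 ?_⟩
      obtain ⟨t', -, -, -, e2⟩ := mem_segment_coord.1 hm
      simp only [← hr] at e2
      linarith
  choose δ h0 hδ using hd
  set ε := Finset.univ.inf' Finset.univ_nonempty δ with hε
  have hε0 : 0 < ε := (Finset.lt_inf'_iff _).2 fun i _ => h0 i
  have hεi : ∀ i, ε ≤ δ i := fun i => Finset.inf'_le _ (Finset.mem_univ i)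
  set Q : Set Plane := (fun q : Plane => (z.1 + σ * q.1, z.2 + τ * q.2)) ''
    (Set.Ioo 0 ε ×ˢ Set.Ioo 0 ε) with hQ
  have hQc : IsPreconnected Q :=
    (isPreconnected_Ioo.prod isPreconnected_Ioo).image _ (by fun_prop)
  have hQF : Disjoint Q (frontier ω.region) := by
    rw [Set.disjoint_left]
    rintro _ ⟨q, ⟨⟨s0, s1⟩, t0, t1⟩, rfl⟩ hf
    rw [ω.boundary_eq, Set.mem_iUnion] at hf
    obtain ⟨i, hi⟩ := hf
    exact hδ i q.1 q.2 s0 (s1.trans_le (hεi i)) t0 (t1.trans_le (hεi i)) hi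
  by_cases hne : (Q ∩ ω.region).Nonempty
  · refine Or.inl ⟨ε, hε0, fun s t s0 s1 t0 t1 => ?_⟩
    by_contra hm
    have hmQ : ((z.1 + σ * s, z.2 + τ * t) : Plane) ∈ Q := ⟨(s, t), ⟨⟨s0, s1⟩, t0, t1⟩, rfl⟩
    have hint : ∀ w ∈ Q, w ∈ ω.region → w ∈ interior ω.region := fun w hw hwW => by
      by_contra hi
      exact Set.disjoint_left.1 hQF hw (ω.isClosed.frontier_eq ▸ ⟨hwW, hi⟩)
    obtain ⟨w, hw, hwW⟩ := hne
    obtain ⟨w', -, hw1, hw2⟩ := hQc _ _ isOpen_interior ω.isClosed.isOpen_compl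
      (fun w hw => or_iff_not_imp_right.2 fun h => hint w hw (not_not.1 h))
      ⟨w, hw, hint w hw hwW⟩ ⟨_, hmQ, hm⟩
    exact hw2 (interior_subset hw1)
  · refine Or.inr ⟨ε, hε0, fun s t s0 s1 t0 t1 hm => hne ?_⟩
    exact ⟨_, ⟨(s, t), ⟨⟨s0, s1⟩, t0, t1⟩, rfl⟩, hm⟩

end Obstacle

theorem image_segment_equiv (g : Plane ≃L[ℝ] Plane) (p q : Plane) :
    g '' segment ℝ p q = segment ℝ (g p) (g q) :=
  image_segment ℝ (g : Plane →ₗ[ℝ] Plane).toAffineMap p q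

theorem image_interior_equiv (g : Plane ≃L[ℝ] Plane) (A : Set Plane) :
    g '' interior A = interior (g '' A) := g.toHomeomorph.image_interior A

theorem image_frontier_equiv (g : Plane ≃L[ℝ] Plane) (A : Set Plane) :
    g '' frontier A = frontier (g '' A) := g.toHomeomorph.image_frontier A

theorem RectPathIn.image {A : Set Plane} (g : Plane ≃L[ℝ] Plane)
    (hax : ∀ p q : Plane, p.1 = q.1 ∨ p.2 = q.2 → (g p).1 = (g q).1 ∨ (g p).2 = (g q).2)
    (hl : ∀ p q, l1Dist (g p) (g q) = l1Dist p q) {p q : Plane} {L : ℝ} (h : RectPathIn A p q L) :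
    RectPathIn (g '' A) (g p) (g q) L := by
  induction h with
  | refl p hp => exact .refl _ (Set.mem_image_of_mem g hp)
  | step p r q L haxis hseg _ ih =>
    rw [← hl]
    refine .step _ _ _ _ (hax _ _ haxis) ?_ ih
    rw [← image_segment_equiv]
    exact Set.image_mono hseg

namespace Obstacle

/-! ### Symmetries -/

/-- The image of an obstacle under a symmetry of the rectilinear plane. -/
def map (ω : Obstacle) (g : Plane ≃L[ℝ] Plane)
    (hax : ∀ p q : Plane, p.1 = q.1 ∨ p.2 = q.2 → (g p).1 = (g q).1 ∨ (g p).2 = (g q).2)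
    (hl : ∀ p q, l1Dist (g p) (g q) = l1Dist p q) : Obstacle where
  region := g '' ω.region
  n := ω.n
  four_le := ω.four_le
  vertex i := g (ω.vertex i)
  vertex_injective := g.injective.comp ω.vertex_injective
  rectilinear i := hax _ _ (ω.rectilinear i)
  consecutive_edges i := by
    have := ω.consecutive_edges i
    rw [← image_segment_equiv g, ← image_segment_equiv g, ← Set.image_inter g.injective, this,
      Set.image_singleton]
  disjoint_edges i j h1 h2 h3 := by
    rw [← image_segment_equiv g, ← image_segment_equiv g, Set.disjoint_image_iff g.injective]
    exact ω.disjoint_edges i j h1 h2 h3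
  general_position i j k h1 h2 h3 h := by
    refine ω.general_position i j k h1 h2 h3 ?_
    obtain ⟨p₀, v, hv⟩ := (collinear_iff_exists_forall_eq_smul_vadd _).1 h
    refine (collinear_iff_exists_forall_eq_smul_vadd _).2 ⟨g.symm p₀, g.symm v, fun p hp => ?_⟩
    obtain ⟨r, hr⟩ := hv (g p) (by
      rcases hp with rfl | rfl | rfl <;> simp)
    exact ⟨r, g.injective (by simpa using hr)⟩
  bounded := (ω.isCompact.image g.continuous).isBounded
  regular := by
    rw [← image_interior_equiv, ← g.image_closure, ω.regular]
  boundary_eq := by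
    rw [← image_frontier_equiv, ω.boundary_eq, Set.image_iUnion]
    simp only [image_segment_equiv]
  convex := by
    rintro _ ⟨p, hp, rfl⟩ _ ⟨q, hq, rfl⟩
    rw [hl]
    exact (ω.convex p hp q hq).image g hax hl

/-- The reflection of an obstacle in the diagonal. -/
def swap (ω : Obstacle) : Obstacle :=
  ω.map (ContinuousLinearEquiv.prodComm ℝ ℝ ℝ) (fun _ _ h => h.symm) fun _ _ => add_comm _ _

theorem swap_region (ω : Obstacle) : ω.swap.region = Prod.swap '' ω.region := rfl

variable (ω : Obstacle)

/-! ### The sides of an obstacle -/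

theorem eq_of_snd {y : ℝ} {i j : ZMod ω.n} (hi : (ω.vertex i).2 = y)
    (hi' : (ω.vertex (i + 1)).2 = y) (hj : (ω.vertex j).2 = y) (hj' : (ω.vertex (j + 1)).2 = y) :
    i = j :=
  ω.swap.eq_of_fst hi hi' hj hj'

theorem edge_swap (i : ZMod ω.n) : ω.swap.edge i = Prod.swap '' ω.edge i :=
  (image_segment_equiv (ContinuousLinearEquiv.prodComm ℝ ℝ ℝ) _ _).symm

theorem exists_edge_of_horizontal {y x₁ x₂ : ℝ} (h12 : x₁ < x₂)
    (h : ∀ x, x₁ ≤ x → x ≤ x₂ → (x, y) ∈ frontier ω.region) :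
    ∃ i, (ω.vertex i).2 = y ∧ (ω.vertex (i + 1)).2 = y ∧
      ∀ x, x₁ ≤ x → x ≤ x₂ → ((x, y) : Plane) ∈ ω.edge i := by
  obtain ⟨i, h1, h2, h3⟩ := ω.swap.exists_edge_of_vertical (x := y) h12 fun x i1 i2 => by
    rw [swap_region, frontier_swap_image, swap_image_mem]
    exact h x i1 i2
  refine ⟨i, h1, h2, fun x i1 i2 => ?_⟩
  have h4 : ((y, x) : Plane) ∈ ω.swap.edge i := h3 x i1 i2
  rw [show ω.swap.edge i = _ from ω.edge_swap i, swap_image_mem] at h4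
  exact h4

/-- At a point of an obstacle, one of the four quadrants is locally contained in the obstacle. -/
theorem exists_fullQuadrant {z : Plane} (hz : z ∈ ω.region) :
    ∃ σ τ : ℝ, (σ = 1 ∨ σ = -1) ∧ (τ = 1 ∨ τ = -1) ∧ FullQuadrant ω.region z σ τ := by
  by_contra hcon
  push Not at hcon
  have hne : ∀ σ : ℝ, (σ = 1 ∨ σ = -1) → σ ≠ 0 := by rintro σ (rfl | rfl) <;> norm_num
  have hE : ∀ σ τ : ℝ, (σ = 1 ∨ σ = -1) → (τ = 1 ∨ τ = -1) → EmptyQuadrant ω.region z σ τ :=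
    fun σ τ hσ hτ => (ω.quadrant_full_or_empty z (hne σ hσ) (hne τ hτ)).resolve_left
      (hcon σ τ hσ hτ)
  obtain ⟨δ1, p1, e1⟩ := hE 1 1 (Or.inl rfl) (Or.inl rfl)
  obtain ⟨δ2, p2, e2⟩ := hE 1 (-1) (Or.inl rfl) (Or.inr rfl)
  obtain ⟨δ3, p3, e3⟩ := hE (-1) 1 (Or.inr rfl) (Or.inl rfl)
  obtain ⟨δ4, p4, e4⟩ := hE (-1) (-1) (Or.inr rfl) (Or.inr rfl)
  set δ := min (min δ1 δ2) (min δ3 δ4) with hδ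
  have hδ0 : 0 < δ := lt_min (lt_min p1 p2) (lt_min p3 p4)
  have l1 : δ ≤ δ1 := (min_le_left _ _).trans (min_le_left _ _)
  have l2 : δ ≤ δ2 := (min_le_left _ _).trans (min_le_right _ _)
  have l3 : δ ≤ δ3 := (min_le_right _ _).trans (min_le_left _ _)
  have l4 : δ ≤ δ4 := (min_le_right _ _).trans (min_le_right _ _)
  rw [← ω.regular] at hz
  obtain ⟨w, hw, hd⟩ := Metric.mem_closure_iff.1 hz (δ / 2) (by linarith)
  rw [Prod.dist_eq, max_lt_iff, Real.dist_eq, Real.dist_eq, abs_lt, abs_lt] at hd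
  obtain ⟨ε, ε0, hε⟩ := Staircase.exists_of_mem_interior hw
  obtain ⟨η, η0, η1, η2⟩ : ∃ η > 0, η < ε ∧ η < δ / 2 :=
    ⟨min ε (δ / 2) / 2, by positivity, by
      have := min_le_left ε (δ / 2); linarith, by
      have := min_le_right ε (δ / 2); linarith⟩
  have hη : |η| < ε := by rwa [abs_of_pos η0]
  have hη' : |-η| < ε := by rwa [abs_neg, abs_of_pos η0]
  -- `w` can be moved away from the axes through `z`
  rcases le_total z.1 w.1 with i | i <;> rcases le_total z.2 w.2 with j | j
  · refine e1 (w.1 + η - z.1) (w.2 + η - z.2) ?_ ?_ ?_ ?_ ?_ <;> try linarith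
    convert hε η η hη hη using 2 <;> ring
  · refine e2 (w.1 + η - z.1) (z.2 - (w.2 - η)) ?_ ?_ ?_ ?_ ?_ <;> try linarith
    convert hε η (-η) hη hη' using 2 <;> ring
  · refine e3 (z.1 - (w.1 - η)) (w.2 + η - z.2) ?_ ?_ ?_ ?_ ?_ <;> try linarith
    convert hε (-η) η hη' hη using 2 <;> ring
  · refine e4 (z.1 - (w.1 - η)) (z.2 - (w.2 - η)) ?_ ?_ ?_ ?_ ?_ <;> try linarith
    convert hε (-η) (-η) hη' hη' using 2 <;> ring

theorem vertical_mem_of_full {z : Plane} {σ τ : ℝ} {W : Set Plane} (hW : IsClosed W)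
    (h : FullQuadrant W z σ τ) :
    ∃ δ > 0, ∀ t, 0 < t → t < δ → (z.1, z.2 + τ * t) ∈ W := by
  obtain ⟨δ, h0, hd⟩ := h
  refine ⟨δ, h0, fun t t0 t1 => mem_of_direction hW (z := (z.1, z.2 + τ * t)) σ 0 h0
    fun ε e0 e1 => ?_⟩
  simpa using hd ε t e0 e1 t0 t1

theorem horizontal_mem_of_full {z : Plane} {σ τ : ℝ} {W : Set Plane} (hW : IsClosed W)
    (h : FullQuadrant W z σ τ) :
    ∃ δ > 0, ∀ s, 0 < s → s < δ → (z.1 + σ * s, z.2) ∈ W := by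
  obtain ⟨δ, h0, hd⟩ := h
  refine ⟨δ, h0, fun s s0 s1 => mem_of_direction hW (z := (z.1 + σ * s, z.2)) 0 τ h0
    fun ε e0 e1 => ?_⟩
  simpa using hd s ε s0 s1 e0 e1

/-- The points of an obstacle on a vertical line that bounds it form an edge. -/
theorem exists_vertical_side {z : Plane} (hz : z ∈ ω.region) {σ : ℝ} (hσ : σ = 1 ∨ σ = -1)
    (hside : ∀ w ∈ ω.region, 0 ≤ σ * (w.1 - z.1)) :
    ∃ i, (ω.vertex i).1 = z.1 ∧ (ω.vertex (i + 1)).1 = z.1 ∧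
      ω.edge i = {w ∈ ω.region | w.1 = z.1} := by
  have hfr : ∀ w ∈ ω.region, w.1 = z.1 → w ∈ frontier ω.region := by
    intro w hw e
    refine ω.isClosed.frontier_eq ▸ ⟨hw, fun hi => ?_⟩
    obtain ⟨ε, ε0, hε⟩ := Staircase.exists_of_mem_interior hi
    have h1 := hside _ (hε (ε / 2) 0 (by rw [abs_of_pos] <;> linarith) (by simpa using ε0))
    have h2 := hside _ (hε (-(ε / 2)) 0 (by rw [abs_neg, abs_of_pos] <;> linarith)
      (by simpa using ε0))
    simp only [e] at h1 h2
    rcases hσ with rfl | rfl <;> linarith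
  have hnd : ∃ y, y ≠ z.2 ∧ ((z.1, y) : Plane) ∈ ω.region := by
    obtain ⟨σ', τ, -, hτ, hfull⟩ := ω.exists_fullQuadrant hz
    obtain ⟨δ, h0, hd⟩ := vertical_mem_of_full ω.isClosed hfull
    refine ⟨z.2 + τ * (δ / 2), fun e => ?_, hd (δ / 2) (by linarith) (by linarith)⟩
    rcases hτ with rfl | rfl <;> linarith
  obtain ⟨y, hyz, hy⟩ := hnd
  have hline : ∀ y₁ y₂, ((z.1, y₁) : Plane) ∈ ω.region → ((z.1, y₂) : Plane) ∈ ω.region → y₁ < y₂ →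
      ∃ i, (ω.vertex i).1 = z.1 ∧ (ω.vertex (i + 1)).1 = z.1 ∧
        ∀ y, y₁ ≤ y → y ≤ y₂ → ((z.1, y) : Plane) ∈ ω.edge i := fun y₁ y₂ h1 h2 h12 =>
    ω.exists_edge_of_vertical h12 fun y i1 i2 => hfr _ (ω.convex.mem_of_fst h1 h2 i1 i2) rfl
  have hex : ∀ w ∈ ω.region, w.1 = z.1 → ∃ i, (ω.vertex i).1 = z.1 ∧ (ω.vertex (i + 1)).1 = z.1 ∧
      w ∈ ω.edge i := by
    rintro ⟨w1, w2⟩ hw rfl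
    obtain ⟨y', hne, hy'⟩ : ∃ y', y' ≠ w2 ∧ ((z.1, y') : Plane) ∈ ω.region := by
      rcases eq_or_ne y w2 with rfl | h
      · exact ⟨z.2, hyz.symm, hz⟩
      · exact ⟨y, h, hy⟩
    rcases lt_or_gt_of_ne hne with i | i
    · obtain ⟨k, k1, k2, k3⟩ := hline _ _ hy' hw i
      exact ⟨k, k1, k2, k3 _ i.le le_rfl⟩
    · obtain ⟨k, k1, k2, k3⟩ := hline _ _ hw hy' i
      exact ⟨k, k1, k2, k3 _ le_rfl i.le⟩
  obtain ⟨i, h1, h2, -⟩ := hex z hz rfl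
  refine ⟨i, h1, h2, Set.Subset.antisymm (fun w hw => ⟨ω.edge_subset i hw, ?_⟩) ?_⟩
  · exact ((fst_eq_of_mem_segment (h1.trans h2.symm) hw).1).trans h2
  · rintro w ⟨hw, e⟩
    obtain ⟨j, j1, j2, j3⟩ := hex w hw e
    rwa [ω.eq_of_fst h1 h2 j1 j2]

theorem exists_horizontal_side {z : Plane} (hz : z ∈ ω.region) {σ : ℝ} (hσ : σ = 1 ∨ σ = -1)
    (hside : ∀ w ∈ ω.region, 0 ≤ σ * (w.2 - z.2)) :
    ∃ i, (ω.vertex i).2 = z.2 ∧ (ω.vertex (i + 1)).2 = z.2 ∧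
      ω.edge i = {w ∈ ω.region | w.2 = z.2} := by
  obtain ⟨i, h1, h2, h3⟩ := ω.swap.exists_vertical_side (z := z.swap)
    (by rwa [swap_region, swap_image_mem]) hσ
    (by rintro _ ⟨w, hw, rfl⟩; exact hside w hw)
  refine ⟨i, h1, h2, ?_⟩
  rw [show ω.swap.edge i = _ from ω.edge_swap i, swap_region] at h3
  ext w
  have := Set.ext_iff.1 h3 w.swap
  rw [swap_image_mem] at this
  simpa only [Set.mem_ofPred_eq, swap_image_mem, Prod.swap_swap, Prod.fst_swap] using this

/-- The bounding box of an obstacle is touched on all of its four sides. -/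
theorem exists_boundingBox : ∃ a c : Plane, boundingBox ω.region = Set.Icc a c ∧
    (∀ w ∈ ω.region, (a.1 ≤ w.1 ∧ a.2 ≤ w.2) ∧ (w.1 ≤ c.1 ∧ w.2 ≤ c.2)) ∧
    (∃ w ∈ ω.region, w.1 = a.1) ∧ (∃ w ∈ ω.region, w.2 = a.2) ∧
    (∃ w ∈ ω.region, w.1 = c.1) ∧ (∃ w ∈ ω.region, w.2 = c.2) := by
  have hne : ω.region.Nonempty := ⟨_, ω.edge_subset 0 (left_mem_segment ℝ _ _)⟩
  have h1 := ω.isCompact.image continuous_fst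
  have h2 := ω.isCompact.image continuous_snd
  refine ⟨_, _, rfl, fun w hw => ⟨⟨?_, ?_⟩, ?_, ?_⟩, ?_, ?_, ?_, ?_⟩
  · exact csInf_le h1.bddBelow ⟨w, hw, rfl⟩
  · exact csInf_le h2.bddBelow ⟨w, hw, rfl⟩
  · exact le_csSup h1.bddAbove ⟨w, hw, rfl⟩
  · exact le_csSup h2.bddAbove ⟨w, hw, rfl⟩
  · exact h1.sInf_mem (hne.image _)
  · exact h2.sInf_mem (hne.image _)
  · exact h1.sSup_mem (hne.image _)
  · exact h2.sSup_mem (hne.image _)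

/-! ### Extreme edges and corners -/

/-- An extreme edge lies on one of the four sides of the bounding box. -/
theorem edge_of_extreme {a c : Plane} (hbox : boundingBox ω.region = Set.Icc a c)
    {i : ZMod ω.n} (he : ω.edge i ⊆ frontier (boundingBox ω.region)) :
    ((ω.vertex i).1 = (ω.vertex (i + 1)).1 ∧ ((ω.vertex i).1 = a.1 ∨ (ω.vertex i).1 = c.1)) ∨
      ((ω.vertex i).2 = (ω.vertex (i + 1)).2 ∧ ((ω.vertex i).2 = a.2 ∨ (ω.vertex i).2 = c.2)) := by
  rw [hbox] at he
  have hm := he (show pointAt (ω.vertex i) (ω.vertex (i + 1)) (1 / 2) ∈ ω.edge i from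
    pointAt_mem (by norm_num) (by norm_num))
  have h1 := (mem_frontier_Icc.1 (he (left_mem_segment ℝ _ _))).1
  have h2 := (mem_frontier_Icc.1 (he (right_mem_segment ℝ _ _))).1
  rw [mem_frontier_Icc] at hm
  obtain ⟨⟨l1, l2⟩, r1, r2⟩ := And.intro (Prod.le_def.1 h1.1) (Prod.le_def.1 h1.2)
  obtain ⟨⟨l3, l4⟩, r3, r4⟩ := And.intro (Prod.le_def.1 h2.1) (Prod.le_def.1 h2.2)
  have hm2 := hm.2
  simp only [pointAt] at hm2
  rcases ω.rectilinear i with hr | hr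
  · left
    refine ⟨hr, ?_⟩
    by_contra! hcon
    have hlt1 := lt_of_le_of_ne l1 hcon.1.symm
    have hlt2 := lt_of_le_of_ne r1 hcon.2
    have hne : (ω.vertex i).2 ≠ (ω.vertex (i + 1)).2 := fun e => ω.vertex_ne i (Prod.ext hr e)
    refine hm2 ⟨⟨by linarith, by linarith⟩, ?_⟩
    rcases lt_or_gt_of_ne hne with k | k <;> constructor <;> linarith
  · right
    refine ⟨hr, ?_⟩
    by_contra! hcon
    have hlt1 := lt_of_le_of_ne l2 hcon.1.symm
    have hlt2 := lt_of_le_of_ne r2 hcon.2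
    have hne : (ω.vertex i).1 ≠ (ω.vertex (i + 1)).1 := fun e => ω.vertex_ne i (Prod.ext e hr)
    refine hm2 ⟨?_, ⟨by linarith, by linarith⟩⟩
    rcases lt_or_gt_of_ne hne with k | k <;> constructor <;> linarith

/-- Extreme corners are corners of the bounding box. -/
theorem IsExtremeCorner.eq {ω : Obstacle} {a c p : Plane}
    (hbox : boundingBox ω.region = Set.Icc a c)
    (hp : ω.IsExtremeCorner p) : (p.1 = a.1 ∨ p.1 = c.1) ∧ (p.2 = a.2 ∨ p.2 = c.2) := by
  obtain ⟨-, e, e', ⟨⟨i, rfl⟩, hi⟩, ⟨⟨j, rfl⟩, hj⟩, hne, hpi, hpj⟩ := hp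
  have hij : i ≠ j := fun h => hne (by rw [h])
  rcases ω.edge_of_extreme hbox hi with ⟨i1, i2⟩ | ⟨i1, i2⟩ <;>
    rcases ω.edge_of_extreme hbox hj with ⟨j1, j2⟩ | ⟨j1, j2⟩
  · have e1 := (fst_eq_of_mem_segment i1 hpi).1
    have e2 := (fst_eq_of_mem_segment j1 hpj).1
    exact absurd (ω.eq_of_fst (i1.trans e1.symm) e1.symm (j1.trans e2.symm) e2.symm) hij
  · have e1 := (fst_eq_of_mem_segment i1 hpi).1
    have e2 := (snd_eq_of_mem_segment j1 hpj).1
    rw [e1, e2, ← i1, ← j1]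
    exact ⟨i2, j2⟩
  · have e1 := (snd_eq_of_mem_segment i1 hpi).1
    have e2 := (fst_eq_of_mem_segment j1 hpj).1
    rw [e1, e2, ← i1, ← j1]
    exact ⟨j2, i2⟩
  · have e1 := (snd_eq_of_mem_segment i1 hpi).1
    have e2 := (snd_eq_of_mem_segment j1 hpj).1
    exact absurd (ω.eq_of_snd (i1.trans e1.symm) e1.symm (j1.trans e2.symm) e2.symm) hij

theorem sign_of_side {A : Set Plane} {a c z : Plane} {π : Plane → ℝ}
    (hac : ∀ w ∈ A, π a ≤ π w ∧ π w ≤ π c) (hz : π z = π a ∨ π z = π c) :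
    ∃ σ : ℝ, (σ = 1 ∨ σ = -1) ∧ ∀ w ∈ A, 0 ≤ σ * (π w - π z) := by
  rcases hz with e | e
  · exact ⟨1, Or.inl rfl, fun w hw => by have := (hac w hw).1; rw [e]; linarith⟩
  · exact ⟨-1, Or.inr rfl, fun w hw => by have := (hac w hw).2; rw [e]; linarith⟩

theorem subset_frontier_box {a c : Plane} (hbox : boundingBox ω.region = Set.Icc a c)
    (hac : ∀ w ∈ ω.region, (a.1 ≤ w.1 ∧ a.2 ≤ w.2) ∧ (w.1 ≤ c.1 ∧ w.2 ≤ c.2)) {A : Set Plane}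
    (hA : A ⊆ ω.region) (h : ∀ w ∈ A, w.1 = a.1 ∨ w.1 = c.1 ∨ w.2 = a.2 ∨ w.2 = c.2) :
    A ⊆ frontier (boundingBox ω.region) := by
  intro w hw
  rw [hbox, mem_frontier_Icc]
  obtain ⟨h1, h2⟩ := hac w (hA hw)
  refine ⟨⟨Prod.le_def.2 h1, Prod.le_def.2 h2⟩, fun ⟨⟨i1, i2⟩, i3, i4⟩ => ?_⟩
  rcases h w hw with e | e | e | e <;> linarith

/-- The points of the obstacle on the left or on the right side of the bounding box form an extreme
edge. -/
theorem isExtremeEdge_fst {a c z : Plane} (hbox : boundingBox ω.region = Set.Icc a c)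
    (hac : ∀ w ∈ ω.region, (a.1 ≤ w.1 ∧ a.2 ≤ w.2) ∧ (w.1 ≤ c.1 ∧ w.2 ≤ c.2))
    (hz : z ∈ ω.region) (hzs : z.1 = a.1 ∨ z.1 = c.1) :
    ∃ i, (ω.vertex i).1 = z.1 ∧ (ω.vertex (i + 1)).1 = z.1 ∧
      ω.edge i = {w ∈ ω.region | w.1 = z.1} ∧ ω.IsExtremeEdge {w ∈ ω.region | w.1 = z.1} := by
  obtain ⟨σ, hσ, hs⟩ := sign_of_side (A := ω.region) (a := a) (c := c) (z := z) (π := Prod.fst)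
    (fun w hw => ⟨(hac w hw).1.1, (hac w hw).2.1⟩) hzs
  obtain ⟨i, h1, h2, h3⟩ := ω.exists_vertical_side hz hσ hs
  refine ⟨i, h1, h2, h3, ⟨i, h3.symm⟩,
    ω.subset_frontier_box hbox hac (fun w hw => hw.1) fun w hw => ?_⟩
  rw [hw.2]
  rcases hzs with e | e
  · exact Or.inl e
  · exact Or.inr (Or.inl e)

theorem isExtremeEdge_snd {a c z : Plane} (hbox : boundingBox ω.region = Set.Icc a c)
    (hac : ∀ w ∈ ω.region, (a.1 ≤ w.1 ∧ a.2 ≤ w.2) ∧ (w.1 ≤ c.1 ∧ w.2 ≤ c.2))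
    (hz : z ∈ ω.region) (hzs : z.2 = a.2 ∨ z.2 = c.2) :
    ∃ i, (ω.vertex i).2 = z.2 ∧ (ω.vertex (i + 1)).2 = z.2 ∧
      ω.edge i = {w ∈ ω.region | w.2 = z.2} ∧ ω.IsExtremeEdge {w ∈ ω.region | w.2 = z.2} := by
  obtain ⟨σ, hσ, hs⟩ := sign_of_side (A := ω.region) (a := a) (c := c) (z := z) (π := Prod.snd)
    (fun w hw => ⟨(hac w hw).1.2, (hac w hw).2.2⟩) hzs
  obtain ⟨i, h1, h2, h3⟩ := ω.exists_horizontal_side hz hσ hs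
  refine ⟨i, h1, h2, h3, ⟨i, h3.symm⟩,
    ω.subset_frontier_box hbox hac (fun w hw => hw.1) fun w hw => ?_⟩
  rw [hw.2]
  exact Or.inr (Or.inr hzs)

/-- The extreme edges are the intersections of the obstacle with the sides of the bounding box. -/
theorem IsExtremeEdge.eq {ω : Obstacle} {a c : Plane} (hbox : boundingBox ω.region = Set.Icc a c)
    (hac : ∀ w ∈ ω.region, (a.1 ≤ w.1 ∧ a.2 ≤ w.2) ∧ (w.1 ≤ c.1 ∧ w.2 ≤ c.2)) {e : Set Plane}
    (he : ω.IsExtremeEdge e) :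
    (∃ x, (x = a.1 ∨ x = c.1) ∧ e = {w ∈ ω.region | w.1 = x}) ∨
      ∃ y, (y = a.2 ∨ y = c.2) ∧ e = {w ∈ ω.region | w.2 = y} := by
  obtain ⟨⟨i, rfl⟩, hi⟩ := he
  have hiW : ω.vertex i ∈ ω.region := ω.edge_subset i (left_mem_segment ℝ _ _)
  rcases ω.edge_of_extreme hbox hi with ⟨i1, i2⟩ | ⟨i1, i2⟩
  · left
    obtain ⟨j, j1, j2, j3, -⟩ := ω.isExtremeEdge_fst hbox hac hiW i2
    exact ⟨_, i2, by rw [← j3, ω.eq_of_fst rfl i1.symm j1 j2]⟩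
  · right
    obtain ⟨j, j1, j2, j3, -⟩ := ω.isExtremeEdge_snd hbox hac hiW i2
    exact ⟨_, i2, by rw [← j3, ω.eq_of_snd rfl i1.symm j1 j2]⟩

/-- A corner of the bounding box that belongs to the obstacle is an extreme corner. -/
theorem isExtremeCorner {a c p : Plane} (hbox : boundingBox ω.region = Set.Icc a c)
    (hac : ∀ w ∈ ω.region, (a.1 ≤ w.1 ∧ a.2 ≤ w.2) ∧ (w.1 ≤ c.1 ∧ w.2 ≤ c.2))
    (hp : p ∈ ω.region) (h1 : p.1 = a.1 ∨ p.1 = c.1) (h2 : p.2 = a.2 ∨ p.2 = c.2) :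
    ω.IsExtremeCorner p := by
  obtain ⟨i, i1, i2, i3, hi⟩ := ω.isExtremeEdge_fst hbox hac hp h1
  obtain ⟨j, j1, j2, j3, hj⟩ := ω.isExtremeEdge_snd hbox hac hp h2
  have hij : i ≠ j := by
    rintro rfl
    exact ω.vertex_ne i (Prod.ext (i1.trans i2.symm) (j1.trans j2.symm))
  refine ⟨?_, _, _, hi, hj, fun h => ?_, ⟨hp, rfl⟩, ⟨hp, rfl⟩⟩
  · rcases ω.mem_edge_inter hij (z := p) (i3 ▸ ⟨hp, rfl⟩) (j3 ▸ ⟨hp, rfl⟩) with h | h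
    exacts [⟨_, h.1⟩, ⟨_, h.1⟩]
  · have hm : ω.vertex i ∈ ω.edge i := left_mem_segment ℝ _ _
    have hm' : ω.vertex (i + 1) ∈ ω.edge i := right_mem_segment ℝ _ _
    rw [i3, h] at hm hm'
    exact ω.vertex_ne i (Prod.ext (i1.trans i2.symm) (hm.2.trans hm'.2.symm))

/-! ### Points at which the region might be pinched -/

/-- If two opposite quadrants at a point are locally full and the other two contain no points of the
obstacle, then two edges would cross at the point. -/
theorem not_crossing {z : Plane}
    (h1 : FullQuadrant ω.region z 1 1) (h2 : FullQuadrant ω.region z (-1) (-1))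
    (hse : ∀ w ∈ ω.region, ¬ (z.1 < w.1 ∧ w.2 < z.2))
    (hnw : ∀ w ∈ ω.region, ¬ (w.1 < z.1 ∧ z.2 < w.2)) : False := by
  obtain ⟨δ1, p1, d1⟩ := vertical_mem_of_full ω.isClosed h1
  obtain ⟨δ2, p2, d2⟩ := vertical_mem_of_full ω.isClosed h2
  obtain ⟨δ3, p3, d3⟩ := horizontal_mem_of_full ω.isClosed h1
  obtain ⟨δ4, p4, d4⟩ := horizontal_mem_of_full ω.isClosed h2
  have m1 := d1 (δ1 / 2) (by linarith) (by linarith)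
  have m2 := d2 (δ2 / 2) (by linarith) (by linarith)
  have m3 := d3 (δ3 / 2) (by linarith) (by linarith)
  have m4 := d4 (δ4 / 2) (by linarith) (by linarith)
  have hf1 : ∀ y, ((z.1, y) : Plane) ∈ ω.region → (z.1, y) ∈ frontier ω.region := fun y hy => by
    refine ω.isClosed.frontier_eq ▸ ⟨hy, fun hi => ?_⟩
    rcases lt_or_ge z.2 y with k | k
    · obtain ⟨w, hw, i, j⟩ := Staircase.exists_top_of_interior hi
      exact hnw w hw ⟨i, k.trans j⟩
    · obtain ⟨w, hw, i, j⟩ := Staircase.exists_right_of_interior hi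
      exact hse w hw ⟨i, lt_of_lt_of_le j k⟩
  have hf2 : ∀ x, ((x, z.2) : Plane) ∈ ω.region → (x, z.2) ∈ frontier ω.region := fun x hx => by
    refine ω.isClosed.frontier_eq ▸ ⟨hx, fun hi => ?_⟩
    rcases lt_or_ge z.1 x with k | k
    · obtain ⟨w, hw, i, j⟩ := Staircase.exists_right_of_interior hi
      exact hse w hw ⟨k.trans i, j⟩
    · obtain ⟨w, hw, i, j⟩ := Staircase.exists_top_of_interior hi
      exact hnw w hw ⟨lt_of_lt_of_le i k, j⟩
  obtain ⟨i, i1, i2, i3⟩ := ω.exists_edge_of_vertical (x := z.1) (y₁ := z.2 + -1 * (δ2 / 2))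
    (y₂ := z.2 + 1 * (δ1 / 2)) (by linarith)
    fun y k1 k2 => hf1 y (ω.convex.mem_of_fst m2 m1 k1 k2)
  obtain ⟨j, j1, j2, j3⟩ := ω.exists_edge_of_horizontal (y := z.2) (x₁ := z.1 + -1 * (δ4 / 2))
    (x₂ := z.1 + 1 * (δ3 / 2)) (by linarith)
    fun x k1 k2 => hf2 x (ω.convex.mem_of_snd m4 m3 k1 k2)
  have hij : i ≠ j := by
    rintro rfl
    exact ω.vertex_ne i (Prod.ext (i1.trans i2.symm) (j1.trans j2.symm))
  have e1 := (fst_eq_of_mem_segment (i1.trans i2.symm) (i3 _ le_rfl (by linarith))).2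
  have e2 := (fst_eq_of_mem_segment (i1.trans i2.symm) (i3 _ (by linarith) le_rfl)).2
  simp only at e1 e2
  rcases ω.mem_edge_inter hij (z := z) (i3 _ (by linarith) (by linarith))
    (j3 _ (by linarith) (by linarith)) with ⟨h, -⟩ | ⟨h, -⟩
  · rw [← h] at e1 e2
    rcases e1 with e1 | e1 <;> rcases e2 with e2 | e2 <;> linarith
  · rw [← h] at e1 e2
    rcases e1 with e1 | e1 <;> rcases e2 with e2 | e2 <;> linarith

/-- If only the quadrants to the upper right (`σ = 1`) or lower left (`σ = -1`) of a point contain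
points of the obstacle nearby, then all of the obstacle is on one side of the point. -/
theorem not_one_sided {z : Plane} (hz : z ∈ ω.region) {σ : ℝ} (hσ : σ = 1 ∨ σ = -1)
    (hem : EmptyQuadrant ω.region z (-σ) (-σ))
    (h1 : EmptyQuadrant ω.region z σ (-σ)) (h2 : EmptyQuadrant ω.region z (-σ) σ)
    (hno : ∀ w ∈ ω.region, ¬ (σ * (w.1 - z.1) < 0 ∧ 0 < σ * (w.2 - z.2))) :
    ∀ w ∈ ω.region, 0 ≤ σ * (w.1 - z.1) := by
  intro w hw
  by_contra! hlt
  have hσσ : σ * σ = 1 := by rcases hσ with rfl | rfl <;> norm_num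
  have hσ0 : σ ≠ 0 := by rintro rfl; norm_num at hσσ
  have hle : σ * (w.2 - z.2) ≤ 0 := by
    by_contra! h
    exact hno w hw ⟨hlt, h⟩
  obtain ⟨δ1, p1, d1⟩ := hem
  obtain ⟨δ2, p2, d2⟩ := h1
  obtain ⟨δ3, p3, d3⟩ := h2
  -- the rays from `z` are not in the region, as the region is regular
  have hreg : ∀ v ∈ ω.region, ∀ ε > 0, ∃ u ∈ ω.region, (|u.1 - v.1| < ε ∧ |u.2 - v.2| < ε) ∧
      u.1 ≠ z.1 ∧ u.2 ≠ z.2 := by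
    intro v hv ε hε
    obtain ⟨s, t, hs, ht, δ, hδ0, hd⟩ := ω.exists_fullQuadrant hv
    obtain ⟨η, η0, η1, η2, η3, η4⟩ : ∃ η > 0, η < ε ∧ η < δ ∧ v.1 + s * η ≠ z.1 ∧
        v.2 + t * η ≠ z.2 := by
      have hfin : ({(z.1 - v.1) / s, (z.2 - v.2) / t} : Set ℝ).Finite := by simp
      obtain ⟨η, ⟨h1, h2⟩, h3⟩ := ((Set.Ioo_infinite (lt_min hε hδ0)).sdiff hfin).nonempty
      have hs0 : s ≠ 0 := by rcases hs with rfl | rfl <;> norm_num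
      have ht0 : t ≠ 0 := by rcases ht with rfl | rfl <;> norm_num
      refine ⟨η, h1, h2.trans_le (min_le_left _ _), h2.trans_le (min_le_right _ _),
        fun e => h3 (Or.inl ?_), fun e => h3 (Or.inr ?_)⟩
      · rw [← e]; field_simp; ring
      · rw [Set.mem_singleton_iff, ← e]; field_simp; ring
    refine ⟨_, hd η η η0 η2 η0 η2, ⟨?_, ?_⟩, η3, η4⟩
    · have : v.1 + s * η - v.1 = s * η := by ring
      rw [this, abs_mul, abs_of_pos η0]
      rcases hs with rfl | rfl <;> simpa using η1
    · have : v.2 + t * η - v.2 = t * η := by ring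
      rw [this, abs_mul, abs_of_pos η0]
      rcases ht with rfl | rfl <;> simpa using η1
  obtain ⟨P, hPW, hP, hwP, hzP, hb⟩ := ω.convex.exists_preconnected hw hz
  set δ := min δ1 (min δ2 δ3) with hδ
  have hδ0 : 0 < δ := lt_min p1 (lt_min p2 p3)
  have l1 : δ ≤ δ1 := min_le_left _ _
  have l2 : δ ≤ δ2 := (min_le_right _ _).trans (min_le_left _ _)
  have l3 : δ ≤ δ3 := (min_le_right _ _).trans (min_le_right _ _)
  -- a point of the path near `z`
  obtain ⟨v, hvP, hv⟩ : ∃ v ∈ P, l1Dist v z = min (δ / 2) (l1Dist w z) := by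
    have hc : ContinuousOn (fun v : Plane => l1Dist v z) P := by
      unfold l1Dist; fun_prop
    have := hP.intermediate_value hzP hwP hc
    refine this ⟨?_, min_le_right _ _⟩
    have h0 : l1Dist z z = 0 := by simp [l1Dist]
    rw [h0]
    refine le_min (by linarith) ?_
    unfold l1Dist; positivity
  have hwz : 0 < l1Dist w z := by
    unfold l1Dist
    have : 0 < |w.1 - z.1| := abs_pos.2 fun h => by rw [h] at hlt; simp at hlt
    positivity
  have hv0 : 0 < l1Dist v z := by rw [hv]; exact lt_min (by linarith) hwz
  have hv1 : l1Dist v z ≤ δ / 2 := by rw [hv]; exact min_le_left _ _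
  obtain ⟨⟨b1, b2⟩, b3, b4⟩ := hb v hvP
  have hv2 : σ * (v.1 - z.1) ≤ 0 ∧ σ * (v.2 - z.2) ≤ 0 := by
    rcases hσ with rfl | rfl
    · rw [max_eq_right (by linarith)] at b2 b4
      constructor <;> linarith
    · rw [min_eq_right (by linarith)] at b1 b3
      constructor <;> linarith
  have hav1 : |v.1 - z.1| = -(σ * (v.1 - z.1)) := by
    rw [← abs_of_nonpos hv2.1, abs_mul]
    rcases hσ with rfl | rfl <;> simp
  have hav2 : |v.2 - z.2| = -(σ * (v.2 - z.2)) := by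
    rw [← abs_of_nonpos hv2.2, abs_mul]
    rcases hσ with rfl | rfl <;> simp
  unfold l1Dist at hv0 hv1
  rw [hav1, hav2] at hv0 hv1
  obtain ⟨u, hu, ⟨u1, u2⟩, u3, u4⟩ := hreg v (hPW hvP)
    (min (δ / 2) (-(σ * (v.1 - z.1)) + -(σ * (v.2 - z.2))) / 2) (by
      have := lt_min (show 0 < δ / 2 by linarith) hv0
      linarith)
  have k1 := min_le_left (δ / 2) (-(σ * (v.1 - z.1)) + -(σ * (v.2 - z.2)))
  have k2 := min_le_right (δ / 2) (-(σ * (v.1 - z.1)) + -(σ * (v.2 - z.2)))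
  have hc1 : σ * (u.1 - z.1) ≠ 0 := mul_ne_zero hσ0 (sub_ne_zero.2 u3)
  have hc2 : σ * (u.2 - z.2) ≠ 0 := mul_ne_zero hσ0 (sub_ne_zero.2 u4)
  have hu1 : |σ * (u.1 - z.1) - σ * (v.1 - z.1)| <
      min (δ / 2) (-(σ * (v.1 - z.1)) + -(σ * (v.2 - z.2))) / 2 := by
    have : σ * (u.1 - z.1) - σ * (v.1 - z.1) = σ * (u.1 - v.1) := by ring
    rw [this, abs_mul]
    rcases hσ with rfl | rfl <;> simpa using u1
  have hu2 : |σ * (u.2 - z.2) - σ * (v.2 - z.2)| <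
      min (δ / 2) (-(σ * (v.1 - z.1)) + -(σ * (v.2 - z.2))) / 2 := by
    have : σ * (u.2 - z.2) - σ * (v.2 - z.2) = σ * (u.2 - v.2) := by ring
    rw [this, abs_mul]
    rcases hσ with rfl | rfl <;> simpa using u2
  rw [abs_lt] at hu1 hu2
  have hx : ∀ x : ℝ, -σ * (-(σ * x)) = x := fun x => by linear_combination x * hσσ
  have hx' : ∀ x : ℝ, σ * (σ * x) = x := fun x => by linear_combination x * hσσ
  rcases lt_or_gt_of_ne hc1 with q1 | q1 <;> rcases lt_or_gt_of_ne hc2 with q2 | q2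
  · refine d1 (-(σ * (u.1 - z.1))) (-(σ * (u.2 - z.2))) ?_ ?_ ?_ ?_ ?_ <;> try linarith
    rwa [hx, hx, add_sub_cancel, add_sub_cancel]
  · refine d3 (-(σ * (u.1 - z.1))) ((σ * (u.2 - z.2))) ?_ ?_ ?_ ?_ ?_ <;> try linarith
    rwa [hx, hx', add_sub_cancel, add_sub_cancel]
  · refine d2 ((σ * (u.1 - z.1))) (-(σ * (u.2 - z.2))) ?_ ?_ ?_ ?_ ?_ <;> try linarith
    rwa [hx, hx', add_sub_cancel, add_sub_cancel]
  · linarith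

/-- A point of an obstacle with points of the obstacle to its left and to its right has one to its
lower right or to its upper left. Otherwise either two edges cross at the point, or the obstacle is
on one side of it. -/
theorem not_pinched {z : Plane} (hz : z ∈ ω.region) (hl : ∃ w ∈ ω.region, w.1 < z.1)
    (hr : ∃ w ∈ ω.region, z.1 < w.1) :
    (∃ w ∈ ω.region, z.1 < w.1 ∧ w.2 < z.2) ∨ (∃ w ∈ ω.region, w.1 < z.1 ∧ z.2 < w.2) := by
  by_contra! hcon
  obtain ⟨hse, hnw⟩ := hcon
  have h1 : EmptyQuadrant ω.region z 1 (-1) :=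
    ⟨1, one_pos, fun s t s0 _ t0 _ hm => by
      have := hse _ hm (by simp only; linarith)
      simp only at this
      linarith⟩
  have h2 : EmptyQuadrant ω.region z (-1) 1 :=
    ⟨1, one_pos, fun s t s0 _ t0 _ hm => by
      have := hnw _ hm (by simp only; linarith)
      simp only at this
      linarith⟩
  obtain ⟨wl, hwl, hl⟩ := hl
  obtain ⟨wr, hwr, hr⟩ := hr
  rcases ω.quadrant_full_or_empty z one_ne_zero one_ne_zero with f1 | f1
  · rcases ω.quadrant_full_or_empty z (neg_ne_zero.2 one_ne_zero) (neg_ne_zero.2 one_ne_zero)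
      with f2 | f2
    · exact ω.not_crossing f1 f2 (fun w hw h => absurd h.2 (not_lt.2 (hse w hw h.1)))
        fun w hw h => absurd h.2 (not_lt.2 (hnw w hw h.1))
    · have := ω.not_one_sided hz (Or.inl rfl) f2 h1 h2 (fun w hw h => by
        have := hnw w hw (by linarith [h.1]); linarith [h.2]) wl hwl
      linarith
  · have := ω.not_one_sided hz (Or.inr rfl) (by simpa using f1) (by simpa using h2)
      (by simpa using h1) (fun w hw h => by
        have := hse w hw (by linarith [h.1]); linarith [h.2]) wr hwr
    linarith

/-! ### Partial staircases satisfy the conditions of `Staircase` -/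

/-- A vertical side of the bounding box meets the obstacle in an interval of positive length. -/
theorem side_interval_fst {a c z : Plane} (hbox : boundingBox ω.region = Set.Icc a c)
    (hac : ∀ w ∈ ω.region, (a.1 ≤ w.1 ∧ a.2 ≤ w.2) ∧ (w.1 ≤ c.1 ∧ w.2 ≤ c.2))
    (hz : z ∈ ω.region) (hzs : z.1 = a.1 ∨ z.1 = c.1) :
    ∃ y₁ y₂, y₁ < y₂ ∧ (z.1, y₁) ∈ ω.region ∧ (z.1, y₂) ∈ ω.region ∧
      ∀ w ∈ ω.region, w.1 = z.1 → y₁ ≤ w.2 ∧ w.2 ≤ y₂ := by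
  obtain ⟨i, h1, h2, h3, -⟩ := ω.isExtremeEdge_fst hbox hac hz hzs
  have hm : ω.vertex i ∈ ω.region := ω.edge_subset i (left_mem_segment ℝ _ _)
  have hm' : ω.vertex (i + 1) ∈ ω.region := ω.edge_subset i (right_mem_segment ℝ _ _)
  have hne : (ω.vertex i).2 ≠ (ω.vertex (i + 1)).2 :=
    fun e => ω.vertex_ne i (Prod.ext (h1.trans h2.symm) e)
  have key : ∀ w ∈ ω.region, w.1 = z.1 → _ := fun w hw e =>
    (fst_eq_of_mem_segment (h1.trans h2.symm) (show w ∈ ω.edge i from h3 ▸ ⟨hw, e⟩)).2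
  rw [← Prod.mk.eta (p := ω.vertex i), h1] at hm
  rw [← Prod.mk.eta (p := ω.vertex (i + 1)), h2] at hm'
  rcases lt_or_gt_of_ne hne with k | k
  · refine ⟨_, _, k, hm, hm', fun w hw e => ?_⟩
    rcases key w hw e with j | j
    · exact j
    · constructor <;> linarith
  · refine ⟨_, _, k, hm', hm, fun w hw e => ?_⟩
    rcases key w hw e with j | j
    · constructor <;> linarith
    · exact j

theorem side_interval_snd {a c z : Plane} (hbox : boundingBox ω.region = Set.Icc a c)
    (hac : ∀ w ∈ ω.region, (a.1 ≤ w.1 ∧ a.2 ≤ w.2) ∧ (w.1 ≤ c.1 ∧ w.2 ≤ c.2))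
    (hz : z ∈ ω.region) (hzs : z.2 = a.2 ∨ z.2 = c.2) :
    ∃ x₁ x₂, x₁ < x₂ ∧ (x₁, z.2) ∈ ω.region ∧ (x₂, z.2) ∈ ω.region ∧
      ∀ w ∈ ω.region, w.2 = z.2 → x₁ ≤ w.1 ∧ w.1 ≤ x₂ := by
  obtain ⟨i, h1, h2, h3, -⟩ := ω.isExtremeEdge_snd hbox hac hz hzs
  have hm : ω.vertex i ∈ ω.region := ω.edge_subset i (left_mem_segment ℝ _ _)
  have hm' : ω.vertex (i + 1) ∈ ω.region := ω.edge_subset i (right_mem_segment ℝ _ _)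
  have hne : (ω.vertex i).1 ≠ (ω.vertex (i + 1)).1 :=
    fun e => ω.vertex_ne i (Prod.ext e (h1.trans h2.symm))
  have key : ∀ w ∈ ω.region, w.2 = z.2 → _ := fun w hw e =>
    (snd_eq_of_mem_segment (h1.trans h2.symm) (show w ∈ ω.edge i from h3 ▸ ⟨hw, e⟩)).2
  rw [← Prod.mk.eta (p := ω.vertex i), h1] at hm
  rw [← Prod.mk.eta (p := ω.vertex (i + 1)), h2] at hm'
  rcases lt_or_gt_of_ne hne with k | k
  · refine ⟨_, _, k, hm, hm', fun w hw e => ?_⟩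
    rcases key w hw e with j | j
    · exact j
    · constructor <;> linarith
  · refine ⟨_, _, k, hm', hm, fun w hw e => ?_⟩
    rcases key w hw e with j | j
    · constructor <;> linarith
    · exact j

/-- Two boundary segments on a vertical line are part of the same edge. -/
theorem vertical_frontier {x y₁ y₂ y₃ y₄ : ℝ} (h12 : y₁ < y₂) (h34 : y₃ < y₄)
    (h1 : ∀ y, y₁ ≤ y → y ≤ y₂ → (x, y) ∈ frontier ω.region)
    (h2 : ∀ y, y₃ ≤ y → y ≤ y₄ → (x, y) ∈ frontier ω.region) :
    ∀ y, y₁ ≤ y → y ≤ y₄ → (x, y) ∈ frontier ω.region := by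
  obtain ⟨i, i1, i2, i3⟩ := ω.exists_edge_of_vertical h12 h1
  obtain ⟨j, j1, j2, j3⟩ := ω.exists_edge_of_vertical h34 h2
  obtain rfl := ω.eq_of_fst i1 i2 j1 j2
  intro y k1 k2
  exact ω.edge_subset_frontier i ((convex_segment _ _).segment_subset (i3 _ le_rfl h12.le)
    (j3 _ h34.le le_rfl) (mem_segment_of_fst_eq rfl rfl (Or.inl ⟨k1, k2⟩)))

theorem horizontal_frontier {y x₁ x₂ x₃ x₄ : ℝ} (h12 : x₁ < x₂) (h34 : x₃ < x₄)
    (h1 : ∀ x, x₁ ≤ x → x ≤ x₂ → (x, y) ∈ frontier ω.region)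
    (h2 : ∀ x, x₃ ≤ x → x ≤ x₄ → (x, y) ∈ frontier ω.region) :
    ∀ x, x₁ ≤ x → x ≤ x₄ → (x, y) ∈ frontier ω.region := by
  obtain ⟨i, i1, i2, i3⟩ := ω.exists_edge_of_horizontal h12 h1
  obtain ⟨j, j1, j2, j3⟩ := ω.exists_edge_of_horizontal h34 h2
  obtain rfl := ω.eq_of_snd i1 i2 j1 j2
  intro y k1 k2
  exact ω.edge_subset_frontier i ((convex_segment _ _).segment_subset (i3 _ le_rfl h12.le)
    (j3 _ h34.le le_rfl) (mem_segment_of_snd_eq rfl rfl (Or.inl ⟨k1, k2⟩)))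

/-- A partial staircase whose extreme corner is at the top right satisfies the conditions of
`Staircase`. -/
theorem IsPartialStaircase.exists_staircase {ω : Obstacle} {c : Plane}
    (hω : ω.IsPartialStaircase c) (hc : ∀ w ∈ ω.region, w.1 ≤ c.1 ∧ w.2 ≤ c.2) :
    ∃ a lo hi en, Staircase ω.region a c lo hi en ∧ boundingBox ω.region = Set.Icc a c := by
  obtain ⟨a, c', hbox, hac, ⟨wl, hwl, el⟩, ⟨wb, hwb, eb⟩, ⟨wr, hwr, er⟩, wt, hwt, et⟩ :=
    ω.exists_boundingBox
  have hcW : c ∈ ω.region := by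
    obtain ⟨⟨i, rfl⟩, -⟩ := hω.1
    exact ω.edge_subset i (left_mem_segment ℝ _ _)
  have hcc : c' = c := Prod.ext (le_antisymm (er ▸ (hc wr hwr).1) (hac c hcW).2.1)
    (le_antisymm (et ▸ (hc wt hwt).2) (hac c hcW).2.2)
  subst hcc
  have hcor : ∀ p ∈ ω.region, (p.1 = a.1 ∨ p.1 = c'.1) → (p.2 = a.2 ∨ p.2 = c'.2) → p = c' :=
    fun p hp h1 h2 => hω.2 p (ω.isExtremeCorner hbox hac hp h1 h2)
  obtain ⟨l₁, l₂, l12, l1, l2, l⟩ := ω.side_interval_fst hbox hac hwl (Or.inl el)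
  obtain ⟨b₁, b₂, b12, b1, b2, b⟩ := ω.side_interval_snd hbox hac hwb (Or.inl eb)
  obtain ⟨r₁, r₂, r12, r1, -, r⟩ := ω.side_interval_fst hbox hac hcW (Or.inr rfl)
  obtain ⟨t₁, t₂, t12, t1, -, t⟩ := ω.side_interval_snd hbox hac hcW (Or.inr rfl)
  have hrt := (hac _ r1).1.2
  have htt := (hac _ t1).1.1
  have hr2 : r₁ < c'.2 := by
    refine lt_of_le_of_ne (r c' hcW rfl).1 fun e => ?_
    obtain ⟨y₁, y₂, y12, m1, m2, -⟩ := ω.side_interval_fst hbox hac hcW (Or.inr rfl)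
    have k1 := (r _ m1 rfl).1
    have k2 := (hac _ m2).2.2
    simp only at k1 k2
    linarith
  have ht2 : t₁ < c'.1 := by
    refine lt_of_le_of_ne (t c' hcW rfl).1 fun e => ?_
    obtain ⟨y₁, y₂, y12, m1, m2, -⟩ := ω.side_interval_snd hbox hac hcW (Or.inr rfl)
    have k1 := (t _ m1 rfl).1
    have k2 := (hac _ m2).2.1
    simp only at k1 k2
    linarith
  simp only at hrt htt
  have ha1 : a.1 < c'.1 := by linarith
  have ha2 : a.2 < c'.2 := by linarith
  rw [el] at l1 l2 l
  rw [eb] at b1 b2 b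
  refine ⟨a, (b₁, l₁), (b₂, l₂), (t₁, r₁), ?_, hbox⟩
  exact
    { isCompact := ω.isCompact
      ge := fun w hw => (hac w hw).1
      le := fun w hw => (hac w hw).2
      corner := hcW
      not_corner := fun h => ha1.ne (congrArg Prod.fst (hcor a h (Or.inl rfl) (Or.inl rfl)))
      quadrants := ω.convex.mem_of_quadrants
      left_lo := l1
      left_hi := l2
      left_lt := l12
      left := l
      bot_lo := b1
      bot_hi := b2
      bot_lt := b12
      bot := b
      hi_lt_fst := lt_of_le_of_ne (hac _ b2).2.1 fun e => by
        have := hcor _ b2 (Or.inr e) (Or.inl rfl)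
        exact ha2.ne (show ((b₂, a.2) : Plane).2 = c'.2 by rw [this])
      hi_lt_snd := lt_of_le_of_ne (hac _ l2).2.2 fun e => by
        have := hcor _ l2 (Or.inl rfl) (Or.inr e)
        exact ha1.ne (show ((a.1, l₂) : Plane).1 = c'.1 by rw [this])
      top := t1
      top_lt := ht2
      right := r1
      right_lt := hr2
      not_pinched := fun z hz h1 h2 _ _ => ω.not_pinched hz ⟨wl, hwl, el ▸ h1⟩ ⟨c', hcW, h2⟩
      localQuadrant := fun z => by
        rcases ω.quadrant_full_or_empty z one_ne_zero one_ne_zero with h | h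
        · obtain ⟨δ, h0, hd⟩ := h
          refine ⟨δ, h0, Or.inl fun w i1 i2 j1 j2 => ?_⟩
          have := hd (w.1 - z.1) (w.2 - z.2) (by linarith) (by linarith) (by linarith) (by linarith)
          rwa [one_mul, one_mul, add_sub_cancel, add_sub_cancel] at this
        · obtain ⟨δ, h0, hd⟩ := h
          refine ⟨δ, h0, Or.inr fun w i1 i2 j1 j2 => ?_⟩
          have := hd (w.1 - z.1) (w.2 - z.2) (by linarith) (by linarith) (by linarith) (by linarith)
          rwa [one_mul, one_mul, add_sub_cancel, add_sub_cancel] at this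
      vertical_edge := fun x y₁ y₂ y₃ y₄ h12 h34 h1 h2 => ω.vertical_frontier h12 h34 h1 h2
      horizontal_edge := fun y x₁ x₂ x₃ x₄ h12 h34 h1 h2 => ω.horizontal_frontier h12 h34 h1 h2 }

/-- The ray to the right of an interior point leaves the obstacle at the abscissa of a vertex,
unless it does so at the height of one. -/
theorem exists_vertex_fst {z : Plane} (hz : z ∈ interior ω.region)
    (hv : ∀ i, (ω.vertex i).2 ≠ z.2) :
    ∃ i, z.1 < (ω.vertex i).1 ∧ segment ℝ z ((ω.vertex i).1, z.2) ⊆ ω.region := by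
  have hzW := interior_subset hz
  have hcomp : IsCompact (ω.region ∩ {w | w.2 = z.2}) :=
    ω.isCompact.inter_right (isClosed_eq continuous_snd continuous_const)
  obtain ⟨w, ⟨hw, hw2⟩, hmax⟩ := hcomp.exists_isMaxOn ⟨z, hzW, rfl⟩ continuous_fst.continuousOn
  have hright : ∀ p ∈ interior ω.region, p.2 = z.2 → p.1 < w.1 := by
    intro p hp e
    obtain ⟨ε, ε0, hε⟩ := Staircase.exists_of_mem_interior hp
    have := hmax (show _ ∈ ω.region ∩ {w | w.2 = z.2} from
      ⟨hε (ε / 2) 0 (by rw [abs_of_pos] <;> linarith) (by simpa using ε0), by simpa using e⟩)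
    have : p.1 + ε / 2 ≤ w.1 := this
    linarith
  have hwf : w ∈ frontier ω.region :=
    ω.isClosed.frontier_eq ▸ ⟨hw, fun hi => lt_irrefl _ (hright w hi hw2)⟩
  rw [ω.boundary_eq, Set.mem_iUnion] at hwf
  obtain ⟨i, hi⟩ := hwf
  have hi1 : w.1 = (ω.vertex i).1 := by
    rcases ω.rectilinear i with hr | hr
    · exact (fst_eq_of_mem_segment hr hi).1.trans hr.symm
    · have := (snd_eq_of_mem_segment hr hi).1
      exact absurd (hr.trans (this.symm.trans hw2)) (hv i)
  refine ⟨i, hi1 ▸ hright z hz rfl, ?_⟩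
  rw [← hi1]
  intro p hp
  obtain ⟨e, k⟩ := snd_eq_of_mem_segment (p := z) (z := (w.1, z.2)) rfl hp
  have hlt := hright z hz rfl
  have hwW : ((w.1, z.2) : Plane) ∈ ω.region := by
    have : w.2 = z.2 := hw2
    rw [← this]; exact hw
  simp only at e k
  have : ((p.1, z.2) : Plane) ∈ ω.region := by
    rcases k with ⟨k1, k2⟩ | ⟨k1, k2⟩
    · exact ω.convex.mem_of_snd hzW hwW k1 k2
    · linarith
  rwa [← e] at this

end Obstacle

/-! ### The frontier of a linked set -/

/-- A linked set spans its box. -/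
theorem Linked.boundingBox_eq {W : Set Plane} {a K : Plane} {S : Set (Set Plane)}
    (h : Linked W a K S) (hge : ∀ w ∈ W, a.1 ≤ w.1 ∧ a.2 ≤ w.2) (h1 : a.1 ≤ K.1) (h2 : a.2 ≤ K.2) :
    boundingBox (⋃₀ S) = Set.Icc a K := by
  have hU : ∀ w ∈ ⋃₀ S, (a.1 ≤ w.1 ∧ a.2 ≤ w.2) ∧ (w.1 ≤ K.1 ∧ w.2 ≤ K.2) := by
    rintro w ⟨s, hs, hw⟩
    exact ⟨hge w (h.subset s hs hw), h.le s hs w hw⟩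
  have hx : ∀ x, a.1 ≤ x → x ≤ K.1 → x ∈ Prod.fst '' ⋃₀ S := fun x i j => by
    obtain ⟨s, hs, w, hw, e⟩ := h.cover_fst x i j
    exact ⟨w, ⟨s, hs, hw⟩, e⟩
  have hy : ∀ y, a.2 ≤ y → y ≤ K.2 → y ∈ Prod.snd '' ⋃₀ S := fun x i j => by
    obtain ⟨s, hs, w, hw, e⟩ := h.cover_snd x i j
    exact ⟨w, ⟨s, hs, hw⟩, e⟩
  have e1 : sInf (Prod.fst '' ⋃₀ S) = a.1 := IsLeast.csInf_eq ⟨hx _ le_rfl h1, by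
    rintro _ ⟨w, hw, rfl⟩; exact (hU w hw).1.1⟩
  have e2 : sInf (Prod.snd '' ⋃₀ S) = a.2 := IsLeast.csInf_eq ⟨hy _ le_rfl h2, by
    rintro _ ⟨w, hw, rfl⟩; exact (hU w hw).1.2⟩
  have e3 : sSup (Prod.fst '' ⋃₀ S) = K.1 := IsGreatest.csSup_eq ⟨hx _ h1 le_rfl, by
    rintro _ ⟨w, hw, rfl⟩; exact (hU w hw).2.1⟩
  have e4 : sSup (Prod.snd '' ⋃₀ S) = K.2 := IsGreatest.csSup_eq ⟨hy _ h2 le_rfl, by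
    rintro _ ⟨w, hw, rfl⟩; exact (hU w hw).2.2⟩
  rw [boundingBox, e1, e2, e3, e4]

theorem lexLe_of_advancesHV {c v w : Plane} (hv : v.1 ≤ c.1 ∧ v.2 ≤ c.2)
    (hw : w.1 ≤ c.1 ∧ w.2 ≤ c.2) : AdvancesHV c v w ↔ LexLe w v := by
  unfold AdvancesHV LexLe
  rw [abs_of_nonpos (sub_nonpos.2 hv.1), abs_of_nonpos (sub_nonpos.2 hv.2),
    abs_of_nonpos (sub_nonpos.2 hw.1), abs_of_nonpos (sub_nonpos.2 hw.2)]
  constructor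
  · rintro (i | ⟨i, j⟩)
    · left; linarith
    · right; constructor <;> linarith
  · rintro (i | ⟨i, j⟩)
    · left; linarith
    · right; constructor <;> linarith

theorem lexLe_of_advancesVH {c v w : Plane} (hv : v.1 ≤ c.1 ∧ v.2 ≤ c.2)
    (hw : w.1 ≤ c.1 ∧ w.2 ≤ c.2) : AdvancesVH c v w ↔ LexLe w.swap v.swap :=
  lexLe_of_advancesHV (c := c.swap) (v := v.swap) (w := w.swap) hv.symm hw.symm

theorem meetsMaximal_swap {W f : Set Plane} {u v : Plane} :
    MeetsMaximal (Prod.swap '' W) (Prod.swap '' f) u.swap v.swap ↔ MeetsMaximal W f u v := by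
  unfold MeetsMaximal
  rw [maximalSegment_swap, segment_swap, ← Set.image_inter Prod.swap_injective,
    Set.image_nonempty]

namespace Staircase

variable {W : Set Plane} {a c lo hi en K : Plane} {S : Set (Set Plane)}

theorem frontier_box_inter (h : Staircase W a c lo hi en) :
    frontier (Set.Icc a K) ∩ interior W = frontierSet W K := by
  ext z
  simp only [Set.mem_inter_iff, mem_frontier_Icc, frontierSet, Set.mem_ofPred_eq, Set.mem_Icc,
    Prod.le_def]
  constructor
  · rintro ⟨⟨⟨-, i, j⟩, hz⟩, hzi⟩
    have hlt := h.interior_lt hzi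
    refine ⟨hzi, ?_⟩
    rcases i.lt_or_eq with i' | i'
    · rcases j.lt_or_eq with j' | j'
      · exact absurd ⟨⟨hlt.1, i'⟩, hlt.2.2.1, j'⟩ hz
      · exact Or.inr ⟨j', i⟩
    · exact Or.inl ⟨i', j⟩
  · rintro ⟨hzi, hz⟩
    have hlt := h.interior_lt hzi
    refine ⟨⟨⟨⟨hlt.1.le, hlt.2.2.1.le⟩, ?_⟩, ?_⟩, hzi⟩
    · rcases hz with ⟨i, j⟩ | ⟨i, j⟩
      · exact ⟨i.le, j⟩
      · exact ⟨j, i.le⟩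
    · rintro ⟨⟨-, i⟩, -, j⟩
      rcases hz with ⟨e, -⟩ | ⟨e, -⟩
      · exact i.ne e
      · exact j.ne e

/-- If the frontier has a part on the right side of the covered box, then it is not horizontal. -/
theorem not_isHorizontal {z : Plane} (hz : z ∈ interior W) (h1 : z.1 = K.1) (h2 : z.2 ≤ K.2) :
    ¬ IsHorizontal (closure (frontierSet W K)) := by
  rintro ⟨y, hy⟩
  obtain ⟨r, r0, hr⟩ := Metric.isOpen_iff.1 isOpen_interior z hz
  have hm : ((z.1, z.2 - r / 2) : Plane) ∈ interior W := by
    apply hr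
    rw [Metric.mem_ball, Prod.dist_eq, max_lt_iff]
    simp [r0, abs_of_pos r0]
  have e1 := hy z (subset_closure ⟨hz, Or.inl ⟨h1, h2⟩⟩)
  have e2 := hy _ (subset_closure ⟨hm, Or.inl ⟨h1, by simp only; linarith⟩⟩)
  simp only at e2
  linarith

theorem exists_right_of_not_isHorizontal (hf : ¬ IsHorizontal (closure (frontierSet W K))) :
    ∃ z ∈ interior W, z.1 = K.1 ∧ z.2 ≤ K.2 := by
  by_contra! hcon
  refine hf ⟨K.2, fun p hp => ?_⟩
  have hcl : IsClosed {p : Plane | p.2 = K.2} := isClosed_eq continuous_snd continuous_const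
  refine closure_minimal ?_ hcl hp
  rintro z ⟨hz, ⟨i, j⟩ | ⟨i, j⟩⟩
  · exact absurd j (not_le.2 (hcon z hz i))
  · exact i

theorem isHorizontal_swap {A : Set Plane} : IsHorizontal (Prod.swap '' A) ↔ IsVertical A := by
  simp only [IsVertical, IsHorizontal, Set.forall_mem_image, Prod.snd_swap]

theorem closure_frontierSet_swap :
    closure (frontierSet (Prod.swap '' W) K.swap) = Prod.swap '' closure (frontierSet W K) := by
  rw [frontierSet_swap, closure_swap_image]

end Staircase

namespace Obstacle

variable {ω : Obstacle} {a c lo hi en K : Plane} {S : Set (Set Plane)}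

/-- The frontier of a linked set with covered box `[a, K]` is the closure of `frontierSet`, which is
connected and, if `K ≠ c`, not empty. -/
theorem isFrontier_iff (h : Staircase ω.region a c lo hi en) (hS : Linked ω.region a K S)
    (hK : IsCovered ω.region hi K) {f : Set Plane} :
    ω.IsFrontier S f ↔ K ≠ c ∧ f = closure (frontierSet ω.region K) := by
  have hlt := h.a_lt_covered hK
  unfold IsFrontier
  rw [hS.boundingBox_eq h.ge hlt.1.le hlt.2.le, h.frontier_box_inter]
  have hcc : ∀ p ∈ frontierSet ω.region K,
      connectedComponentIn (frontierSet ω.region K) p = frontierSet ω.region K :=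
    fun p hp => (h.isPreconnected_frontierSet hK).connectedComponentIn hp
  constructor
  · rintro ⟨p, hp, rfl⟩
    exact ⟨h.ne_corner_of_nonempty ⟨p, hp⟩, by rw [hcc p hp]⟩
  · rintro ⟨hc, rfl⟩
    obtain ⟨p, hp⟩ := h.frontierSet_nonempty hK hc
    exact ⟨p, hp, by rw [hcc p hp]⟩

/-- A horizontally most advanced segment that meets the frontier passes the abscissa of a vertex. -/
theorem advance_right (h : Staircase ω.region a c lo hi en) (hK : IsCovered ω.region hi K)
    (hc : K ≠ c) (hf : ¬ IsHorizontal (closure (frontierSet ω.region K))) {u v : Plane}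
    (huv : MeetsMaximal ω.region (closure (frontierSet ω.region K)) u v)
    (hmax : ∀ u' v', MeetsMaximal ω.region (closure (frontierSet ω.region K)) u' v' → LexLe v' v) :
    Advance ω.region hi K u v ∧ ∃ i, K.1 < (ω.vertex i).1 ∧ (ω.vertex i).1 ≤ v.1 := by
  have hR := Staircase.exists_right_of_not_isHorizontal hf
  obtain ⟨hA, hle⟩ := h.advance_right hK hc hR huv hmax
  refine ⟨hA, ?_⟩
  obtain ⟨z, hz, h1, h2⟩ := hR
  obtain ⟨r, r0, hr⟩ := Metric.isOpen_iff.1 isOpen_interior z hz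
  -- choose a height at which there is no vertex
  obtain ⟨y, ⟨y1, y2⟩, hy⟩ := ((Set.Ioo_infinite (show z.2 - r < z.2 by linarith)).sdiff
    (Set.finite_range fun i => (ω.vertex i).2)).nonempty
  have hm : ((z.1, y) : Plane) ∈ interior ω.region := by
    apply hr
    rw [Metric.mem_ball, Prod.dist_eq, max_lt_iff, Real.dist_eq, Real.dist_eq, abs_lt, abs_lt]
    constructor <;> constructor <;> simp only <;> linarith
  obtain ⟨i, i1, i2⟩ := ω.exists_vertex_fst hm fun i e => hy ⟨i, e⟩
  simp only at i1 i2
  rw [h1] at i1 i2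
  exact ⟨i, i1, hle ((ω.vertex i).1, y) (i2 (right_mem_segment ℝ _ _)) (y2.le.trans h2) i2⟩

theorem advance_top (h : Staircase ω.region a c lo hi en) (hK : IsCovered ω.region hi K)
    (hc : K ≠ c) (hf : ¬ IsVertical (closure (frontierSet ω.region K))) {u v : Plane}
    (huv : MeetsMaximal ω.region (closure (frontierSet ω.region K)) u v)
    (hmax : ∀ u' v', MeetsMaximal ω.region (closure (frontierSet ω.region K)) u' v' →
      LexLe v'.swap v.swap) :
    Advance ω.region hi K u v ∧ ∃ i, K.2 < (ω.vertex i).2 ∧ (ω.vertex i).2 ≤ v.2 := by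
  obtain ⟨hA, i, i1, i2⟩ := advance_right (ω := ω.swap) (K := K.swap) (u := u.swap) (v := v.swap)
    h.swap hK.swap (fun e => hc (Prod.swap_injective e))
    (by rwa [swap_region, Staircase.closure_frontierSet_swap, Staircase.isHorizontal_swap])
    (by rwa [swap_region, Staircase.closure_frontierSet_swap, meetsMaximal_swap])
    (fun u' v' hm => by
      rw [swap_region, Staircase.closure_frontierSet_swap, ← u'.swap_swap, ← v'.swap_swap,
        meetsMaximal_swap] at hm
      exact hmax _ _ hm)
  refine ⟨?_, i, i1, i2⟩
  have := hA.swap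
  rwa [swap_region, swap_image_swap_image] at this

/-- Every maximal frontier visibility edge advances the covered box, beyond some vertex. -/
theorem IsMaximalFrontierEdge.advance (h : Staircase ω.region a c lo hi en)
    (hK : IsCovered ω.region hi K) (hc : K ≠ c) {s : Set Plane}
    (hs : ω.IsMaximalFrontierEdge c (closure (frontierSet ω.region K)) s) :
    ∃ u v, s = segment ℝ u v ∧ Advance ω.region hi K u v ∧
      ∃ i, (K.1 < (ω.vertex i).1 ∧ (ω.vertex i).1 ≤ v.1) ∨
        (K.2 < (ω.vertex i).2 ∧ (ω.vertex i).2 ≤ v.2) := by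
  obtain ⟨u, v, rfl, huv, hcase⟩ := hs
  have hle : ∀ u' v', ω.IsFrontierEdge (closure (frontierSet ω.region K)) u' v' →
      v'.1 ≤ c.1 ∧ v'.2 ≤ c.2 := fun u' v' h' => h.le v' (h'.1.2.1 (right_mem_segment ℝ u' v'))
  refine ⟨u, v, rfl, ?_⟩
  rcases hcase with ⟨hf, hmax⟩ | ⟨hf, hmax⟩
  · obtain ⟨hA, i, hi⟩ := advance_right h hK hc hf huv fun u' v' h' =>
      (lexLe_of_advancesHV (hle u v huv) (hle u' v' h')).1 (hmax u' v' h')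
    exact ⟨hA, i, Or.inl hi⟩
  · obtain ⟨hA, i, hi⟩ := advance_top h hK hc hf huv fun u' v' h' =>
      (lexLe_of_advancesVH (hle u v huv) (hle u' v' h')).1 (hmax u' v' h')
    exact ⟨hA, i, Or.inr hi⟩

theorem exists_isMaximalFrontierEdge (h : Staircase ω.region a c lo hi en)
    (hK : IsCovered ω.region hi K) (hc : K ≠ c) :
    ∃ s, ω.IsMaximalFrontierEdge c (closure (frontierSet ω.region K)) s := by
  obtain ⟨z, hz, ⟨h1, h2⟩ | ⟨h1, h2⟩⟩ := h.frontierSet_nonempty hK hc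
  · obtain ⟨u, v, huv, hmax⟩ := h.exists_right_edge (K := K) ⟨z, hz, h1, h2⟩
    refine ⟨_, u, v, rfl, huv, Or.inl ⟨Staircase.not_isHorizontal hz h1 h2, fun u' v' h' => ?_⟩⟩
    exact (lexLe_of_advancesHV (h.le v (huv.1.2.1 (right_mem_segment ℝ u v)))
      (h.le v' (h'.1.2.1 (right_mem_segment ℝ u' v')))).2 (hmax u' v' h')
  · have hz' : z.swap ∈ interior (Prod.swap '' ω.region) := by
      rwa [interior_swap_image, swap_image_mem]
    obtain ⟨u, v, huv, hmax⟩ := h.swap.exists_right_edge (K := K.swap) ⟨z.swap, hz', h1, h2⟩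
    have hnv := Staircase.not_isHorizontal (K := K.swap) hz' h1 h2
    rw [Staircase.closure_frontierSet_swap] at huv hmax hnv
    rw [Staircase.isHorizontal_swap] at hnv
    rw [← u.swap_swap, ← v.swap_swap, meetsMaximal_swap] at huv
    refine ⟨_, u.swap, v.swap, rfl, huv, Or.inr ⟨hnv, fun u' v' h' => ?_⟩⟩
    refine (lexLe_of_advancesVH (h.le _ (huv.1.2.1 (right_mem_segment ℝ _ _)))
      (h.le v' (h'.1.2.1 (right_mem_segment ℝ u' v')))).2 ?_
    exact hmax _ _ (meetsMaximal_swap.2 h')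

/-! ### The loop -/

/-- The number of vertices to the right of, and of those above, the covered box. -/
noncomputable def potential (ω : Obstacle) (K : Plane) : ℕ :=
  {i | K.1 < (ω.vertex i).1}.ncard + {i | K.2 < (ω.vertex i).2}.ncard

/-- Moving the corner of the covered box past a vertex lowers the potential. -/
theorem potential_lt {v : Plane} (h1 : K.1 ≤ v.1) (h2 : K.2 ≤ v.2)
    (h : ∃ i, (K.1 < (ω.vertex i).1 ∧ (ω.vertex i).1 ≤ v.1) ∨
      (K.2 < (ω.vertex i).2 ∧ (ω.vertex i).2 ≤ v.2)) : ω.potential v < ω.potential K := by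
  have hsub1 : {i | v.1 < (ω.vertex i).1} ⊆ {i | K.1 < (ω.vertex i).1} :=
    fun i hi => lt_of_le_of_lt h1 hi
  have hsub2 : {i | v.2 < (ω.vertex i).2} ⊆ {i | K.2 < (ω.vertex i).2} :=
    fun i hi => lt_of_le_of_lt h2 hi
  obtain ⟨i, ⟨i1, i2⟩ | ⟨i1, i2⟩⟩ := h
  · refine add_lt_add_of_lt_of_le (Set.ncard_lt_ncard ?_ (Set.toFinite _))
      (Set.ncard_le_ncard hsub2 (Set.toFinite _))
    exact (Set.ssubset_iff_of_subset hsub1).2 ⟨i, i1, not_lt.2 i2⟩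
  · refine add_lt_add_of_le_of_lt (Set.ncard_le_ncard hsub1 (Set.toFinite _))
      (Set.ncard_lt_ncard ?_ (Set.toFinite _))
    exact (Set.ssubset_iff_of_subset hsub2).2 ⟨i, i1, not_lt.2 i2⟩

/-- The invariant of the loop: the segments are linked and span the box with corner `K`, and every
skeleton has more segments that meet this box. -/
structure Invariant (ω : Obstacle) (a c hi K : Plane) (S : Set (Set Plane)) : Prop where
  linked : Linked ω.region a K S
  covered : IsCovered ω.region hi K
  ne : K ≠ c
  lower : ∀ S', IsSkeletonOf ω.region S' → S'.Finite → S.encard + 1 ≤ (meeting S' K).encard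

/-- The states that satisfy the invariant, with a number that decreases at every step. -/
def Good (ω : Obstacle) (a c hi : Plane) : State → ℕ → Prop
  | .halt S, m => ω.IsMinimumSkeleton S ∧ m = 0
  | .advance S, m => ∃ K, ω.Invariant a c hi K S ∧ m = 2 * ω.potential K + 1
  | .loop S f, m => ∃ K, ω.Invariant a c hi K S ∧ f = closure (frontierSet ω.region K) ∧
      m = 2 * ω.potential K

theorem isMinimumSkeleton (h : Staircase ω.region a c lo hi en) (hS : Linked ω.region a c S)
    (hmin : ∀ S', IsSkeletonOf ω.region S' → S'.Finite → S.encard ≤ S'.encard) :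
    ω.IsMinimumSkeleton S := by
  refine ⟨h.isSkeletonOf_of_linked hS, fun S' hS' => ?_⟩
  by_cases hfin : S'.Finite
  · exact hmin S' hS' hfin
  · rw [Set.Infinite.encard_eq hfin]
    exact le_top

/-- Every step of the loop keeps the invariant. -/
theorem Good.step (h : Staircase ω.region a c lo hi en) {σ σ' : State} {m : ℕ}
    (hσ : ω.Good a c hi σ m) (hs : ω.StaircaseStep c σ σ') : ∃ m' < m, ω.Good a c hi σ' m' := by
  cases hs with
  | finish S f s hs hc =>
    obtain ⟨K, hI, rfl, rfl⟩ := hσ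
    obtain ⟨u, v, rfl, hA, hv⟩ := hs.advance h hI.covered hI.ne
    have hlt := potential_lt hA.upper.1 hA.upper.2 hv
    obtain ⟨z, hz, hzc⟩ := hc
    obtain rfl : z = c := hzc
    -- the corner is on the new segment only if it is its end
    have hvc : v = z := by
      have h1 := h.le v hA.covered.mem
      have h2 := hA.dominates u z hA.lower (((convex_segment u v).segment_subset
        (left_mem_segment ℝ u v) hz).trans hA.maximal.2.1)
      exact Prod.ext (le_antisymm h1.1 h2.1) (le_antisymm h1.2 h2.2)
    subst hvc
    refine ⟨0, by omega, isMinimumSkeleton h (hI.linked.advance h hI.covered hA)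
      fun S' hS' hfin => ?_, rfl⟩
    calc (insert (segment ℝ u v) S).encard ≤ S.encard + 1 := Set.encard_insert_le _ _
      _ ≤ (meeting S' K).encard := hI.lower S' hS' hfin
      _ ≤ S'.encard := Set.encard_le_encard fun t ht => ht.1
  | add S f s hs hc =>
    obtain ⟨K, hI, rfl, rfl⟩ := hσ
    obtain ⟨u, v, rfl, hA, hv⟩ := hs.advance h hI.covered hI.ne
    have hlt := potential_lt hA.upper.1 hA.upper.2 hv
    have hvc : v ≠ c := fun e => hc ⟨c, e ▸ right_mem_segment ℝ u v, rfl⟩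
    refine ⟨2 * ω.potential v + 1, by omega, v, ⟨hI.linked.advance h hI.covered hA, hA.covered, hvc,
      fun S' hS' hfin => ?_⟩, rfl⟩
    calc (insert (segment ℝ u v) S).encard + 1 ≤ (S.encard + 1) + 1 :=
          add_le_add_left (Set.encard_insert_le _ _) 1
      _ ≤ (meeting S' K).encard + 1 := add_le_add_left (hI.lower S' hS' hfin) 1
      _ ≤ (inside S' v).encard + 1 :=
        add_le_add_left (Set.encard_le_encard (hA.meeting_subset hS')) 1
      _ ≤ (meeting S' v).encard := h.encard_inside_add_one_le hS' hfin hA.covered hvc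
  | newFrontier S f hf =>
    obtain ⟨K, hI, rfl⟩ := hσ
    rw [isFrontier_iff h hI.linked hI.covered] at hf
    exact ⟨2 * ω.potential K, by omega, K, hI, hf.2, rfl⟩

/-- The loop does not get stuck: there is always a frontier and a maximal frontier visibility edge.
-/
theorem Good.progress (h : Staircase ω.region a c lo hi en) {σ : State} {m : ℕ}
    (hσ : ω.Good a c hi σ m) : (∃ S, σ = .halt S) ∨ ∃ σ', ω.StaircaseStep c σ σ' := by
  cases σ with
  | halt S => exact Or.inl ⟨S, rfl⟩
  | advance S =>
    obtain ⟨K, hI, -⟩ := hσ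
    exact Or.inr ⟨_, .newFrontier S _ ((isFrontier_iff h hI.linked hI.covered).2 ⟨hI.ne, rfl⟩)⟩
  | loop S f =>
    obtain ⟨K, hI, rfl, -⟩ := hσ
    obtain ⟨s, hs⟩ := exists_isMaximalFrontierEdge h hI.covered hI.ne
    by_cases hc : (s ∩ {c}).Nonempty
    · exact Or.inr ⟨_, .finish S _ s hs hc⟩
    · exact Or.inr ⟨_, .add S _ s hs hc⟩

/-! ### The start -/

/-- The edge at the left side of the bounding box. -/
def leftEdge (ω : Obstacle) (a : Plane) : Set Plane := {w ∈ ω.region | w.1 = a.1}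

/-- The edge at the bottom of the bounding box. -/
def bottomEdge (ω : Obstacle) (a : Plane) : Set Plane := {w ∈ ω.region | w.2 = a.2}

theorem not_isHorizontal_of_fst (h : Staircase ω.region a c lo hi en)
    (hbox : boundingBox ω.region = Set.Icc a c) {z : Plane} (hz : z ∈ ω.region)
    (hzs : z.1 = a.1 ∨ z.1 = c.1) : ¬ IsHorizontal {w ∈ ω.region | w.1 = z.1} := by
  rintro ⟨y, hy⟩
  obtain ⟨y₁, y₂, h12, h1, h2, -⟩ := ω.side_interval_fst hbox
    (fun w hw => ⟨h.ge w hw, h.le w hw⟩) hz hzs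
  have e1 := hy _ ⟨h1, rfl⟩
  have e2 := hy _ ⟨h2, rfl⟩
  simp only at e1 e2
  linarith

theorem not_isVertical_of_snd (h : Staircase ω.region a c lo hi en)
    (hbox : boundingBox ω.region = Set.Icc a c) {z : Plane} (hz : z ∈ ω.region)
    (hzs : z.2 = a.2 ∨ z.2 = c.2) : ¬ IsVertical {w ∈ ω.region | w.2 = z.2} := by
  rintro ⟨x, hx⟩
  obtain ⟨x₁, x₂, h12, h1, h2, -⟩ := ω.side_interval_snd hbox
    (fun w hw => ⟨h.ge w hw, h.le w hw⟩) hz hzs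
  have e1 := hx _ ⟨h1, rfl⟩
  have e2 := hx _ ⟨h2, rfl⟩
  simp only at e1 e2
  linarith

theorem IsExtremeEdge.eq_of_isHorizontal (h : Staircase ω.region a c lo hi en)
    (hbox : boundingBox ω.region = Set.Icc a c) {e : Set Plane} (he : ω.IsExtremeEdge e)
    (hh : IsHorizontal e) : ∃ y, (y = a.2 ∨ y = c.2) ∧ e = {w ∈ ω.region | w.2 = y} := by
  rcases he.eq hbox (fun w hw => ⟨h.ge w hw, h.le w hw⟩) with ⟨x, hx, rfl⟩ | hy
  · exfalso
    have : ∃ z ∈ ω.region, z.1 = x := by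
      rcases hx with rfl | rfl
      · exact ⟨_, h.left_lo, rfl⟩
      · exact ⟨c, h.corner, rfl⟩
    obtain ⟨z, hz, rfl⟩ := this
    exact not_isHorizontal_of_fst h hbox hz hx hh
  · exact hy

theorem IsExtremeEdge.eq_of_isVertical (h : Staircase ω.region a c lo hi en)
    (hbox : boundingBox ω.region = Set.Icc a c) {e : Set Plane} (he : ω.IsExtremeEdge e)
    (hh : IsVertical e) : ∃ x, (x = a.1 ∨ x = c.1) ∧ e = {w ∈ ω.region | w.1 = x} := by
  rcases he.eq hbox (fun w hw => ⟨h.ge w hw, h.le w hw⟩) with hx | ⟨y, hy, rfl⟩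
  · exact hx
  · exfalso
    have : ∃ z ∈ ω.region, z.2 = y := by
      rcases hy with rfl | rfl
      · exact ⟨_, h.bot_lo, rfl⟩
      · exact ⟨c, h.corner, rfl⟩
    obtain ⟨z, hz, rfl⟩ := this
    exact not_isVertical_of_snd h hbox hz hy hh

theorem areFarEdges (h : Staircase ω.region a c lo hi en)
    (hbox : boundingBox ω.region = Set.Icc a c) :
    ω.AreFarEdges c (ω.leftEdge a) (ω.bottomEdge a) := by
  have hac : ∀ w ∈ ω.region, _ := fun w hw => And.intro (h.ge w hw) (h.le w hw)
  obtain ⟨i, -, -, -, h1⟩ := ω.isExtremeEdge_fst hbox hac h.left_lo (Or.inl rfl)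
  obtain ⟨j, -, -, -, h2⟩ := ω.isExtremeEdge_snd hbox hac h.bot_lo (Or.inl rfl)
  refine ⟨h1, h2, fun e => ?_, fun hm => ?_, fun hm => ?_⟩
  · have : ((a.1, hi.2) : Plane) ∈ ω.bottomEdge a := e ▸ ⟨h.left_hi, rfl⟩
    exact h.a_lt_hi.2.ne' this.2
  · exact (h.a_lt_hi.1.trans h.hi_lt_fst).ne' hm.2
  · exact (h.a_lt_hi.2.trans h.hi_lt_snd).ne' hm.2

theorem AreFarEdges.eq (h : Staircase ω.region a c lo hi en)
    (hbox : boundingBox ω.region = Set.Icc a c) {e₁ e₂ : Set Plane} (he : ω.AreFarEdges c e₁ e₂) :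
    (e₁ = ω.leftEdge a ∧ e₂ = ω.bottomEdge a) ∨ (e₁ = ω.bottomEdge a ∧ e₂ = ω.leftEdge a) := by
  have key : ∀ e, ω.IsExtremeEdge e → c ∉ e → e = ω.leftEdge a ∨ e = ω.bottomEdge a := by
    intro e he hce
    rcases he.eq hbox (fun w hw => ⟨h.ge w hw, h.le w hw⟩) with
      ⟨x, rfl | rfl, rfl⟩ | ⟨y, rfl | rfl, rfl⟩
    · exact Or.inl rfl
    · exact absurd ⟨h.corner, rfl⟩ hce
    · exact Or.inr rfl
    · exact absurd ⟨h.corner, rfl⟩ hce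
  obtain ⟨h1, h2, hne, hc1, hc2⟩ := he
  rcases key e₁ h1 hc1 with rfl | rfl <;> rcases key e₂ h2 hc2 with rfl | rfl
  · exact absurd rfl hne
  · exact Or.inl ⟨rfl, rfl⟩
  · exact Or.inr ⟨rfl, rfl⟩
  · exact absurd rfl hne

/-- The segments of a cross meet, and touch all four sides of the bounding box. -/
theorem isMinimumSkeleton_of_isCross (h : Staircase ω.region a c lo hi en)
    (hbox : boundingBox ω.region = Set.Icc a c) {sH sV : Set Plane} (hX : ω.IsCross sH sV) :
    ω.IsMinimumSkeleton {sH, sV} := by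
  obtain ⟨⟨e, e', he, he', hne, hh, hh', p', hp', q', hq', rfl, hsH⟩,
    d, d', hd, hd', hne', hv, hv', r', hr', t', ht', rfl, hsV⟩ := hX
  obtain ⟨y, hy, rfl⟩ := he.eq_of_isHorizontal h hbox hh
  obtain ⟨y', hy', rfl⟩ := he'.eq_of_isHorizontal h hbox hh'
  obtain ⟨x, hx, rfl⟩ := hd.eq_of_isVertical h hbox hv
  obtain ⟨x', hx', rfl⟩ := hd'.eq_of_isVertical h hbox hv'
  obtain ⟨p, q, hpq, hp, hq⟩ : ∃ p q, segment ℝ p' q' = segment ℝ p q ∧ p.2 = a.2 ∧ q.2 = c.2 := by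
    rcases hy with rfl | rfl <;> rcases hy' with rfl | rfl
    · exact absurd rfl hne
    · exact ⟨p', q', rfl, hp'.2, hq'.2⟩
    · exact ⟨q', p', segment_symm ℝ _ _, hq'.2, hp'.2⟩
    · exact absurd rfl hne
  obtain ⟨r, t, hrt, hr, ht⟩ : ∃ r t, segment ℝ r' t' = segment ℝ r t ∧ r.1 = a.1 ∧ t.1 = c.1 := by
    rcases hx with rfl | rfl <;> rcases hx' with rfl | rfl
    · exact absurd rfl hne'
    · exact ⟨r', t', rfl, hr'.2, ht'.2⟩
    · exact ⟨t', r', segment_symm ℝ _ _, ht'.2, hr'.2⟩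
    · exact absurd rfl hne'
  rw [hpq] at hsH ⊢
  rw [hrt] at hsV ⊢
  have hpW := hsH (left_mem_segment ℝ p q)
  have hqW := hsH (right_mem_segment ℝ p q)
  have hrW := hsV (left_mem_segment ℝ r t)
  have htW := hsV (right_mem_segment ℝ r t)
  have hac1 : a.1 < c.1 := h.a_lt_hi.1.trans h.hi_lt_fst
  have hac2 : a.2 < c.2 := h.a_lt_hi.2.trans h.hi_lt_snd
  -- along `sH`, the height above the line through `sV` changes its sign
  have hmeet : (segment ℝ p q ∩ segment ℝ r t).Nonempty := by
    set φ : Plane → ℝ := fun z => (z.2 - r.2) * (c.1 - a.1) - (z.1 - a.1) * (t.2 - r.2) with hφ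
    have hφc : ContinuousOn φ (segment ℝ p q) := by fun_prop
    have hd0 : 0 < c.1 - a.1 := by linarith
    have hp0 : φ p ≤ 0 := by
      have h1 := h.ge _ hrW
      have h2 := h.ge _ htW
      have h3 := h.ge _ hpW
      have h4 := h.le _ hpW
      have e1 := mul_nonneg (sub_nonneg.2 h1.2) (sub_nonneg.2 h4.1)
      have e2 := mul_nonneg (sub_nonneg.2 h2.2) (sub_nonneg.2 h3.1)
      simp only [hφ, hp]
      nlinarith
    have hq0 : 0 ≤ φ q := by
      have h1 := h.le _ hrW
      have h2 := h.le _ htW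
      have h3 := h.ge _ hqW
      have h4 := h.le _ hqW
      have e1 := mul_nonneg (sub_nonneg.2 h1.2) (sub_nonneg.2 h4.1)
      have e2 := mul_nonneg (sub_nonneg.2 h2.2) (sub_nonneg.2 h3.1)
      simp only [hφ, hq]
      nlinarith
    obtain ⟨z, hz, hz0⟩ := (isPreconnected_segment p q).intermediate_value
      (left_mem_segment ℝ p q) (right_mem_segment ℝ p q) hφc ⟨hp0, hq0⟩
    have hzW := hsH hz
    refine ⟨z, hz, mem_segment_coord.2 ⟨(z.1 - a.1) / (c.1 - a.1), ?_, ?_, ?_, ?_⟩⟩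
    · exact div_nonneg (sub_nonneg.2 (h.ge z hzW).1) hd0.le
    · rw [div_le_one hd0]
      linarith [(h.le z hzW).1]
    · rw [hr, ht]; field_simp; ring
    · simp only [hφ] at hz0
      field_simp
      linear_combination hz0
  have hne1 : p ≠ q := fun e => hac2.ne (by rw [← hp, ← hq, e])
  have hne2 : r ≠ t := fun e => hac1.ne (by rw [← hr, ← ht, e])
  have hU : ⋃₀ ({segment ℝ p q, segment ℝ r t} : Set (Set Plane)) = segment ℝ p q ∪ segment ℝ r t :=
    Set.sUnion_pair _ _
  obtain ⟨o, ho1, ho2⟩ := hmeet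
  refine isMinimumSkeleton h (linked_of_preconnected h.ge (by simp) ?_ ?_ ?_ ?_ ?_ ?_ ?_ ?_ ?_) ?_
  · rintro s (rfl | rfl)
    exacts [⟨p, q, hne1, rfl⟩, ⟨r, t, hne2, rfl⟩]
  · rintro s (rfl | rfl)
    exacts [hsH, hsV]
  · rintro s (rfl | rfl) w hw
    exacts [h.le w (hsH hw), h.le w (hsV hw)]
  · rw [hU]
    exact (isPreconnected_segment p q).union o ho1 ho2 (isPreconnected_segment r t)
  · rintro s (rfl | rfl)
    exacts [⟨p, left_mem_segment ℝ p q, Or.inr hp⟩, ⟨r, left_mem_segment ℝ r t, Or.inl hr⟩]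
  · exact ⟨r, hU ▸ Or.inr (left_mem_segment ℝ r t), hr⟩
  · exact ⟨p, hU ▸ Or.inl (left_mem_segment ℝ p q), hp⟩
  · exact ⟨t, hU ▸ Or.inr (right_mem_segment ℝ r t), ht⟩
  · exact ⟨q, hU ▸ Or.inl (right_mem_segment ℝ p q), hq⟩
  · intro S' hS' hfin
    refine (Set.encard_insert_le _ _).trans ?_
    rw [Set.encard_singleton, one_add_one_eq_two]
    exact h.two_le_encard hS' hfin

end Obstacle

namespace Staircase

variable {W : Set Plane} {a c lo hi en K : Plane} {S : Set (Set Plane)}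

theorem hi_mem (h : Staircase W a c lo hi en) : hi ∈ W :=
  h.mem_of h.left_hi h.bot_hi h.left_lo h.a_lt_hi.1.le le_rfl le_rfl h.a_lt_hi.2.le h.a_lt_hi.1.le
    h.left_lt.le

/-- If some point of the left edge is visible from the bottom edge, then the ends of these edges at
`hi` are visible from each other: every point of the segment that joins them dominates a point of
the given segment. -/
theorem segment_hi_subset (h : Staircase W a c lo hi en) {p q : Plane} (hp : p.1 = a.1)
    (hq : q.2 = a.2) (hs : segment ℝ p q ⊆ W) :
    segment ℝ ((a.1, hi.2) : Plane) (hi.1, a.2) ⊆ W := by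
  have hpW := hs (left_mem_segment ℝ p q)
  have hqW := hs (right_mem_segment ℝ p q)
  intro z hz
  obtain ⟨t, t0, t1, e1, e2⟩ := mem_segment_coord.1 hz
  simp only at e1 e2
  have hlt := h.a_lt_hi
  refine h.mem_of h.left_hi h.bot_hi (hs (pointAt_mem t0 t1)) ?_ ?_ ?_ ?_ ?_ ?_
  · rw [e1]; exact le_convexComb t0 t1 le_rfl hlt.1.le
  · rw [e2]; exact convexComb_le_right t0 t1 le_rfl hlt.2.le
  · rw [e1]; exact convexComb_le_right t0 t1 hlt.1.le le_rfl
  · rw [e2]; exact le_convexComb t0 t1 hlt.2.le le_rfl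
  · rw [e1]; exact convexComb_le t0 t1 hp.le (h.bot q hqW hq).2
  · rw [e2]; exact convexComb_le t0 t1 (h.left p hpW hp).2 hq.le

/-- The longest segment between the left and the bottom edge joins the ends of these edges. -/
theorem euclLength_le (h : Staircase W a c lo hi en) {p q : Plane} (hpW : p ∈ W) (hqW : q ∈ W)
    (hp : p.1 = a.1) (hq : q.2 = a.2) : euclLength p q ≤ euclLength (a.1, hi.2) (hi.1, a.2) ∧
      (euclLength (a.1, hi.2) (hi.1, a.2) ≤ euclLength p q →
        p = (a.1, hi.2) ∧ q = (hi.1, a.2)) := by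
  have hlt := h.a_lt_hi
  have h1 := (h.left p hpW hp).2
  have h2 := (h.bot q hqW hq).2
  have h3 := (h.ge p hpW).2
  have h4 := (h.ge q hqW).1
  unfold euclLength
  rw [Real.sqrt_le_sqrt_iff (by positivity), Real.sqrt_le_sqrt_iff (by positivity)]
  simp only [hp, hq]
  have k1 : 0 ≤ (hi.1 - q.1) * ((hi.1 - a.1) + (q.1 - a.1)) :=
    mul_nonneg (by linarith) (by linarith)
  have k2 : 0 ≤ (hi.2 - p.2) * ((hi.2 - a.2) + (p.2 - a.2)) :=
    mul_nonneg (by linarith) (by linarith)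
  refine ⟨by nlinarith, fun hle => ?_⟩
  have z1 : (hi.1 - q.1) * ((hi.1 - a.1) + (q.1 - a.1)) = 0 := by nlinarith
  have z2 : (hi.2 - p.2) * ((hi.2 - a.2) + (p.2 - a.2)) = 0 := by nlinarith
  have i1 : hi.1 - q.1 = 0 := (mul_eq_zero.1 z1).resolve_right (by linarith)
  have i2 : hi.2 - p.2 = 0 := (mul_eq_zero.1 z2).resolve_right (by linarith)
  exact ⟨Prod.ext hp (by simp only; linarith), Prod.ext (by simp only; linarith) hq⟩

/-- The segment that joins the far ends of the left and the bottom edge is linked. -/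
theorem linked_hi (h : Staircase W a c lo hi en)
    (hs : segment ℝ ((a.1, hi.2) : Plane) (hi.1, a.2) ⊆ W) :
    Linked W a hi {segment ℝ ((a.1, hi.2) : Plane) (hi.1, a.2)} := by
  have hl := left_mem_segment ℝ ((a.1, hi.2) : Plane) (hi.1, a.2)
  have hr := right_mem_segment ℝ ((a.1, hi.2) : Plane) (hi.1, a.2)
  have hU : ⋃₀ {segment ℝ ((a.1, hi.2) : Plane) (hi.1, a.2)} =
    segment ℝ ((a.1, hi.2) : Plane) (hi.1, a.2) := Set.sUnion_singleton _
  refine linked_of_preconnected h.ge (Set.finite_singleton _) ?_ ?_ ?_ ?_ ?_ ?_ ?_ ?_ ?_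
  · rintro s rfl
    exact ⟨(a.1, hi.2), (hi.1, a.2), fun e => h.a_lt_hi.1.ne (Prod.mk.inj e).1, rfl⟩
  · rintro s rfl
    exact hs
  · rintro s rfl w hw
    exact h.touch_le hs ⟨_, hl, rfl⟩ ⟨_, hr, rfl⟩ w hw
  · rw [hU]
    exact isPreconnected_segment _ _
  · rintro s rfl
    exact ⟨_, hl, Or.inl rfl⟩
  · exact ⟨(a.1, hi.2), ⟨_, rfl, hl⟩, rfl⟩
  · exact ⟨(hi.1, a.2), ⟨_, rfl, hr⟩, rfl⟩
  · exact ⟨(hi.1, a.2), ⟨_, rfl, hr⟩, rfl⟩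
  · exact ⟨(a.1, hi.2), ⟨_, rfl, hl⟩, rfl⟩

/-- What is known of a most advanced maximal segment from the left edge. -/
structure LeftEdgeSegment (W : Set Plane) (a hi u v : Plane) : Prop where
  start : u.1 = a.1
  maximal : MaximalSegment W u v
  covered : IsCovered W hi v
  le : u.1 ≤ v.1 ∧ u.2 ≤ v.2
  dominates : ∀ p n : Plane, p.1 = a.1 → segment ℝ p n ⊆ W → n.1 ≤ v.1 ∧ n.2 ≤ v.2

theorem leftEdgeSegment (h : Staircase W a c lo hi en) {u v : Plane} (hu : u.1 = a.1)
    (huv : MaximalSegment W u v)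
    (hmax : ∀ u' v', u'.1 = a.1 → MaximalSegment W u' v' → LexLe v' v) :
    LeftEdgeSegment W a hi u v := by
  obtain ⟨h1, h2, h3⟩ := h.covered_left hu huv hmax
  exact ⟨hu, huv, h1, h2, h3⟩

/-- Most advanced segments from the left and from the bottom edge are linked. -/
theorem linked_pair (h : Staircase W a c lo hi en) {u₁ v₁ u₂ v₂ : Plane}
    (h1 : LeftEdgeSegment W a hi u₁ v₁)
    (h2 : LeftEdgeSegment (Prod.swap '' W) a.swap hi.swap u₂.swap v₂.swap) :
    Linked W a (max v₁.1 v₂.1, max v₁.2 v₂.2) {segment ℝ u₁ v₁, segment ℝ u₂ v₂} ∧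
      IsCovered W hi (max v₁.1 v₂.1, max v₁.2 v₂.2) ∧
      (∀ p n : Plane, p.1 = a.1 → segment ℝ p n ⊆ W → n.1 ≤ v₁.1 ∧ n.2 ≤ v₁.2) ∧
      ∀ p n : Plane, p.2 = a.2 → segment ℝ p n ⊆ W → n.1 ≤ v₂.1 ∧ n.2 ≤ v₂.2 := by
  have hm2 := maximalSegment_swap.1 h2.maximal
  have hs2 : u₂.2 = a.2 := h2.start
  have hc2 : IsCovered W hi v₂ := by
    have := h2.covered.swap
    rwa [swap_image_swap_image] at this
  have hd2 : ∀ p n : Plane, p.2 = a.2 → segment ℝ p n ⊆ W → n.1 ≤ v₂.1 ∧ n.2 ≤ v₂.2 :=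
    fun p n hp hpn => (h2.dominates p.swap n.swap hp (segment_swap_subset.2 hpn)).symm
  have hle2 : u₂.1 ≤ v₂.1 ∧ u₂.2 ≤ v₂.2 := ⟨h2.le.2, h2.le.1⟩
  have hlt1 := h.a_lt_covered h1.covered
  have hlt2 := h.a_lt_covered hc2
  obtain ⟨o, ho1, ho2⟩ := h.meet_of_dominates h1.start hs2 h1.maximal.2.1 hm2.2.1 h1.le.2 hle2.1
    hlt1.1 hlt2.2 (fun p n hp hpn => (h1.dominates p n hp hpn).1)
    (fun p n hp hpn => (hd2 p n hp hpn).2)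
  have hU : ⋃₀ ({segment ℝ u₁ v₁, segment ℝ u₂ v₂} : Set (Set Plane)) =
    segment ℝ u₁ v₁ ∪ segment ℝ u₂ v₂ := Set.sUnion_pair _ _
  have l1 := left_mem_segment ℝ u₁ v₁
  have r1 := right_mem_segment ℝ u₁ v₁
  have l2 := left_mem_segment ℝ u₂ v₂
  have r2 := right_mem_segment ℝ u₂ v₂
  refine ⟨linked_of_preconnected h.ge (by simp) ?_ ?_ ?_ ?_ ?_ ?_ ?_ ?_ ?_,
    h.covered_sup h1.covered hc2, h1.dominates, hd2⟩
  · rintro s (rfl | rfl)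
    exacts [⟨_, _, h1.maximal.1, rfl⟩, ⟨_, _, hm2.1, rfl⟩]
  · rintro s (rfl | rfl)
    exacts [h1.maximal.2.1, hm2.2.1]
  · rintro s (rfl | rfl) w hw
    · have := h1.dominates u₁ w h1.start
        (((convex_segment u₁ v₁).segment_subset l1 hw).trans h1.maximal.2.1)
      exact ⟨le_max_of_le_left this.1, le_max_of_le_left this.2⟩
    · have := hd2 u₂ w hs2 (((convex_segment u₂ v₂).segment_subset l2 hw).trans hm2.2.1)
      exact ⟨le_max_of_le_right this.1, le_max_of_le_right this.2⟩
  · rw [hU]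
    exact (isPreconnected_segment _ _).union o ho1 ho2 (isPreconnected_segment _ _)
  · rintro s (rfl | rfl)
    exacts [⟨_, l1, Or.inl h1.start⟩, ⟨_, l2, Or.inr hs2⟩]
  · exact ⟨_, hU ▸ Or.inl l1, h1.start⟩
  · exact ⟨_, hU ▸ Or.inr l2, hs2⟩
  · rcases le_total v₁.1 v₂.1 with i | i
    · exact ⟨_, hU ▸ Or.inr r2, (max_eq_right i).symm⟩
    · exact ⟨_, hU ▸ Or.inl r1, (max_eq_left i).symm⟩
  · rcases le_total v₁.2 v₂.2 with i | i
    · exact ⟨_, hU ▸ Or.inr r2, (max_eq_right i).symm⟩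
    · exact ⟨_, hU ▸ Or.inl r1, (max_eq_left i).symm⟩

end Staircase

namespace Obstacle

open Staircase

variable {ω : Obstacle} {a c lo hi en K : Plane} {S : Set (Set Plane)}

theorem MutuallyVisible.symm {e₁ e₂ : Set Plane} (h : ω.MutuallyVisible e₁ e₂) :
    ω.MutuallyVisible e₂ e₁ := by
  obtain ⟨p, hp, q, hq, hs⟩ := h
  exact ⟨q, hq, p, hp, by rwa [segment_symm]⟩

theorem euclLength_comm (p q : Plane) : euclLength p q = euclLength q p := by
  unfold euclLength
  congr 1
  ring

theorem IsMaxLengthAdjacent.symm {e₁ e₂ s : Set Plane} (h : ω.IsMaxLengthAdjacent e₁ e₂ s) :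
    ω.IsMaxLengthAdjacent e₂ e₁ s := by
  obtain ⟨p, hp, q, hq, rfl, hs, hmax⟩ := h
  refine ⟨q, hq, p, hp, segment_symm ℝ _ _, by rwa [segment_symm], fun q' hq' p' hp' hs' => ?_⟩
  rw [euclLength_comm q' p', euclLength_comm q p]
  exact hmax p' hp' q' hq' (by rwa [segment_symm])

theorem IsMaxLengthAdjacent.eq (h : Staircase ω.region a c lo hi en) {s : Set Plane}
    (hs : ω.IsMaxLengthAdjacent (ω.leftEdge a) (ω.bottomEdge a) s) :
    s = segment ℝ ((a.1, hi.2) : Plane) (hi.1, a.2) := by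
  obtain ⟨p, hp, q, hq, rfl, hs, hmax⟩ := hs
  obtain ⟨rfl, rfl⟩ := (h.euclLength_le hp.1 hq.1 hp.2 hq.2).2
    (hmax _ ⟨h.left_hi, rfl⟩ _ ⟨h.bot_hi, rfl⟩ (h.segment_hi_subset hp.2 hq.2 hs))
  rfl

theorem exists_isMaxLengthAdjacent (h : Staircase ω.region a c lo hi en)
    (hv : ω.MutuallyVisible (ω.leftEdge a) (ω.bottomEdge a)) :
    ∃ s, ω.IsMaxLengthAdjacent (ω.leftEdge a) (ω.bottomEdge a) s := by
  obtain ⟨p, hp, q, hq, hs⟩ := hv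
  exact ⟨_, _, ⟨h.left_hi, rfl⟩, _, ⟨h.bot_hi, rfl⟩, rfl, h.segment_hi_subset hp.2 hq.2 hs,
    fun p' hp' q' hq' _ => (h.euclLength_le hp'.1 hq'.1 hp'.2 hq'.2).1⟩

theorem not_isHorizontal_leftEdge (h : Staircase ω.region a c lo hi en) :
    ¬ IsHorizontal (ω.leftEdge a) := by
  rintro ⟨y, hy⟩
  exact h.left_lt.ne ((hy _ ⟨h.left_lo, rfl⟩).trans (hy _ ⟨h.left_hi, rfl⟩).symm)

theorem not_isVertical_bottomEdge (h : Staircase ω.region a c lo hi en) :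
    ¬ IsVertical (ω.bottomEdge a) := by
  rintro ⟨x, hx⟩
  exact h.bot_lt.ne ((hx _ ⟨h.bot_lo, rfl⟩).trans (hx _ ⟨h.bot_hi, rfl⟩).symm)

theorem isMaximalExtremeEdge_left (h : Staircase ω.region a c lo hi en) {s : Set Plane} :
    ω.IsMaximalExtremeEdge c (ω.leftEdge a) s ↔ ∃ u v, s = segment ℝ u v ∧ u.1 = a.1 ∧
      MaximalSegment ω.region u v ∧
        ∀ u' v', u'.1 = a.1 → MaximalSegment ω.region u' v' → LexLe v' v := by
  have hle : ∀ u' v', MaximalSegment ω.region u' v' → v'.1 ≤ c.1 ∧ v'.2 ≤ c.2 :=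
    fun u' v' h' => h.le v' (h'.2.1 (right_mem_segment ℝ u' v'))
  constructor
  · rintro ⟨u, v, rfl, hu, huv, ⟨hH, -⟩ | ⟨-, hmax⟩⟩
    · exact absurd hH (not_isHorizontal_leftEdge h)
    · exact ⟨u, v, rfl, hu.2, huv, fun u' v' hu' h' => (lexLe_of_advancesHV (hle u v huv)
        (hle u' v' h')).1 (hmax u' v' ⟨h'.2.1 (left_mem_segment ℝ u' v'), hu'⟩ h')⟩
  · rintro ⟨u, v, rfl, hu, huv, hmax⟩
    exact ⟨u, v, rfl, ⟨huv.2.1 (left_mem_segment ℝ u v), hu⟩, huv, Or.inr ⟨⟨a.1, fun w hw => hw.2⟩,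
      fun u' v' hu' h' => (lexLe_of_advancesHV (hle u v huv) (hle u' v' h')).2
        (hmax u' v' hu'.2 h')⟩⟩

theorem isMaximalExtremeEdge_bottom (h : Staircase ω.region a c lo hi en) {s : Set Plane} :
    ω.IsMaximalExtremeEdge c (ω.bottomEdge a) s ↔ ∃ u v, s = segment ℝ u v ∧ u.2 = a.2 ∧
      MaximalSegment ω.region u v ∧
        ∀ u' v', u'.2 = a.2 → MaximalSegment ω.region u' v' → LexLe v'.swap v.swap := by
  have hle : ∀ u' v', MaximalSegment ω.region u' v' → v'.1 ≤ c.1 ∧ v'.2 ≤ c.2 :=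
    fun u' v' h' => h.le v' (h'.2.1 (right_mem_segment ℝ u' v'))
  constructor
  · rintro ⟨u, v, rfl, hu, huv, ⟨-, hmax⟩ | ⟨hV, -⟩⟩
    · exact ⟨u, v, rfl, hu.2, huv, fun u' v' hu' h' => (lexLe_of_advancesVH (hle u v huv)
        (hle u' v' h')).1 (hmax u' v' ⟨h'.2.1 (left_mem_segment ℝ u' v'), hu'⟩ h')⟩
    · exact absurd hV (not_isVertical_bottomEdge h)
  · rintro ⟨u, v, rfl, hu, huv, hmax⟩
    exact ⟨u, v, rfl, ⟨huv.2.1 (left_mem_segment ℝ u v), hu⟩, huv, Or.inl ⟨⟨a.2, fun w hw => hw.2⟩,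
      fun u' v' hu' h' => (lexLe_of_advancesVH (hle u v huv) (hle u' v' h')).2
        (hmax u' v' hu'.2 h')⟩⟩

theorem leftEdgeSegment_swap (h : Staircase ω.region a c lo hi en) {u v : Plane} (hu : u.2 = a.2)
    (huv : MaximalSegment ω.region u v)
    (hmax : ∀ u' v', u'.2 = a.2 → MaximalSegment ω.region u' v' → LexLe v'.swap v.swap) :
    LeftEdgeSegment (Prod.swap '' ω.region) a.swap hi.swap u.swap v.swap := by
  refine h.swap.leftEdgeSegment hu (maximalSegment_swap.2 huv) fun u' v' hu' h' => ?_
  rw [← u'.swap_swap, ← v'.swap_swap, maximalSegment_swap] at h'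
  exact hmax _ _ hu' h'

theorem exists_isMaximalExtremeEdge (h : Staircase ω.region a c lo hi en) :
    (∃ s, ω.IsMaximalExtremeEdge c (ω.leftEdge a) s) ∧
      ∃ s, ω.IsMaximalExtremeEdge c (ω.bottomEdge a) s := by
  constructor
  · obtain ⟨u, v, hu, huv, hmax⟩ := h.exists_left
    exact ⟨_, (isMaximalExtremeEdge_left h).2 ⟨u, v, rfl, hu, huv, hmax⟩⟩
  · obtain ⟨u, v, hu, huv, hmax⟩ := h.swap.exists_left
    refine ⟨_, (isMaximalExtremeEdge_bottom h).2 ⟨u.swap, v.swap, rfl, hu, ?_,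
      fun u' v' hu' h' => ?_⟩⟩
    · rwa [← maximalSegment_swap]
    · exact hmax _ _ hu' (maximalSegment_swap.2 h')

/-- If the left and the bottom edge see each other, the loop starts with the box spanned by them.
This box meets two segments of every skeleton. -/
theorem good_adjacent (h : Staircase ω.region a c lo hi en)
    (hv : ω.MutuallyVisible (ω.leftEdge a) (ω.bottomEdge a)) {s : Set Plane}
    (hs : ω.IsMaxLengthAdjacent (ω.leftEdge a) (ω.bottomEdge a) s) :
    ∃ m, ω.Good a c hi (.advance {s}) m := by
  obtain rfl := hs.eq h
  obtain ⟨p, hp, q, hq, hpq⟩ := hv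
  refine ⟨_, hi, ⟨h.linked_hi (h.segment_hi_subset hp.2 hq.2 hpq), h.covered_hi h.hi_mem,
    fun e => h.hi_lt_fst.ne (congrArg Prod.fst e), fun S' hS' hfin => ?_⟩, rfl⟩
  rw [Set.encard_singleton, one_add_one_eq_two]
  exact h.two_le_meeting_hi hS' hfin h.hi_mem

theorem encard_pair_le {α : Type*} (x y : α) : ({x, y} : Set α).encard ≤ 2 := by
  refine (Set.encard_insert_le _ _).trans ?_
  rw [Set.encard_singleton, one_add_one_eq_two]

/-- If the left and the bottom edge do not see each other, the two initial segments span a box that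
contains two segments of every skeleton. -/
theorem good_pair (h : Staircase ω.region a c lo hi en)
    (hv : ¬ ω.MutuallyVisible (ω.leftEdge a) (ω.bottomEdge a)) {s₁ s₂ : Set Plane}
    (hs₁ : ω.IsMaximalExtremeEdge c (ω.leftEdge a) s₁)
    (hs₂ : ω.IsMaximalExtremeEdge c (ω.bottomEdge a) s₂) :
    ((∃ f, ω.IsFrontier {s₁, s₂} f) → ∃ m, ω.Good a c hi (.advance {s₁, s₂}) m) ∧
      ((¬ ∃ f, ω.IsFrontier {s₁, s₂} f) → ω.IsMinimumSkeleton {s₁, s₂}) := by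
  obtain ⟨u₁, v₁, rfl, hu₁, hm₁, hmax₁⟩ := (isMaximalExtremeEdge_left h).1 hs₁
  obtain ⟨u₂, v₂, rfl, hu₂, hm₂, hmax₂⟩ := (isMaximalExtremeEdge_bottom h).1 hs₂
  obtain ⟨hL, hK, hd₁, hd₂⟩ := h.linked_pair (h.leftEdgeSegment hu₁ hm₁ hmax₁)
    (leftEdgeSegment_swap h hu₂ hm₂ hmax₂)
  set K : Plane := (max v₁.1 v₂.1, max v₁.2 v₂.2) with hKdef
  have hin : ∀ S', IsSkeletonOf ω.region S' → S'.Finite → 2 ≤ (inside S' K).encard :=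
    fun S' hS' hfin => h.two_le_inside hS' hfin
      (fun p q hp hq hs => hv ⟨p, ⟨hs (left_mem_segment ℝ p q), hp⟩, q,
        ⟨hs (right_mem_segment ℝ p q), hq⟩, hs⟩)
      (fun p n hp hpn => ⟨le_max_of_le_left (hd₁ p n hp hpn).1,
        le_max_of_le_left (hd₁ p n hp hpn).2⟩)
      fun p n hp hpn => ⟨le_max_of_le_right (hd₂ p n hp hpn).1,
        le_max_of_le_right (hd₂ p n hp hpn).2⟩
  constructor
  · rintro ⟨f, hf⟩
    have hc := ((isFrontier_iff h hL hK).1 hf).1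
    refine ⟨_, K, ⟨hL, hK, hc, fun S' hS' hfin => ?_⟩, rfl⟩
    exact (add_le_add_left ((encard_pair_le _ _).trans (hin S' hS' hfin)) 1).trans
      (h.encard_inside_add_one_le hS' hfin hK hc)
  · intro hf
    have hc : K = c := by
      by_contra hc
      exact hf ⟨_, (isFrontier_iff h hL hK).2 ⟨hc, rfl⟩⟩
    rw [hc] at hL hin
    exact isMinimumSkeleton h hL fun S' hS' hfin => (encard_pair_le _ _).trans
      ((hin S' hS' hfin).trans (Set.encard_le_encard fun t ht => ht.1))

theorem PartialStaircaseStart.good (h : Staircase ω.region a c lo hi en)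
    (hbox : boundingBox ω.region = Set.Icc a c) {σ : State} (hσ : ω.PartialStaircaseStart c σ) :
    ∃ m, ω.Good a c hi σ m := by
  cases hσ with
  | cross sH sV hX => exact ⟨0, isMinimumSkeleton_of_isCross h hbox hX, rfl⟩
  | adjacent e₁ e₂ s hX he hvis hs =>
    rcases he.eq h hbox with ⟨rfl, rfl⟩ | ⟨rfl, rfl⟩
    · exact good_adjacent h hvis hs
    · exact good_adjacent h hvis.symm hs.symm
  | pair e₁ e₂ s₁ s₂ hX he hvis hs₁ hs₂ hf =>
    rcases he.eq h hbox with ⟨rfl, rfl⟩ | ⟨rfl, rfl⟩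
    · exact (good_pair h hvis hs₁ hs₂).1 hf
    · rw [Set.pair_comm] at hf ⊢
      exact (good_pair h (fun hv => hvis hv.symm) hs₂ hs₁).1 hf
  | pairComplete e₁ e₂ s₁ s₂ hX he hvis hs₁ hs₂ hf =>
    rcases he.eq h hbox with ⟨rfl, rfl⟩ | ⟨rfl, rfl⟩
    · exact ⟨0, (good_pair h hvis hs₁ hs₂).2 hf, rfl⟩
    · rw [Set.pair_comm] at hf ⊢
      exact ⟨0, (good_pair h (fun hv => hvis hv.symm) hs₂ hs₁).2 hf, rfl⟩

theorem exists_partialStaircaseStart (h : Staircase ω.region a c lo hi en)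
    (hbox : boundingBox ω.region = Set.Icc a c) : ∃ σ, ω.PartialStaircaseStart c σ := by
  by_cases hX : ω.HasCross
  · obtain ⟨sH, sV, hX⟩ := hX
    exact ⟨_, .cross sH sV hX⟩
  have hF := areFarEdges h hbox
  by_cases hv : ω.MutuallyVisible (ω.leftEdge a) (ω.bottomEdge a)
  · obtain ⟨s, hs⟩ := exists_isMaxLengthAdjacent h hv
    exact ⟨_, .adjacent _ _ s hX hF hv hs⟩
  · obtain ⟨⟨s₁, hs₁⟩, s₂, hs₂⟩ := exists_isMaximalExtremeEdge h
    by_cases hf : ∃ f, ω.IsFrontier {s₁, s₂} f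
    · exact ⟨_, .pair _ _ s₁ s₂ hX hF hv hs₁ hs₂ hf⟩
    · exact ⟨_, .pairComplete _ _ s₁ s₂ hX hF hv hs₁ hs₂ hf⟩

/-- The algorithm is correct on `ω`. -/
def Correct (ω : Obstacle) (c : Plane) : Prop :=
  (∃ σ, ω.PartialStaircaseStart c σ) ∧
    (∀ σ, ω.Reachable c σ → (∃ S, σ = State.halt S) ∨ ∃ σ', ω.StaircaseStep c σ σ') ∧
    (¬ ∃ run : ℕ → State, ω.PartialStaircaseStart c (run 0) ∧
      ∀ k, ω.StaircaseStep c (run k) (run (k + 1))) ∧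
    (∀ S, ω.Reachable c (State.halt S) → ω.IsMinimumSkeleton S)

theorem correct_of_staircase (h : Staircase ω.region a c lo hi en)
    (hbox : boundingBox ω.region = Set.Icc a c) : ω.Correct c := by
  have hreach : ∀ σ, ω.Reachable c σ → ∃ m, ω.Good a c hi σ m := by
    rintro σ ⟨σ₀, h₀, hr⟩
    induction hr with
    | refl => exact h₀.good h hbox
    | tail _ hstep ih =>
      obtain ⟨m, hm⟩ := ih
      obtain ⟨m', -, hm'⟩ := hm.step h hstep
      exact ⟨m', hm'⟩
  refine ⟨exists_partialStaircaseStart h hbox, fun σ hσ => ?_, ?_, fun S hS => ?_⟩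
  · obtain ⟨m, hm⟩ := hreach σ hσ
    exact hm.progress h
  · rintro ⟨run, h₀, hrun⟩
    have key : ∀ m k, ¬ ω.Good a c hi (run k) m := by
      intro m
      induction m using Nat.strong_induction_on with
      | _ m ih =>
        intro k hk
        obtain ⟨m', hlt, hm'⟩ := hk.step h (hrun k)
        exact ih m' hlt (k + 1) hm'
    obtain ⟨m, hm⟩ := h₀.good h hbox
    exact key m 0 hm
  · obtain ⟨m, hm⟩ := hreach _ hS
    exact hm.1

end Obstacle

/-! ### Reflections -/

/-- The obstacles `ω` and `ω'` are mirror images under the reflection `g`, which preserves the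
horizontal and the vertical distances. -/
structure Mirror (g : Plane ≃L[ℝ] Plane) (ω ω' : Obstacle) : Prop where
  involutive : ∀ p, g (g p) = p
  fst : ∀ p q, |(g p).1 - (g q).1| = |p.1 - q.1|
  snd : ∀ p q, |(g p).2 - (g q).2| = |p.2 - q.2|
  box : ∀ A, boundingBox (g '' A) = g '' boundingBox A
  region : ω'.region = g '' ω.region
  vertex : ∀ i, ∃ j, g (ω.vertex i) = ω'.vertex j
  vertex' : ∀ i, ∃ j, g (ω'.vertex i) = ω.vertex j
  edge : ∀ i, ∃ j, g '' ω.edge i = ω'.edge j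
  edge' : ∀ i, ∃ j, g '' ω'.edge i = ω.edge j

/-- The mirror image of a state of the algorithm. -/
def State.image (g : Plane → Plane) : State → State
  | .loop S f => .loop (Set.image g '' S) (g '' f)
  | .advance S => .advance (Set.image g '' S)
  | .halt S => .halt (Set.image g '' S)

namespace Mirror

variable {g : Plane ≃L[ℝ] Plane} {ω ω' : Obstacle}

theorem image_image (M : Mirror g ω ω') (A : Set Plane) : g '' (g '' A) = A := by
  rw [← Set.image_comp]
  simp [M.involutive]

theorem image_image_image (M : Mirror g ω ω') (S : Set (Set Plane)) :
    Set.image g '' (Set.image g '' S) = S := by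
  rw [← Set.image_comp]
  simp [M.image_image]

theorem mem_image (M : Mirror g ω ω') {A : Set Plane} {p : Plane} : p ∈ g '' A ↔ g p ∈ A := by
  constructor
  · rintro ⟨q, hq, rfl⟩
    rwa [M.involutive]
  · intro h
    exact ⟨g p, h, M.involutive p⟩

theorem apply_mem (A : Set Plane) {p : Plane} : g p ∈ g '' A ↔ p ∈ A :=
  g.injective.mem_set_image

theorem symm (M : Mirror g ω ω') : Mirror g ω' ω where
  involutive := M.involutive
  fst := M.fst
  snd := M.snd
  box := M.box
  region := by rw [M.region, M.image_image]
  vertex := M.vertex'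
  vertex' := M.vertex
  edge := M.edge'
  edge' := M.edge

theorem fst_eq (M : Mirror g ω ω') {p q : Plane} : (g p).1 = (g q).1 ↔ p.1 = q.1 := by
  rw [← sub_eq_zero, ← abs_eq_zero, M.fst, abs_eq_zero, sub_eq_zero]

theorem snd_eq (M : Mirror g ω ω') {p q : Plane} : (g p).2 = (g q).2 ↔ p.2 = q.2 := by
  rw [← sub_eq_zero, ← abs_eq_zero, M.snd, abs_eq_zero, sub_eq_zero]

theorem isHorizontal (M : Mirror g ω ω') {A : Set Plane} (h : IsHorizontal A) :
    IsHorizontal (g '' A) := by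
  obtain ⟨y, hy⟩ := h
  refine ⟨(g (0, y)).2, ?_⟩
  rintro _ ⟨p, hp, rfl⟩
  exact M.snd_eq.2 (hy p hp)

theorem isVertical (M : Mirror g ω ω') {A : Set Plane} (h : IsVertical A) :
    IsVertical (g '' A) := by
  obtain ⟨x, hx⟩ := h
  refine ⟨(g (x, 0)).1, ?_⟩
  rintro _ ⟨p, hp, rfl⟩
  exact M.fst_eq.2 (hx p hp)

theorem isHorizontal_iff (M : Mirror g ω ω') {A : Set Plane} :
    IsHorizontal (g '' A) ↔ IsHorizontal A :=
  ⟨fun h => by simpa [M.image_image] using M.isHorizontal h, M.isHorizontal⟩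

theorem isVertical_iff (M : Mirror g ω ω') {A : Set Plane} :
    IsVertical (g '' A) ↔ IsVertical A :=
  ⟨fun h => by simpa [M.image_image] using M.isVertical h, M.isVertical⟩

theorem subset_region (M : Mirror g ω ω') {A : Set Plane} (h : A ⊆ ω.region) :
    g '' A ⊆ ω'.region := by
  rw [M.region]; exact Set.image_mono h

theorem segment_subset (M : Mirror g ω ω') {p q : Plane} (h : segment ℝ p q ⊆ ω.region) :
    segment ℝ (g p) (g q) ⊆ ω'.region := by
  rw [← image_segment_equiv]; exact M.subset_region h

theorem segment_subset' (M : Mirror g ω ω') {p q : Plane} (h : segment ℝ p q ⊆ ω'.region) :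
    segment ℝ (g p) (g q) ⊆ ω.region := M.symm.segment_subset h

theorem isExtremeEdge (M : Mirror g ω ω') {e : Set Plane} (h : ω.IsExtremeEdge e) :
    ω'.IsExtremeEdge (g '' e) := by
  obtain ⟨⟨i, rfl⟩, h⟩ := h
  refine ⟨M.edge i, ?_⟩
  rw [M.region, M.box, ← image_frontier_equiv]
  exact Set.image_mono h

theorem isExtremeCorner (M : Mirror g ω ω') {c : Plane} (h : ω.IsExtremeCorner c) :
    ω'.IsExtremeCorner (g c) := by
  obtain ⟨⟨i, rfl⟩, e, e', he, he', hne, h1, h2⟩ := h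
  exact ⟨M.vertex i, _, _, M.isExtremeEdge he, M.isExtremeEdge he',
    fun h => hne (g.injective.image_injective h), ⟨_, h1, rfl⟩, ⟨_, h2, rfl⟩⟩

theorem isPartialStaircase (M : Mirror g ω ω') {c : Plane} (h : ω.IsPartialStaircase c) :
    ω'.IsPartialStaircase (g c) := by
  refine ⟨M.isExtremeCorner h.1, fun c' hc' => ?_⟩
  rw [← h.2 _ (M.symm.isExtremeCorner hc'), M.involutive]

theorem isOneCornerPath (M : Mirror g ω ω') {p q : Plane} {P : Set Plane}
    (h : IsOneCornerPath p q P) : IsOneCornerPath (g p) (g q) (g '' P) := by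
  have e : ∀ p q : Plane, g (p.1, q.2) = ((g p).1, (g q).2) := fun p q =>
    Prod.ext (M.fst_eq.2 rfl) (M.snd_eq.2 rfl)
  rcases h with rfl | rfl
  · left
    rw [Set.image_union, image_segment_equiv, image_segment_equiv, ← e]
  · right
    rw [Set.image_union, image_segment_equiv, image_segment_equiv, ← e]

theorem mem_interior (M : Mirror g ω ω') {p : Plane} :
    p ∈ interior ω'.region ↔ g p ∈ interior ω.region := by
  rw [M.region, ← image_interior_equiv, M.mem_image]

theorem isSkeleton (M : Mirror g ω ω') {S : Set (Set Plane)} (h : ω.IsSkeleton S) :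
    ω'.IsSkeleton (Set.image g '' S) := by
  refine ⟨?_, fun p q hp hq hall P hP => ?_⟩
  · rintro _ ⟨s, hs, rfl⟩
    obtain ⟨⟨x, y, hxy, rfl⟩, hsub⟩ := h.1 s hs
    exact ⟨⟨g x, g y, fun e => hxy (g.injective e), image_segment_equiv g x y⟩,
      M.subset_region hsub⟩
  · rw [M.mem_interior] at hp hq
    obtain ⟨s, hs, z, hz, hzs⟩ := h.2 (g p) (g q) hp hq (fun Q hQ => by
      have hQ' := M.isOneCornerPath hQ
      rw [M.involutive, M.involutive] at hQ'
      obtain ⟨z, hz, hzi⟩ := hall _ hQ'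
      exact ⟨g z, M.mem_image.1 hz, M.mem_interior.1 hzi⟩) _ (M.isOneCornerPath hP)
    exact ⟨_, ⟨s, hs, rfl⟩, g z, M.mem_image.1 hz, ⟨z, hzs, rfl⟩⟩

theorem isMinimumSkeleton (M : Mirror g ω ω') {S : Set (Set Plane)} (h : ω.IsMinimumSkeleton S) :
    ω'.IsMinimumSkeleton (Set.image g '' S) := by
  have henc : ∀ T : Set (Set Plane), (Set.image g '' T).encard = T.encard := fun T =>
    g.injective.image_injective.encard_image T
  refine ⟨M.isSkeleton h.1, fun S' hS' => ?_⟩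
  rw [henc, ← henc S']
  exact h.2 _ (M.symm.isSkeleton hS')

theorem isVisibilityEdge (M : Mirror g ω ω') {u v : Plane} (h : ω.IsVisibilityEdge u v) :
    ω'.IsVisibilityEdge (g u) (g v) := by
  refine ⟨fun e => h.1 (g.injective e), M.segment_subset h.2.1, fun u' v' h1 h2 => ?_⟩
  have h3 := h.2.2 (g u') (g v') (by
    have := Set.image_mono (f := g) h1
    rwa [image_segment_equiv, image_segment_equiv, M.involutive, M.involutive] at this)
    (M.segment_subset' h2)
  rw [← image_segment_equiv, ← h3, image_segment_equiv, M.involutive, M.involutive]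

theorem isVisibilityEdge' (M : Mirror g ω ω') {u v : Plane} (h : ω'.IsVisibilityEdge u v) :
    ω.IsVisibilityEdge (g u) (g v) := M.symm.isVisibilityEdge h

theorem mutuallyVisible (M : Mirror g ω ω') {e e' : Set Plane} (h : ω.MutuallyVisible e e') :
    ω'.MutuallyVisible (g '' e) (g '' e') := by
  obtain ⟨p, hp, q, hq, h⟩ := h
  exact ⟨g p, ⟨p, hp, rfl⟩, g q, ⟨q, hq, rfl⟩, M.segment_subset h⟩

theorem mutuallyVisible_iff (M : Mirror g ω ω') {e e' : Set Plane} :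
    ω'.MutuallyVisible (g '' e) (g '' e') ↔ ω.MutuallyVisible e e' :=
  ⟨fun h => by simpa [M.image_image] using M.symm.mutuallyVisible h, M.mutuallyVisible⟩

theorem joins (M : Mirror g ω ω') {s e e' : Set Plane} (h : ω.Joins s e e') :
    ω'.Joins (g '' s) (g '' e) (g '' e') := by
  obtain ⟨p, hp, q, hq, rfl, h⟩ := h
  exact ⟨g p, ⟨p, hp, rfl⟩, g q, ⟨q, hq, rfl⟩, image_segment_equiv g p q, M.subset_region h⟩

theorem isCross (M : Mirror g ω ω') {s t : Set Plane} (h : ω.IsCross s t) :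
    ω'.IsCross (g '' s) (g '' t) := by
  obtain ⟨⟨e, e', h1, h2, h3, h4, h5, h6⟩, d, d', k1, k2, k3, k4, k5, k6⟩ := h
  exact ⟨⟨_, _, M.isExtremeEdge h1, M.isExtremeEdge h2, fun h => h3 (g.injective.image_injective h),
    M.isHorizontal h4, M.isHorizontal h5, M.joins h6⟩, _, _, M.isExtremeEdge k1,
    M.isExtremeEdge k2, fun h => k3 (g.injective.image_injective h), M.isVertical k4,
    M.isVertical k5, M.joins k6⟩

theorem hasCross (M : Mirror g ω ω') (h : ω.HasCross) : ω'.HasCross := by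
  obtain ⟨s, t, h⟩ := h
  exact ⟨_, _, M.isCross h⟩

theorem euclLength_eq (M : Mirror g ω ω') (p q : Plane) :
    euclLength (g p) (g q) = euclLength p q := by
  unfold euclLength
  rw [← sq_abs, M.fst, sq_abs, ← sq_abs ((g p).2 - _), M.snd, sq_abs]

theorem isMaxLengthAdjacent (M : Mirror g ω ω') {e e' s : Set Plane}
    (h : ω.IsMaxLengthAdjacent e e' s) : ω'.IsMaxLengthAdjacent (g '' e) (g '' e') (g '' s) := by
  obtain ⟨p, hp, q, hq, rfl, h, hmax⟩ := h
  refine ⟨g p, ⟨p, hp, rfl⟩, g q, ⟨q, hq, rfl⟩, image_segment_equiv g p q, M.segment_subset h,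
    fun p' hp' q' hq' h' => ?_⟩
  rw [M.euclLength_eq, ← M.euclLength_eq p']
  exact hmax _ (M.mem_image.1 hp') _ (M.mem_image.1 hq') (M.segment_subset' h')

theorem advancesHV (M : Mirror g ω ω') {c v w : Plane} :
    AdvancesHV (g c) (g v) w ↔ AdvancesHV c v (g w) := by
  unfold AdvancesHV
  rw [M.fst, M.snd, ← M.fst w, ← M.snd w, M.involutive]

theorem advancesVH (M : Mirror g ω ω') {c v w : Plane} :
    AdvancesVH (g c) (g v) w ↔ AdvancesVH c v (g w) := by
  unfold AdvancesVH
  rw [M.fst, M.snd, ← M.fst w, ← M.snd w, M.involutive]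

theorem isMaximalExtremeEdge (M : Mirror g ω ω') {c : Plane} {e s : Set Plane}
    (h : ω.IsMaximalExtremeEdge c e s) : ω'.IsMaximalExtremeEdge (g c) (g '' e) (g '' s) := by
  obtain ⟨u, v, rfl, hu, huv, h⟩ := h
  refine ⟨g u, g v, image_segment_equiv g u v, ⟨u, hu, rfl⟩, M.isVisibilityEdge huv, ?_⟩
  rcases h with ⟨h1, h2⟩ | ⟨h1, h2⟩
  · exact Or.inl ⟨M.isHorizontal h1, fun u' v' h3 h4 =>
      M.advancesVH.2 (h2 _ _ (M.mem_image.1 h3) (M.isVisibilityEdge' h4))⟩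
  · exact Or.inr ⟨M.isVertical h1, fun u' v' h3 h4 =>
      M.advancesHV.2 (h2 _ _ (M.mem_image.1 h3) (M.isVisibilityEdge' h4))⟩

theorem isFrontier (M : Mirror g ω ω') {S : Set (Set Plane)} {f : Set Plane}
    (h : ω.IsFrontier S f) : ω'.IsFrontier (Set.image g '' S) (g '' f) := by
  obtain ⟨p, hp, rfl⟩ := h
  have e : frontier (boundingBox (⋃₀ (Set.image g '' S))) ∩ interior ω'.region =
      g '' (frontier (boundingBox (⋃₀ S)) ∩ interior ω.region) := by
    rw [← Set.image_sUnion, M.box, M.region, ← image_frontier_equiv, ← image_interior_equiv,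
      Set.image_inter g.injective]
  refine ⟨g p, e ▸ ⟨p, hp, rfl⟩, ?_⟩
  rw [e, g.image_closure]
  congr 1
  exact g.toHomeomorph.image_connectedComponentIn hp

theorem exists_isFrontier_iff (M : Mirror g ω ω') {S : Set (Set Plane)} :
    (∃ f, ω'.IsFrontier (Set.image g '' S) f) ↔ ∃ f, ω.IsFrontier S f :=
  ⟨fun ⟨f, h⟩ => ⟨_, by simpa only [M.image_image_image] using M.symm.isFrontier h⟩,
    fun ⟨f, h⟩ => ⟨_, M.isFrontier h⟩⟩

theorem isFrontierEdge (M : Mirror g ω ω') {f : Set Plane} {u v : Plane}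
    (h : ω.IsFrontierEdge f u v) : ω'.IsFrontierEdge (g '' f) (g u) (g v) := by
  refine ⟨M.isVisibilityEdge h.1, ?_⟩
  rw [← image_segment_equiv, ← Set.image_inter g.injective]
  exact h.2.image _

theorem isMaximalFrontierEdge (M : Mirror g ω ω') {c : Plane} {f s : Set Plane}
    (h : ω.IsMaximalFrontierEdge c f s) : ω'.IsMaximalFrontierEdge (g c) (g '' f) (g '' s) := by
  obtain ⟨u, v, rfl, huv, h⟩ := h
  have hinv : ∀ u' v', ω'.IsFrontierEdge (g '' f) u' v' → ω.IsFrontierEdge f (g u') (g v') :=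
    fun u' v' h' => by simpa only [M.image_image] using M.symm.isFrontierEdge h'
  refine ⟨g u, g v, image_segment_equiv g u v, M.isFrontierEdge huv, ?_⟩
  rw [M.isHorizontal_iff, M.isVertical_iff]
  rcases h with ⟨h1, h2⟩ | ⟨h1, h2⟩
  · exact Or.inl ⟨h1, fun u' v' h' => M.advancesHV.2 (h2 _ _ (hinv u' v' h'))⟩
  · exact Or.inr ⟨h1, fun u' v' h' => M.advancesVH.2 (h2 _ _ (hinv u' v' h'))⟩

theorem areFarEdges (M : Mirror g ω ω') {c : Plane} {e e' : Set Plane}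
    (h : ω.AreFarEdges c e e') : ω'.AreFarEdges (g c) (g '' e) (g '' e') := by
  obtain ⟨h1, h2, h3, h4, h5⟩ := h
  exact ⟨M.isExtremeEdge h1, M.isExtremeEdge h2, fun h => h3 (g.injective.image_injective h),
    fun h => h4 ((apply_mem _).1 h), fun h => h5 ((apply_mem _).1 h)⟩

theorem inter_corner {c : Plane} {s : Set Plane} :
    (g '' s ∩ {g c}).Nonempty ↔ (s ∩ {c}).Nonempty := by
  rw [← Set.image_singleton, ← Set.image_inter g.injective, Set.image_nonempty]

theorem staircaseStep (M : Mirror g ω ω') {c : Plane} {σ σ' : State}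
    (h : ω.StaircaseStep c σ σ') : ω'.StaircaseStep (g c) (σ.image g) (σ'.image g) := by
  cases h with
  | finish S f s hs hc =>
    simp only [State.image, Set.image_insert_eq]
    exact .finish _ _ _ (M.isMaximalFrontierEdge hs) (inter_corner.2 hc)
  | add S f s hs hc =>
    simp only [State.image, Set.image_insert_eq]
    exact .add _ _ _ (M.isMaximalFrontierEdge hs) (fun h => hc (inter_corner.1 h))
  | newFrontier S f hf => exact .newFrontier _ _ (M.isFrontier hf)

theorem partialStaircaseStart (M : Mirror g ω ω') {c : Plane} {σ : State}
    (h : ω.PartialStaircaseStart c σ) : ω'.PartialStaircaseStart (g c) (σ.image g) := by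
  have hpair : ∀ s t : Set Plane, Set.image g '' {s, t} = {g '' s, g '' t} := fun s t =>
    Set.image_pair _ _ _
  cases h with
  | cross sH sV hX =>
    simp only [State.image, hpair]
    exact .cross _ _ (M.isCross hX)
  | adjacent e₁ e₂ s hX he hvis hs =>
    simp only [State.image, Set.image_singleton]
    exact .adjacent _ _ _ (fun h => hX (M.symm.hasCross h)) (M.areFarEdges he)
      (M.mutuallyVisible hvis) (M.isMaxLengthAdjacent hs)
  | pair e₁ e₂ s₁ s₂ hX he hvis hs₁ hs₂ hf =>
    rw [← M.exists_isFrontier_iff] at hf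
    simp only [State.image, hpair] at hf ⊢
    exact .pair _ _ _ _ (fun h => hX (M.symm.hasCross h)) (M.areFarEdges he)
      (fun h => hvis (M.mutuallyVisible_iff.1 h)) (M.isMaximalExtremeEdge hs₁)
      (M.isMaximalExtremeEdge hs₂) hf
  | pairComplete e₁ e₂ s₁ s₂ hX he hvis hs₁ hs₂ hf =>
    rw [← M.exists_isFrontier_iff] at hf
    simp only [State.image, hpair] at hf ⊢
    exact .pairComplete _ _ _ _ (fun h => hX (M.symm.hasCross h)) (M.areFarEdges he)
      (fun h => hvis (M.mutuallyVisible_iff.1 h)) (M.isMaximalExtremeEdge hs₁)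
      (M.isMaximalExtremeEdge hs₂) hf

theorem state_image_image (M : Mirror g ω ω') (σ : State) : (σ.image g).image g = σ := by
  cases σ <;> simp only [State.image, M.image_image_image, M.image_image]

theorem reachable (M : Mirror g ω ω') {c : Plane} {σ : State} (h : ω.Reachable c σ) :
    ω'.Reachable (g c) (σ.image g) := by
  obtain ⟨σ₀, h₀, hr⟩ := h
  refine ⟨_, M.partialStaircaseStart h₀, ?_⟩
  induction hr with
  | refl => exact .refl
  | tail _ hs ih => exact ih.tail (M.staircaseStep hs)

theorem correct (M : Mirror g ω ω') {c : Plane} (h : ω.Correct c) : ω'.Correct (g c) := by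
  have hg : g (g c) = c := M.involutive c
  obtain ⟨⟨σ, hσ⟩, h2, h3, h4⟩ := h
  refine ⟨⟨_, M.partialStaircaseStart hσ⟩, fun σ hσ => ?_, ?_, fun S hS => ?_⟩
  · have hr := M.symm.reachable hσ
    rw [hg] at hr
    rcases h2 _ hr with ⟨S, hS⟩ | ⟨σ', hσ'⟩
    · refine Or.inl ⟨Set.image g '' S, ?_⟩
      rw [← M.state_image_image σ, hS]
      rfl
    · have := M.staircaseStep hσ'
      rw [M.state_image_image] at this
      exact Or.inr ⟨_, this⟩
  · rintro ⟨run, h0, hrun⟩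
    refine h3 ⟨fun k => (run k).image g, ?_, fun k => ?_⟩
    · simpa only [hg] using M.symm.partialStaircaseStart h0
    · simpa only [hg] using M.symm.staircaseStep (hrun k)
  · have hr := M.symm.reachable hS
    rw [hg] at hr
    have := M.isMinimumSkeleton (h4 _ hr)
    rwa [M.image_image_image] at this

end Mirror

/-- The identity, or the reflection in the origin if `b` is true. -/
noncomputable def reflectLine (b : Bool) : ℝ ≃L[ℝ] ℝ :=
  if b then ContinuousLinearEquiv.neg ℝ else ContinuousLinearEquiv.refl ℝ ℝ

theorem reflectLine_true (x : ℝ) : reflectLine true x = -x := rfl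

theorem reflectLine_false (x : ℝ) : reflectLine false x = x := rfl

/-- The reflection of the coordinates that are marked by `true`. -/
noncomputable def reflect (b d : Bool) : Plane ≃L[ℝ] Plane :=
  (reflectLine b).prodCongr (reflectLine d)

theorem reflect_apply (b d : Bool) (p : Plane) :
    reflect b d p = (reflectLine b p.1, reflectLine d p.2) := rfl

theorem abs_reflectLine (b : Bool) (x y : ℝ) : |reflectLine b x - reflectLine b y| = |x - y| := by
  cases b
  · rfl
  · rw [reflectLine_true, reflectLine_true, abs_sub_comm]
    congr 1
    ring

/-- Reflections preserve bounding intervals, even the meaningless ones of unbounded and of empty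
sets. -/
theorem image_reflectLine_Icc (b : Bool) (s : Set ℝ) :
    reflectLine b '' Set.Icc (sInf s) (sSup s) =
      Set.Icc (sInf (reflectLine b '' s)) (sSup (reflectLine b '' s)) := by
  cases b
  · have : ∀ t : Set ℝ, reflectLine false '' t = t := fun t => Set.image_id t
    rw [this, this]
  · have : ∀ t : Set ℝ, reflectLine true '' t = -t := fun t => Set.image_neg_eq_neg
    rw [this, this, Set.neg_Icc, Real.sInf_def (-s), neg_neg, Real.sInf_def s, neg_neg]

theorem boundingBox_reflect (b d : Bool) (A : Set Plane) :
    boundingBox (reflect b d '' A) = reflect b d '' boundingBox A := by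
  have h1 : Prod.fst '' (reflect b d '' A) = reflectLine b '' (Prod.fst '' A) := by
    rw [← Set.image_comp, ← Set.image_comp]; rfl
  have h2 : Prod.snd '' (reflect b d '' A) = reflectLine d '' (Prod.snd '' A) := by
    rw [← Set.image_comp, ← Set.image_comp]; rfl
  have h3 : ∀ s t : Set ℝ, reflect b d '' (s ×ˢ t) = (reflectLine b '' s) ×ˢ (reflectLine d '' t) :=
    fun s t => (Set.prodMap_image_prod _ _ s t)
  unfold boundingBox
  rw [h1, h2, ← Set.Icc_prod_Icc, ← Set.Icc_prod_Icc, h3, image_reflectLine_Icc,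
    image_reflectLine_Icc]

theorem reflect_reflect (b d : Bool) (p : Plane) : reflect b d (reflect b d p) = p := by
  cases b <;> cases d <;>
    simp [reflect_apply, reflectLine_true, reflectLine_false]

theorem abs_reflect (b d : Bool) (p q : Plane) :
    |(reflect b d p).1 - (reflect b d q).1| = |p.1 - q.1| ∧
      |(reflect b d p).2 - (reflect b d q).2| = |p.2 - q.2| :=
  ⟨abs_reflectLine b _ _, abs_reflectLine d _ _⟩

/-- The mirror image of an obstacle. -/
noncomputable def Obstacle.reflect (ω : Obstacle) (b d : Bool) : Obstacle :=
  ω.map (RectSkeleton.reflect b d)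
    (fun _ _ h => h.imp (congrArg (reflectLine b)) (congrArg (reflectLine d)))
    fun p q => congrArg₂ (· + ·) (abs_reflect b d p q).1 (abs_reflect b d p q).2

theorem Obstacle.mirror_reflect (ω : Obstacle) (b d : Bool) :
    Mirror (RectSkeleton.reflect b d) ω (ω.reflect b d) where
  involutive := reflect_reflect b d
  fst p q := (abs_reflect b d p q).1
  snd p q := (abs_reflect b d p q).2
  box := boundingBox_reflect b d
  region := rfl
  vertex i := ⟨i, rfl⟩
  vertex' i := ⟨i, reflect_reflect b d _⟩
  edge i := ⟨i, image_segment_equiv _ _ _⟩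
  edge' i := ⟨i, by
    unfold Obstacle.edge
    rw [image_segment_equiv]
    exact congrArg₂ _ (reflect_reflect b d _) (reflect_reflect b d _)⟩

/-- Some reflection moves the extreme corner to the top right. -/
theorem Obstacle.IsPartialStaircase.exists_reflect {ω : Obstacle} {c : Plane}
    (h : ω.IsPartialStaircase c) : ∃ b d, ∀ w ∈ (ω.reflect b d).region,
      w.1 ≤ (RectSkeleton.reflect b d c).1 ∧ w.2 ≤ (RectSkeleton.reflect b d c).2 := by
  obtain ⟨a, e, hbox, hac, -⟩ := ω.exists_boundingBox
  obtain ⟨h1, h2⟩ := h.1.eq hbox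
  have key : ∀ (π : Plane → ℝ), (∀ w ∈ ω.region, π a ≤ π w ∧ π w ≤ π e) → (π c = π a ∨ π c = π e) →
      ∃ b, ∀ w ∈ ω.region, reflectLine b (π w) ≤ reflectLine b (π c) := by
    intro π hπ hc
    rcases hc with hc | hc
    · refine ⟨true, fun w hw => ?_⟩
      rw [reflectLine_true, reflectLine_true, hc]
      exact neg_le_neg (hπ w hw).1
    · refine ⟨false, fun w hw => ?_⟩
      rw [reflectLine_false, reflectLine_false, hc]
      exact (hπ w hw).2
  obtain ⟨b, hb⟩ := key Prod.fst (fun w hw => ⟨(hac w hw).1.1, (hac w hw).2.1⟩) h1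
  obtain ⟨d, hd⟩ := key Prod.snd (fun w hw => ⟨(hac w hw).1.2, (hac w hw).2.2⟩) h2
  refine ⟨b, d, ?_⟩
  rintro _ ⟨w, hw, rfl⟩
  exact ⟨hb w hw, hd w hw⟩

theorem Obstacle.IsPartialStaircase.correct {ω : Obstacle} {c : Plane}
    (h : ω.IsPartialStaircase c) : ω.Correct c := by
  obtain ⟨b, d, hle⟩ := h.exists_reflect
  have M := ω.mirror_reflect b d
  obtain ⟨a, lo, hi, en, hst, hbox⟩ := (M.isPartialStaircase h).exists_staircase hle
  have := M.symm.correct (Obstacle.correct_of_staircase hst hbox)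
  rwa [M.involutive] at this

end RectSkeleton

/-- PartialStaircaseSkeleton is correct on every partial staircase `ω` with extreme corner `c`: it
can start, it never gets stuck, no run is infinite, and, whatever choices are made, the set of
edges that it returns is a minimum skeleton for `ω`. -/
theorem mainTheorem4 (ω : RectSkeleton.Obstacle) (c : RectSkeleton.Plane)
    (hω : ω.IsPartialStaircase c) :
    (∃ σ, ω.PartialStaircaseStart c σ) ∧
    (∀ σ, ω.Reachable c σ →
      (∃ S, σ = RectSkeleton.State.halt S) ∨ ∃ σ', ω.StaircaseStep c σ σ') ∧
    (¬ ∃ run : ℕ → RectSkeleton.State, ω.PartialStaircaseStart c (run 0) ∧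
      ∀ k, ω.StaircaseStep c (run k) (run (k + 1))) ∧
    (∀ S, ω.Reachable c (RectSkeleton.State.halt S) → ω.IsMinimumSkeleton S) := by
  exact hω.correct
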